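/- **Setting.** A tabular episodic zero-sum Markov game has a horizon $H$, a finite state set $\mathcal S$ with $|\mathcal S|\le S$, finite action sets $\mathcal A$ (max-player, $A=|\mathcal A|\ge 1$) and $\mathcal B$ (min-player, $B=|\mathcal B|\ge 1$), transition kernels $\mathbb P_h(\cdot\mid s,a,b)$, deterministic rewards $r_h(s,a,b)\in[0,1]$ ($h=1,\dots,H$) and a fixed initial state $s_1$. A general policy of a player is a set of maps from a random seed $z$ (drawn once, from some distribution, independently of everything else) and the history $(s_1,a_1,b_1,r_1,\dots,s_h)$ to distributions over that player's actions. $V_1^{\mu,\nu}(s_1)$ is the expected cumulative reward of an episode under general policies $\mu,\nu$; $V_1^{\dagger,\nu}(s_1)=\sup_\mu V_1^{\mu,\nu}(s_1)$ and $V_1^{\mu,\dagger}(s_1)=\inf_\nu V_1^{\mu,\nu}(s_1)$ over all general policies. A pair $(\hat\mu,\hat\nu)$ is an $\epsilon$-approximate Nash equilibrium if $V_1^{\dagger,\hat\nu}(s_1)-V_1^{\hat\mu,\dagger}(s_1)\le\epsilon$. **Nash V-learning.** Let $\alpha_t=\frac{H+1}{H+t}$ and $\alpha_t^i=\alpha_i\prod_{j=i+1}^t(1-\alpha_j)$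 for $1\le i\le t$. With a parameter $c>0$, $T=HK$ and $\iota=\log(SABT/p)$, let $$\overline\eta_t=\sqrt{\tfrac{\iota}{At}},\quad \underline\eta_t=\sqrt{\tfrac{\iota}{Bt}},\quad \overline\beta_t=c\sqrt{\tfrac{H^4A\iota}{t}},\quad \underline\beta_t=c\sqrt{\tfrac{H^4B\iota}{t}}.$$ The max-player keeps $\widetilde V_h(s)$ (initially $H+1-h$), $\overline L_h(s,a)$ (initially $0$), $N_h(s)$ (initially $0$) and $\mu_h(\cdot\mid s)$ (initially uniform), and writes $\overline V_h(s)=\min\{H+1-h,\widetilde V_h(s)\}$, $\overline V_{H+1}=0$. The min-player keeps $\underset{\sim}{V}{}_h(s)$ (initially $0$), $\underline L_h(s,b)$ (initially $0$), the same counts $N_h(s)$ and $\nu_h(\cdot\mid s)$ (initially uniform), and writes $\underline V_h(s)=\max\{0,\underset{\sim}{V}{}_h(s)\}$, $\underline V_{H+1}=0$. In each of $K\ge 1$ episodes and for $h=1,\dots,H$ they draw independently $a_h\sim\mu_h(\cdot\mid s_h)$, $b_h\sim\nu_h(\cdot\mid s_h)$, observe $r_h=r_h(s_h,a_h,b_h)$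 and $s_{h+1}\sim\mathbb P_h(\cdot\mid s_h,a_h,b_h)$, set $t=N_h(s_h)\leftarrow N_h(s_h)+1$, and update $$\widetilde V_h(s_h)\leftarrow(1-\alpha_t)\widetilde V_h(s_h)+\alpha_t\big(r_h+\overline V_{h+1}(s_{h+1})+\overline\beta_t\big),$$ $$\underset{\sim}{V}{}_h(s_h)\leftarrow(1-\alpha_t)\underset{\sim}{V}{}_h(s_h)+\alpha_t\big(r_h+\underline V_{h+1}(s_{h+1})-\underline\beta_t\big),$$ $$\overline L_h(s_h,a)\leftarrow(1-\alpha_t)\overline L_h(s_h,a)+\alpha_t\frac{H+1-h-r_h-\overline V_{h+1}(s_{h+1})}{\mu_h(a_h\mid s_h)+\overline\eta_t}\,\mathbb 1\{a=a_h\}\quad(a\in\mathcal A),$$ $$\underline L_h(s_h,b)\leftarrow(1-\alpha_t)\underline L_h(s_h,b)+\alpha_t\frac{r_h+\underline V_{h+1}(s_{h+1})}{\nu_h(b_h\mid s_h)+\underline\eta_t}\,\mathbb 1\{b=b_h\}\quad(b\in\mathcal B),$$ and then $\mu_h(\cdot\mid s_h)\propto\exp[-(\overline\eta_t/\alpha_t)\overline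 L_h(s_h,\cdot)]$, $\nu_h(\cdot\mid s_h)\propto\exp[-(\underline\eta_t/\alpha_t)\underline L_h(s_h,\cdot)]$. **Certified policies.** Let $\mu^k,\nu^k$ be the policies at the beginning of episode $k$, $N_h^k(s)$ the number of visits to $s$ at step $h$ before episode $k$, and $k_h^i(s)$ the episode of the $i$-th such visit. The policy $\hat\mu$ draws $k$ uniformly from $\{1,\dots,K\}$; then at each step $h=1,\dots,H$ it observes $s_h$, puts $t=N_h^k(s_h)$, draws $m\in\{1,\dots,t\}$ with $\Pr(m=i)=\alpha_t^i$, replaces $k$ by $k_h^m(s_h)$ (if $t=0$, $k$ is kept), and plays $a_h\sim\mu_h^k(\cdot\mid s_h)$. The policy $\hat\nu$ is defined in the same way from $\nu^1,\dots,\nu^K$. **Theorem.** For every sufficiently large absolute constant $c$ there is a constant $C>0$, depending only on $c$, such that for every game as above, every $p\in(0,1]$, $\epsilon>0$ and $K\ge1$ with $$K\ \ge\ C\,\frac{H^6S(A+B)\,\iota}{\epsilon^2},\qquad \iota=\log(SABHK/p),$$ if both players run Nash V-learning for $K$ episodes, then with probability at least $1-p$ the certified policies $(\hat\mu,\hat\nu)$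 form an $\epsilon$-approximate Nash equilibrium: $V_1^{\dagger,\hat\nu}(s_1)-V_1^{\hat\mu,\dagger}(s_1)\le\epsilon$. -/

import Mathlib

open MeasureTheory

universe u v w x

namespace NashV

/-! ### Zero-sum episodic Markov games

Steps are numbered from `0` to `H - 1`, so that step `h` below is step `h + 1` in the usual
numbering from `1` to `H`. -/

/-- A tabular episodic zero-sum Markov game with horizon `H`, transition kernels `P h`, deterministic
rewards `r h` with values in `[0, 1]` and a fixed initial state. Only the data at the steps `h < H`
are ever used. -/
structure MarkovGame (𝒮 : Type u) (𝒜 : Type v) (ℬ : Type w) where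
  H : ℕ
  P : ℕ → 𝒮 → 𝒜 → ℬ → PMF 𝒮
  r : ℕ → 𝒮 → 𝒜 → ℬ → ℝ
  r_nonneg : ∀ h, h < H → ∀ s a b, 0 ≤ r h s a b
  r_le_one : ∀ h, h < H → ∀ s a b, r h s a b ≤ 1
  s₁ : 𝒮

/-- What has been observed before the current state: the list, in chronological order, of the tuples
(state, action of the max-player, action of the min-player, reward). -/
abbrev History (𝒮 : Type u) (𝒜 : Type v) (ℬ : Type w) := List (𝒮 × 𝒜 × ℬ × ℝ)

/-- A general policy of a player with action set `𝒳`: a random seed `z ~ 𝒟`, drawn once and shared by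
all steps, and a map from the seed, the history and the current state to a distribution over actions.
The step is the length of the history. -/
structure GeneralPolicy (𝒮 : Type u) (𝒜 : Type v) (ℬ : Type w) (𝒳 : Type x) where
  Z : Type u
  [measurableSpace : MeasurableSpace Z]
  𝒟 : Measure Z
  [isProbabilityMeasure : IsProbabilityMeasure 𝒟]
  act : Z → History 𝒮 𝒜 ℬ → 𝒮 → PMF 𝒳
  measurable_act : ∀ hist s a, Measurable fun z => act z hist s a

attribute [instance] GeneralPolicy.measurableSpace GeneralPolicy.isProbabilityMeasure

/-- One step of play: (state, action of the max-player, action of the min-player, next state). -/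
abbrev Transition (𝒮 : Type u) (𝒜 : Type v) (ℬ : Type w) := 𝒮 × 𝒜 × ℬ × 𝒮

namespace MarkovGame

variable {𝒮 : Type u} {𝒜 : Type v} {ℬ : Type w}

/-- The law of the next `n` steps of play from state `s` after the history `hist`, when the players
use history-dependent policies `μ` and `ν` (with their seeds fixed): the two actions are drawn
independently, then the next state is drawn from the transition kernel. -/
noncomputable def rollout (G : MarkovGame 𝒮 𝒜 ℬ)
    (μ : History 𝒮 𝒜 ℬ → 𝒮 → PMF 𝒜) (ν : History 𝒮 𝒜 ℬ → 𝒮 → PMF ℬ) :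
    (n : ℕ) → History 𝒮 𝒜 ℬ → 𝒮 → PMF (Fin n → Transition 𝒮 𝒜 ℬ)
  | 0, _, _ => PMF.pure Fin.elim0
  | n + 1, hist, s =>
      (μ hist s).bind fun a => (ν hist s).bind fun b =>
        (G.P hist.length s a b).bind fun s' =>
          (rollout G μ ν n (hist ++ [(s, a, b, G.r hist.length s a b)]) s').map
            fun τ => Fin.cons (s, a, b, s') τ

/-- The law of a full episode, started at the initial state. -/
noncomputable def episodeLaw (G : MarkovGame 𝒮 𝒜 ℬ)
    (μ : History 𝒮 𝒜 ℬ → 𝒮 → PMF 𝒜) (ν : History 𝒮 𝒜 ℬ → 𝒮 → PMF ℬ) :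
    PMF (Fin G.H → Transition 𝒮 𝒜 ℬ) :=
  G.rollout μ ν G.H [] G.s₁

/-- The cumulative reward of an episode. -/
noncomputable def totalReward (G : MarkovGame 𝒮 𝒜 ℬ) (τ : Fin G.H → Transition 𝒮 𝒜 ℬ) : ℝ :=
  ∑ h : Fin G.H, G.r h (τ h).1 (τ h).2.1 (τ h).2.2.1

variable [Fintype 𝒮] [Fintype 𝒜] [Fintype ℬ]

/-- The value `V₁^{μ,ν}(s₁)` of a pair of general policies: the expected cumulative reward of an
episode, also averaged over the independent seeds of the two players. -/
noncomputable def value (G : MarkovGame 𝒮 𝒜 ℬ)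
    (μ : GeneralPolicy 𝒮 𝒜 ℬ 𝒜) (ν : GeneralPolicy 𝒮 𝒜 ℬ ℬ) : ℝ :=
  ∫ z, ∫ z', ∑ τ, (G.episodeLaw (μ.act z) (ν.act z') τ).toReal * G.totalReward τ ∂ν.𝒟 ∂μ.𝒟

/-- `V₁^{†,ν}(s₁)`, the value of the best response of the max-player to `ν`. -/
noncomputable def maxBestResponseValue (G : MarkovGame 𝒮 𝒜 ℬ) (ν : GeneralPolicy 𝒮 𝒜 ℬ ℬ) : ℝ :=
  ⨆ μ : GeneralPolicy 𝒮 𝒜 ℬ 𝒜, G.value μ ν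

/-- `V₁^{μ,†}(s₁)`, the value of the best response of the min-player to `μ`. -/
noncomputable def minBestResponseValue (G : MarkovGame 𝒮 𝒜 ℬ) (μ : GeneralPolicy 𝒮 𝒜 ℬ 𝒜) : ℝ :=
  ⨅ ν : GeneralPolicy 𝒮 𝒜 ℬ ℬ, G.value μ ν

/-- `(μ, ν)` is an `ε`-approximate Nash equilibrium. -/
def IsApproxNash (G : MarkovGame 𝒮 𝒜 ℬ) (ε : ℝ)
    (μ : GeneralPolicy 𝒮 𝒜 ℬ 𝒜) (ν : GeneralPolicy 𝒮 𝒜 ℬ ℬ) : Prop :=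
  G.maxBestResponseValue ν - G.minBestResponseValue μ ≤ ε

end MarkovGame

/-! ### Hyperparameters -/

/-- The learning rate `α_t = (H + 1) / (H + t)`. -/
noncomputable def lr (H t : ℕ) : ℝ := ((H : ℝ) + 1) / (H + t)

/-- `α_t^i = α_i ∏_{j = i+1}^t (1 - α_j)`, for `1 ≤ i ≤ t`. -/
noncomputable def lrWeight (H t i : ℕ) : ℝ := lr H i * ∏ j ∈ Finset.Icc (i + 1) t, (1 - lr H j)

/-- The step size `η_t = √(ι / (m t))` of a player with `m` actions. -/
noncomputable def stepSize (m : ℕ) (ι : ℝ) (t : ℕ) : ℝ := √(ι / (m * t))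

/-- The bonus `β_t = c √(H⁴ m ι / t)` of a player with `m` actions. -/
noncomputable def bonus (H m : ℕ) (c ι : ℝ) (t : ℕ) : ℝ := c * √((H : ℝ) ^ 4 * m * ι / t)

theorem lrWeight_nonneg (H t i : ℕ) : 0 ≤ lrWeight H t i := by
  refine mul_nonneg (by unfold lr; positivity) (Finset.prod_nonneg fun j hj => ?_)
  have hj1 : (1 : ℝ) ≤ j := by
    have := (Finset.mem_Icc.1 hj).1
    exact_mod_cast (by omega : 1 ≤ j)
  have hpos : (0 : ℝ) < H + j := by positivity
  rw [lr, sub_nonneg, div_le_one hpos]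
  linarith

theorem lrWeight_sum (H t : ℕ) (ht : 0 < t) : ∑ i : Fin t, lrWeight H t (i + 1) = 1 := by
  induction t, ht using Nat.le_induction with
  | base =>
    have : (H : ℝ) + 1 ≠ 0 := by positivity
    simp [lrWeight, lr, this]
  | succ n hn ih =>
    rw [Fin.sum_univ_castSucc]
    have h1 : ∀ i : Fin n, lrWeight H (n + 1) ((i.castSucc : Fin (n + 1)) + 1)
        = lrWeight H n (i + 1) * (1 - lr H (n + 1)) := by
      intro i
      have hi : (i : ℕ) + 1 + 1 ≤ n + 1 := by omega
      simp only [lrWeight, Fin.val_castSucc]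
      rw [Finset.prod_Icc_succ_top hi, mul_assoc]
    simp only [h1]
    rw [← Finset.sum_mul, ih]
    simp [lrWeight]

/-- The distribution on visit numbers with `P(m = i) = α_t^i`; the index `i : Fin t` stands for the
visit number `i + 1`. -/
noncomputable def visitWeights (H t : ℕ) (ht : 0 < t) : PMF (Fin t) :=
  PMF.ofFintype (fun i => ENNReal.ofReal (lrWeight H t (i + 1))) (by
    rw [← ENNReal.ofReal_sum_of_nonneg fun i _ => lrWeight_nonneg H t _, lrWeight_sum H t ht,
      ENNReal.ofReal_one])

/-- The distribution proportional to `exp (-θ L)`. -/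
noncomputable def expWeights {𝒳 : Type x} [Fintype 𝒳] [Nonempty 𝒳] (θ : ℝ) (L : 𝒳 → ℝ) : PMF 𝒳 :=
  PMF.ofFintype (fun a => ENNReal.ofReal (Real.exp (-θ * L a) / ∑ a', Real.exp (-θ * L a'))) (by
    have hpos : 0 < ∑ a', Real.exp (-θ * L a') :=
      Finset.sum_pos (fun _ _ => Real.exp_pos _) Finset.univ_nonempty
    rw [← ENNReal.ofReal_sum_of_nonneg fun a _ => by positivity, ← Finset.sum_div,
      div_self hpos.ne', ENNReal.ofReal_one])

/-! ### Nash V-learning -/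

/-- The tables of one player: running value estimate `V`, weighted cumulative estimated loss `L`,
visit counts `N` and current policy `π`, for every step and state. -/
structure Tables (𝒮 : Type u) (𝒳 : Type x) where
  V : ℕ → 𝒮 → ℝ
  L : ℕ → 𝒮 → 𝒳 → ℝ
  N : ℕ → 𝒮 → ℕ
  π : ℕ → 𝒮 → PMF 𝒳

section Learning

variable {𝒮 : Type u} {𝒜 : Type v} {ℬ : Type w} {𝒳 : Type x}

/-- The update of one player after an episode. `fb h s` is `none` if `s` was not the state at step
`h`; otherwise it is `some (a, y, l)`, with `a` the action played by this player, `y` the target of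
the value update and `l` the loss incurred.

Within an episode, the entry at step `h` is computed from the tables of steps `h` and `h + 1` only,
and step `h + 1` comes later, so that all entries can be updated from the tables at the beginning of
the episode. -/
noncomputable def Tables.update [Fintype 𝒳] [Nonempty 𝒳] [DecidableEq 𝒳] (H : ℕ) (ι : ℝ)
    (T : Tables 𝒮 𝒳) (fb : ℕ → 𝒮 → Option (𝒳 × ℝ × ℝ)) : Tables 𝒮 𝒳 :=
  let η : ℕ → ℝ := stepSize (Fintype.card 𝒳) ι
  let t : ℕ → 𝒮 → ℕ := fun h s => T.N h s + 1
  let L' : ℕ → 𝒮 → 𝒳 → ℝ := fun h s a' =>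
    match fb h s with
    | none => T.L h s a'
    | some (a, _, l) =>
        (1 - lr H (t h s)) * T.L h s a'
          + lr H (t h s) * (if a = a' then l / ((T.π h s a).toReal + η (t h s)) else 0)
  { V := fun h s =>
      match fb h s with
      | none => T.V h s
      | some (_, y, _) => (1 - lr H (t h s)) * T.V h s + lr H (t h s) * y
    L := L'
    N := fun h s => if (fb h s).isSome then t h s else T.N h s
    π := fun h s =>
      if (fb h s).isSome then expWeights (η (t h s) / lr H (t h s)) (L' h s) else T.π h s }

/-- The optimistic estimate of the max-player, truncated at `H - h`, the largest possible cumulative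
reward from step `h` on; it vanishes after the last step. -/
noncomputable def upperV (H : ℕ) (T : Tables 𝒮 𝒜) (h : ℕ) (s : 𝒮) : ℝ :=
  if h < H then min ((H : ℝ) - h) (T.V h s) else 0

/-- The estimate of the min-player, truncated at `0`; it vanishes after the last step. -/
noncomputable def lowerV (H : ℕ) (T : Tables 𝒮 ℬ) (h : ℕ) (s : 𝒮) : ℝ :=
  if h < H then max 0 (T.V h s) else 0

namespace MarkovGame

variable [DecidableEq 𝒮]

section MaxPlayer

variable [Fintype 𝒜] [Nonempty 𝒜] [DecidableEq 𝒜]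

/-- The initial tables of the max-player. -/
noncomputable def maxInit (G : MarkovGame 𝒮 𝒜 ℬ) : Tables 𝒮 𝒜 where
  V h _ := (G.H : ℝ) - h
  L _ _ _ := 0
  N _ _ := 0
  π _ _ := PMF.uniformOfFintype 𝒜

/-- The update of the max-player after an episode `τ`. -/
noncomputable def maxUpdate (G : MarkovGame 𝒮 𝒜 ℬ) (c ι : ℝ) (T : Tables 𝒮 𝒜)
    (τ : Fin G.H → Transition 𝒮 𝒜 ℬ) : Tables 𝒮 𝒜 :=
  T.update G.H ι fun h s =>
    if hh : h < G.H then
      let (s_h, a, b, s') := τ ⟨h, hh⟩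
      if s_h = s then
        let y := G.r h s a b + upperV G.H T (h + 1) s'
        some (a, y + bonus G.H (Fintype.card 𝒜) c ι (T.N h s + 1), (G.H : ℝ) - h - y)
      else none
    else none

/-- The tables of the max-player after the first `k` episodes of `ω`. -/
noncomputable def maxTables (G : MarkovGame 𝒮 𝒜 ℬ) (c ι : ℝ) {K : ℕ}
    (ω : Fin K → Fin G.H → Transition 𝒮 𝒜 ℬ) : ℕ → Tables 𝒮 𝒜
  | 0 => G.maxInit
  | k + 1 => if hk : k < K then G.maxUpdate c ι (maxTables G c ι ω k) (ω ⟨k, hk⟩)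
      else maxTables G c ι ω k

end MaxPlayer

section MinPlayer

variable [Fintype ℬ] [Nonempty ℬ] [DecidableEq ℬ]

/-- The initial tables of the min-player. -/
noncomputable def minInit (_G : MarkovGame 𝒮 𝒜 ℬ) : Tables 𝒮 ℬ where
  V _ _ := 0
  L _ _ _ := 0
  N _ _ := 0
  π _ _ := PMF.uniformOfFintype ℬ

/-- The update of the min-player after an episode `τ`. -/
noncomputable def minUpdate (G : MarkovGame 𝒮 𝒜 ℬ) (c ι : ℝ) (T : Tables 𝒮 ℬ)
    (τ : Fin G.H → Transition 𝒮 𝒜 ℬ) : Tables 𝒮 ℬ :=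
  T.update G.H ι fun h s =>
    if hh : h < G.H then
      let (s_h, a, b, s') := τ ⟨h, hh⟩
      if s_h = s then
        let y := G.r h s a b + lowerV G.H T (h + 1) s'
        some (b, y - bonus G.H (Fintype.card ℬ) c ι (T.N h s + 1), y)
      else none
    else none

/-- The tables of the min-player after the first `k` episodes of `ω`. -/
noncomputable def minTables (G : MarkovGame 𝒮 𝒜 ℬ) (c ι : ℝ) {K : ℕ}
    (ω : Fin K → Fin G.H → Transition 𝒮 𝒜 ℬ) : ℕ → Tables 𝒮 ℬ
  | 0 => G.minInit
  | k + 1 => if hk : k < K then G.minUpdate c ι (minTables G c ι ω k) (ω ⟨k, hk⟩)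
      else minTables G c ι ω k

end MinPlayer

variable [Fintype 𝒜] [Nonempty 𝒜] [DecidableEq 𝒜] [Fintype ℬ] [Nonempty ℬ] [DecidableEq ℬ]

/-- The law of the first `K` episodes when both players run Nash V-learning against each other: each
episode is played with the current policies of the two players. -/
noncomputable def run (G : MarkovGame 𝒮 𝒜 ℬ) (c ι : ℝ) :
    (K : ℕ) → PMF (Fin K → Fin G.H → Transition 𝒮 𝒜 ℬ)
  | 0 => PMF.pure Fin.elim0
  | K + 1 => (run G c ι K).bind fun ω =>
      (G.episodeLaw (fun hist => (G.maxTables c ι ω K).π hist.length)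
        (fun hist => (G.minTables c ι ω K).π hist.length)).map
          fun τ => Fin.snoc (α := fun _ => Fin G.H → Transition 𝒮 𝒜 ℬ) ω τ

end MarkovGame

/-! ### Certified policies -/

variable [DecidableEq 𝒮] {H K : ℕ}

/-- The episodes before episode `k` that visited `s` at step `h`, in chronological order. -/
def visits (ω : Fin K → Fin H → Transition 𝒮 𝒜 ℬ) (h : Fin H) (k : Fin K) (s : 𝒮) :
    List (Fin K) :=
  (List.finRange K).filter fun j => j < k ∧ (ω j h).1 = s

/-- The law of the new episode index when `s` is observed at step `h` and the current index is `k`: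
the index of the `m`-th previous visit, with `P(m = i) = α_t^i`, where `t` is the number of previous
visits. If there are none, the index is kept. -/
noncomputable def jumpLaw (ω : Fin K → Fin H → Transition 𝒮 𝒜 ℬ) (h : Fin H) (k : Fin K) (s : 𝒮) :
    PMF (Fin K) :=
  if ht : 0 < (visits ω h k s).length then
    (visitWeights H (visits ω h k s).length ht).map (visits ω h k s).get
  else PMF.pure k

/-- The seed of a certified policy: the initial episode index, and for each step, current index and
observed state the new index. -/
abbrev CertSeed (𝒮 : Type u) (H K : ℕ) := Fin K × (Fin H → Fin K → 𝒮 → Fin K)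

/-- The episode index that is in use after the states `l` have been observed. -/
def certIndex (z : CertSeed 𝒮 H K) (l : List 𝒮) : Fin K :=
  l.zipIdx.foldl (fun k si => if hi : si.2 < H then z.2 ⟨si.2, hi⟩ k si.1 else k) z.1

/-- The certified policy extracted from the `K` episodes `ω`, where `π k` is the policy used in
episode `k`. It starts with an index `k` uniform in the `K` episodes. At each step it observes the
state, replaces the index by a fresh draw from `jumpLaw`, and plays by the policy of the episode with
this new index. -/
noncomputable def certified [Fintype 𝒮] [NeZero K] (ω : Fin K → Fin H → Transition 𝒮 𝒜 ℬ)
    (π : Fin K → ℕ → 𝒮 → PMF 𝒳) : GeneralPolicy 𝒮 𝒜 ℬ 𝒳 where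
  Z := CertSeed 𝒮 H K
  𝒟 := (PMF.uniformOfFintype (Fin K)).toMeasure.prod
    (Measure.pi fun h => Measure.pi fun k => Measure.pi fun s => (jumpLaw ω h k s).toMeasure)
  act z hist s := π (certIndex z (hist.map Prod.fst ++ [s])) hist.length s
  measurable_act _ _ _ := Measurable.of_discrete

end Learning

namespace MarkovGame

variable {𝒮 : Type u} {𝒜 : Type v} {ℬ : Type w} [Fintype 𝒮] [DecidableEq 𝒮]

/-- The certified policy of the max-player. -/
noncomputable def certifiedMax [Fintype 𝒜] [Nonempty 𝒜] [DecidableEq 𝒜]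
    (G : MarkovGame 𝒮 𝒜 ℬ) (c ι : ℝ) {K : ℕ} [NeZero K]
    (ω : Fin K → Fin G.H → Transition 𝒮 𝒜 ℬ) : GeneralPolicy 𝒮 𝒜 ℬ 𝒜 :=
  certified ω fun k => (G.maxTables c ι ω k).π

/-- The certified policy of the min-player. -/
noncomputable def certifiedMin [Fintype ℬ] [Nonempty ℬ] [DecidableEq ℬ]
    (G : MarkovGame 𝒮 𝒜 ℬ) (c ι : ℝ) {K : ℕ} [NeZero K]
    (ω : Fin K → Fin G.H → Transition 𝒮 𝒜 ℬ) : GeneralPolicy 𝒮 𝒜 ℬ ℬ :=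
  certified ω fun k => (G.minTables c ι ω k).π

end MarkovGame

end NashV

/-! The estimates of the two players sandwich the exploitability of the certified pair. On a good
event of probability at least `1 - p`, the mean over episodes of `upperV` at the initial state
dominates the best response to the certified min-policy, and the mean of `lowerV` is at most what
the certified max-policy guarantees. The mean difference of the two estimates is small on every run
in the support, whether good or not.

Optimism. A certified policy jumps to an earlier visit with the same weights `α_t^i` with which the
value table averages its targets (`LocalRun.V_eq`, `ex_jumpLaw`). So the one-step lookahead of a
fixed action `a` against the certified min-policy is a weighted mean over earlier visits of the mean
target of `a` against `ν^j`, while the table of the max-player holds the same weighted mean of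
realized targets, plus bonuses. The difference of the two means is the weighted regret of the
max-player against `a`, so the bonus only has to cover that regret (`ex_jumpLaw_le_upperV`, and
`lowerV_le_ex_jumpLaw` for the other side). A backward induction, `ex_jumpPMF_mul_le`, turns the
one-step inequalities into a bound against every history-dependent opponent.

Regret. The potential `logMeanExp` controls the regret for the estimated losses
(`LocalRun.wsum_sub_le`). With implicit exploration the policy average of the estimates is,
pathwise, the realized loss minus a bias (`LocalRun.ex_lossEst`). Hence realized losses enter with
no concentration of their own, and chance matters only through upward deviations of the estimates
from the conditional mean losses. These have exponential supermartingales (`ex_exp_lossEst_le`,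
`ex_run_exp_le`) in two families: weights proportional to `α_t^i` bound the estimated loss of the
comparator, weights proportional to `α_t^i η_i` bound the bias. A Chernoff bound at level `3ι` and a
union bound give the good event, on which the regret is at most `25 √(H⁴ A ι / t)`.

Gap. The difference of the estimates at step `h` is at most two averaged bonuses plus the
`α_t^i`-average of the differences at step `h + 1` (`estimateGap_le`). Summed over episodes, each
earlier episode is charged at most `1 + 1/H` in total (`sum_wsum_le`), the bonuses add up by
Cauchy-Schwarz (`sum_bonus_le`), and `(1 + 1/H)^H ≤ 3` closes the recursion. `gap_bound_le` compares
the result with `ε`. -/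

namespace NashV

/-! ### Expectations with respect to a `PMF` on a finite type -/

/-- The expectation of `f` under `p`. -/
noncomputable def ex {α : Type*} [Fintype α] (p : PMF α) (f : α → ℝ) : ℝ :=
  ∑ x, (p x).toReal * f x

section Expectation

variable {α β : Type*} [Fintype α] [Fintype β]

theorem sum_toReal_eq_one (p : PMF α) : ∑ x, (p x).toReal = 1 := by
  rw [← ENNReal.toReal_sum fun x _ => p.apply_ne_top x,
    ← tsum_fintype (L := .unconditional _), p.tsum_coe,
    ENNReal.toReal_one]

theorem ex_const (p : PMF α) (c : ℝ) : ex p (fun _ => c) = c := by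
  rw [ex, ← Finset.sum_mul, sum_toReal_eq_one, one_mul]

theorem ex_add (p : PMF α) (f g : α → ℝ) : ex p (fun x => f x + g x) = ex p f + ex p g := by
  simp [ex, mul_add, Finset.sum_add_distrib]

theorem ex_sub (p : PMF α) (f g : α → ℝ) : ex p (fun x => f x - g x) = ex p f - ex p g := by
  simp [ex, mul_sub, Finset.sum_sub_distrib]

theorem ex_const_mul (p : PMF α) (c : ℝ) (f : α → ℝ) : ex p (fun x => c * f x) = c * ex p f := by
  simp only [ex, Finset.mul_sum]
  exact Finset.sum_congr rfl fun _ _ => by ring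

theorem ex_mul_const (p : PMF α) (c : ℝ) (f : α → ℝ) : ex p (fun x => f x * c) = ex p f * c := by
  simp only [ex, Finset.sum_mul]
  exact Finset.sum_congr rfl fun _ _ => by ring

theorem neg_ex (p : PMF α) (f : α → ℝ) : -ex p f = ex p fun x => -f x := by
  simp [ex]

theorem ex_mono {p : PMF α} {f g : α → ℝ} (h : ∀ x, f x ≤ g x) : ex p f ≤ ex p g :=
  Finset.sum_le_sum fun x _ => mul_le_mul_of_nonneg_left (h x) ENNReal.toReal_nonneg

theorem ex_le {p : PMF α} {f : α → ℝ} {c : ℝ} (h : ∀ x, f x ≤ c) : ex p f ≤ c :=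
  (ex_mono h).trans_eq (ex_const p c)

theorem le_ex {p : PMF α} {f : α → ℝ} {c : ℝ} (h : ∀ x, c ≤ f x) : c ≤ ex p f :=
  (ex_const p c).symm.trans_le (ex_mono h)

theorem ex_comm (p : PMF α) (q : PMF β) (f : α → β → ℝ) :
    ex p (fun x => ex q (f x)) = ex q fun y => ex p fun x => f x y := by
  simp only [ex, Finset.mul_sum]
  rw [Finset.sum_comm]
  exact Finset.sum_congr rfl fun _ _ => Finset.sum_congr rfl fun _ _ => by ring

theorem ex_sum {κ : Type*} (p : PMF α) (s : Finset κ) (f : κ → α → ℝ) :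
    ex p (fun x => ∑ i ∈ s, f i x) = ∑ i ∈ s, ex p (f i) := by
  simp only [ex, Finset.mul_sum]
  exact Finset.sum_comm

theorem ex_pure (a : α) (f : α → ℝ) : ex (PMF.pure a) f = f a := by
  classical
  rw [ex, Finset.sum_eq_single a]
  · simp
  · intro b _ hb
    simp [PMF.pure_apply, hb]
  · simp

theorem ex_bind (p : PMF α) (q : α → PMF β) (f : β → ℝ) :
    ex (p.bind q) f = ex p fun a => ex (q a) f := by
  have h : ∀ y, ((p.bind q) y).toReal = ∑ a, (p a).toReal * (q a y).toReal := fun y => by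
    rw [PMF.bind_apply, tsum_fintype, ENNReal.toReal_sum fun a _ =>
      ENNReal.mul_ne_top (p.apply_ne_top a) ((q a).apply_ne_top y)]
    simp
  simp only [ex, h, Finset.sum_mul, Finset.mul_sum]
  rw [Finset.sum_comm]
  exact Finset.sum_congr rfl fun _ _ => Finset.sum_congr rfl fun _ _ => by ring

theorem ex_map (p : PMF α) (g : α → β) (f : β → ℝ) : ex (p.map g) f = ex p fun a => f (g a) := by
  rw [PMF.map, ex_bind]
  simp [ex_pure]

theorem ex_uniform [Nonempty α] (f : α → ℝ) :
    ex (PMF.uniformOfFintype α) f = (Fintype.card α : ℝ)⁻¹ * ∑ x, f x := by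
  simp [ex, PMF.uniformOfFintype_apply, Finset.mul_sum]

theorem ex_congr_support {p : PMF α} {f g : α → ℝ} (h : ∀ x ∈ p.support, f x = g x) :
    ex p f = ex p g := by
  refine Finset.sum_congr rfl fun x _ => ?_
  by_cases hx : x ∈ p.support
  · rw [h x hx]
  · rw [PMF.mem_support_iff, not_not] at hx
    simp [hx]

open Classical in
theorem toOuterMeasure_eq_ofReal_ex (p : PMF α) (s : Set α) :
    p.toOuterMeasure s = ENNReal.ofReal (ex p fun x => if x ∈ s then 1 else 0) := by
  rw [PMF.toOuterMeasure_apply_fintype, ex, ENNReal.ofReal_sum_of_nonneg]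
  · refine Finset.sum_congr rfl fun x _ => ?_
    by_cases hx : x ∈ s
    · simp [hx, ENNReal.ofReal_toReal (p.apply_ne_top x)]
    · simp [hx]
  · intro x _
    split_ifs <;> simp

open Classical in
/-- A Chernoff bound. -/
theorem ex_indicator_le_exp (p : PMF α) (f : α → ℝ) (y : ℝ)
    (h : ex p (fun x => Real.exp (f x)) ≤ 1) :
    ex p (fun x => if y < f x then 1 else 0) ≤ Real.exp (-y) := by
  calc ex p (fun x => if y < f x then 1 else 0)
      ≤ ex p fun x => Real.exp (-y) * Real.exp (f x) := by
        refine ex_mono fun x => ?_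
        rw [← Real.exp_add]
        split_ifs with hx
        · exact Real.one_le_exp (by linarith)
        · positivity
    _ ≤ Real.exp (-y) := by
        rw [ex_const_mul]
        exact mul_le_of_le_one_right (Real.exp_nonneg _) h

open Classical in
/-- A union bound. -/
theorem ofReal_one_sub_le_toOuterMeasure {κ : Type*} [Fintype κ] (p : PMF α) (s : Set α)
    (bad : κ → α → Prop) (δ q : ℝ) (hbad : ∀ i, ex p (fun x => if bad i x then 1 else 0) ≤ q)
    (hq : Fintype.card κ * q ≤ δ) (hs : ∀ x ∈ p.support, (∀ i, ¬ bad i x) → x ∈ s) :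
    ENNReal.ofReal (1 - δ) ≤ p.toOuterMeasure s := by
  rw [toOuterMeasure_eq_ofReal_ex]
  refine ENNReal.ofReal_le_ofReal ?_
  have h1 : ex p (fun x => ∑ i, if bad i x then (1 : ℝ) else 0) ≤ δ := by
    rw [ex_sum]
    refine (Finset.sum_le_sum fun i _ => hbad i).trans ?_
    simpa using hq
  have h2 : (1 : ℝ) ≤ ex p (fun x => (if x ∈ s then 1 else 0)
      + ∑ i, if bad i x then (1 : ℝ) else 0) := by
    -- Off the support nothing is known about `s`. Since those points have mass `0`, the integrand
    -- may be replaced by `1` there, and a pointwise lower bound then suffices.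
    rw [← ex_congr_support (f := fun x => if x ∈ p.support then (if x ∈ s then 1 else 0)
      + ∑ i, (if bad i x then (1 : ℝ) else 0) else 1) fun x hx => by simp only [hx, if_true]]
    refine le_ex fun x => ?_
    split_ifs with hx hxs
    · exact le_add_of_nonneg_right (Finset.sum_nonneg fun i _ => by split_ifs <;> norm_num)
    · rw [zero_add]
      have : ∃ i, bad i x := by
        by_contra! hcon
        exact hxs (hs x hx hcon)
      obtain ⟨i, hi⟩ := this
      refine le_trans ?_ (Finset.single_le_sum (f := fun i => if bad i x then (1 : ℝ) else 0)
        (fun i _ => by split_ifs <;> norm_num) (Finset.mem_univ i))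
      simp [hi]
    · exact le_rfl
  rw [ex_add] at h2
  linarith

end Expectation

namespace MarkovGame

/-! ### Visited states are consistent -/

/-- A trajectory stores every state twice, as next state of one transition and as state of the
following one. The two copies agree only almost surely, and passing from step `h` to step `h + 1` in
the sum of gaps needs this agreement. -/
theorem rollout_support {𝒮 : Type u} {𝒜 : Type v} {ℬ : Type w} (G : MarkovGame 𝒮 𝒜 ℬ)
    (μ : History 𝒮 𝒜 ℬ → 𝒮 → PMF 𝒜) (ν : History 𝒮 𝒜 ℬ → 𝒮 → PMF ℬ) (n : ℕ)
    (hist : History 𝒮 𝒜 ℬ) (s : 𝒮) (τ : Fin n → Transition 𝒮 𝒜 ℬ) (hτ : τ ∈ (G.rollout μ ν n hist s).support) :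
    (∀ h0 : 0 < n, (τ ⟨0, h0⟩).1 = s) ∧
      ∀ i (hi : i + 1 < n), (τ ⟨i + 1, hi⟩).1 = (τ ⟨i, by omega⟩).2.2.2 := by
  induction n generalizing hist s with
  | zero => exact ⟨fun h0 => absurd h0 (lt_irrefl 0), fun i hi => by omega⟩
  | succ n ih =>
    simp only [rollout, PMF.mem_support_bind_iff, PMF.mem_support_map_iff] at hτ
    obtain ⟨a, -, b, -, s', -, τ', hτ', rfl⟩ := hτ
    obtain ⟨h1, h2⟩ := ih _ _ _ hτ'
    refine ⟨fun _ => rfl, fun i hi => ?_⟩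
    cases i with
    | zero => exact h1 (by omega)
    | succ i => exact h2 i (by omega)

variable {𝒮 : Type u} {𝒜 : Type v} {ℬ : Type w} [Fintype 𝒮] [Fintype 𝒜] [Fintype ℬ]

/-! ### Expected rewards of rollouts -/

theorem ex_rollout_succ (G : MarkovGame 𝒮 𝒜 ℬ)
    (μ : History 𝒮 𝒜 ℬ → 𝒮 → PMF 𝒜) (ν : History 𝒮 𝒜 ℬ → 𝒮 → PMF ℬ) (n : ℕ)
    (hist : History 𝒮 𝒜 ℬ) (s : 𝒮) (f : (Fin (n + 1) → Transition 𝒮 𝒜 ℬ) → ℝ) :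
    ex (G.rollout μ ν (n + 1) hist s) f = ex (μ hist s) fun a => ex (ν hist s) fun b =>
      ex (G.P hist.length s a b) fun s' =>
        ex (G.rollout μ ν n (hist ++ [(s, a, b, G.r hist.length s a b)]) s') fun τ =>
          f (Fin.cons (s, a, b, s') τ) := by
  simp only [rollout, ex_bind, ex_map]

/-- The expected reward of the next `n` steps. -/
noncomputable def rew (G : MarkovGame 𝒮 𝒜 ℬ)
    (μ : History 𝒮 𝒜 ℬ → 𝒮 → PMF 𝒜) (ν : History 𝒮 𝒜 ℬ → 𝒮 → PMF ℬ) (n : ℕ)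
    (hist : History 𝒮 𝒜 ℬ) (s : 𝒮) : ℝ :=
  ex (G.rollout μ ν n hist s) fun τ =>
    ∑ i : Fin n, G.r (hist.length + i) (τ i).1 (τ i).2.1 (τ i).2.2.1

variable (G : MarkovGame 𝒮 𝒜 ℬ)
    (μ : History 𝒮 𝒜 ℬ → 𝒮 → PMF 𝒜) (ν : History 𝒮 𝒜 ℬ → 𝒮 → PMF ℬ)

theorem rew_zero (hist : History 𝒮 𝒜 ℬ) (s : 𝒮) : G.rew μ ν 0 hist s = 0 := by
  simp [rew, ex]

theorem rew_succ (n : ℕ) (hist : History 𝒮 𝒜 ℬ) (s : 𝒮) :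
    G.rew μ ν (n + 1) hist s = ex (μ hist s) fun a => ex (ν hist s) fun b =>
      G.r hist.length s a b + ex (G.P hist.length s a b) fun s' =>
        G.rew μ ν n (hist ++ [(s, a, b, G.r hist.length s a b)]) s' := by
  rw [rew, ex_rollout_succ]
  simp [rew, Fin.sum_univ_succ, ex_add, ex_const, Nat.add_assoc, Nat.add_comm 1]

theorem rew_mem_Icc (n : ℕ) (hist : History 𝒮 𝒜 ℬ) (s : 𝒮) (hn : hist.length + n ≤ G.H) :
    G.rew μ ν n hist s ∈ Set.Icc (0 : ℝ) n := by
  induction n generalizing hist s with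
  | zero => simp [rew_zero]
  | succ n ih =>
    have hlt : hist.length < G.H := by omega
    have key := fun a b s' => ih (hist ++ [(s, a, b, G.r hist.length s a b)]) s'
      (by simp only [List.length_append, List.length_singleton]; omega)
    rw [rew_succ]
    constructor
    · exact le_ex fun a => le_ex fun b => add_nonneg (G.r_nonneg _ hlt _ _ _)
        (le_ex fun s' => (key a b s').1)
    · refine ex_le fun a => ex_le fun b => ?_
      have h1 := G.r_le_one _ hlt s a b
      have h2 := ex_le (p := G.P hist.length s a b) fun s' => (key a b s').2
      push_cast
      linarith

theorem value_eq_integral_rew (μ : GeneralPolicy 𝒮 𝒜 ℬ 𝒜) (ν : GeneralPolicy 𝒮 𝒜 ℬ ℬ) :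
    G.value μ ν = ∫ z, ∫ z', G.rew (μ.act z) (ν.act z') G.H [] G.s₁ ∂ν.𝒟 ∂μ.𝒟 := by
  simp [value, rew, ex, episodeLaw, totalReward]

theorem measurable_rew_right (ν : GeneralPolicy 𝒮 𝒜 ℬ ℬ) (n : ℕ) (hist : History 𝒮 𝒜 ℬ) (s : 𝒮) :
    Measurable fun z => G.rew μ (ν.act z) n hist s := by
  induction n generalizing hist s with
  | zero => simp [rew_zero]
  | succ n ih =>
    simp only [rew_succ, ex]
    refine Finset.measurable_sum _ fun a _ => Measurable.const_mul
      (Finset.measurable_sum _ fun b _ => Measurable.mul ?_ ?_) _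
    · exact (ν.measurable_act hist s b).ennreal_toReal
    · exact (Finset.measurable_sum _ fun s' _ => (ih _ s').const_mul _).const_add _

/-- A bound on the expectation of a function of one transition of a rollout follows from a bound on
its conditional expectation given the state. -/
theorem ex_rollout_apply_le (n : ℕ) (hist : History 𝒮 𝒜 ℬ) (s : 𝒮) (i : Fin n)
    (μ : ℕ → 𝒮 → PMF 𝒜) (ν : ℕ → 𝒮 → PMF ℬ)
    (f : Transition 𝒮 𝒜 ℬ → ℝ) (C : ℝ)
    (hf : ∀ s, ex (μ (hist.length + i) s) (fun a => ex (ν (hist.length + i) s) fun b =>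
      ex (G.P (hist.length + i) s a b) fun s' => f (s, a, b, s')) ≤ C) :
    ex (G.rollout (fun hist => μ hist.length) (fun hist => ν hist.length) n hist s)
      (fun τ => f (τ i)) ≤ C := by
  induction n generalizing hist s with
  | zero => exact i.elim0
  | succ n ih =>
    rw [ex_rollout_succ]
    induction i using Fin.cases with
    | zero => simpa [ex_const] using hf s
    | succ i =>
      simp only [Fin.cons_succ]
      refine ex_le fun a => ex_le fun b => ex_le fun s' => ih _ _ i fun s => ?_
      simpa [Nat.add_assoc, Nat.add_comm 1] using hf s

end MarkovGame
/-! ### Certified policies against arbitrary opponents -/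

/-- Replacing one coordinate by an independent copy does not change a product measure. This is how
the draw at a single step is integrated out. -/
theorem pi_map_update {κ : Type*} [Fintype κ] [DecidableEq κ] {X : κ → Type*}
    [∀ i, MeasurableSpace (X i)] (m : ∀ i, Measure (X i)) [∀ i, IsProbabilityMeasure (m i)]
    (i : κ) :
    ((m i).prod (Measure.pi m)).map (fun q => Function.update q.2 i q.1) = Measure.pi m := by
  have hmeas : Measurable fun q : X i × (∀ j, X j) => Function.update q.2 i q.1 := by
    refine measurable_pi_lambda _ fun j => ?_
    by_cases hj : j = i
    · subst hj
      simpa using measurable_fst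
    · simp only [Function.update_of_ne hj]
      exact (measurable_pi_apply j).comp measurable_snd
  refine (Measure.pi_eq fun s hs => ?_).symm
  rw [Measure.map_apply hmeas (MeasurableSet.univ_pi hs)]
  have hpre : (fun q : X i × (∀ j, X j) => Function.update q.2 i q.1) ⁻¹' (Set.univ.pi s)
      = s i ×ˢ Set.univ.pi (Function.update s i Set.univ) := by
    ext q
    simp only [Set.mem_preimage, Set.mem_univ_pi, Set.mem_prod]
    constructor
    · intro h
      refine ⟨by simpa using h i, fun j => ?_⟩
      by_cases hj : j = i
      · subst hj
        simp
      · simpa [Function.update_of_ne hj] using h j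
    · rintro ⟨h1, h2⟩ j
      by_cases hj : j = i
      · subst hj
        simpa using h1
      · simpa [Function.update_of_ne hj] using h2 j
  rw [hpre, Measure.prod_prod, Measure.pi_pi, ← Finset.mul_prod_erase Finset.univ _
    (Finset.mem_univ i), ← Finset.mul_prod_erase Finset.univ (fun j => m j (s j))
    (Finset.mem_univ i)]
  simp only [Function.update_self, measure_univ, one_mul]
  congr 1
  refine Finset.prod_congr rfl fun j hj => ?_
  rw [Function.update_of_ne (Finset.ne_of_mem_erase hj)]

section Seed

variable {𝒮 : Type u} {𝒜 : Type v} {ℬ : Type w} {H K : ℕ}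

theorem certIndex_nil (z : CertSeed 𝒮 H K) : certIndex z [] = z.1 := rfl

theorem certIndex_append (z : CertSeed 𝒮 H K) (l : List 𝒮) (s : 𝒮) (hl : l.length < H) :
    certIndex z (l ++ [s]) = z.2 ⟨l.length, hl⟩ (certIndex z l) s := by
  simp [certIndex, List.zipIdx_append, List.foldl_append, hl]

/-- The current index is adapted: it involves only the draws of the steps already observed. -/
theorem certIndex_congr (k : Fin K) (ξ ξ' : Fin H → Fin K → 𝒮 → Fin K) (l : List 𝒮)
    (hl : l.length ≤ H) (h : ∀ i : Fin H, i < l.length → ξ i = ξ' i) :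
    certIndex (k, ξ) l = certIndex (k, ξ') l := by
  induction l using List.reverseRecOn with
  | nil => rfl
  | append_singleton l s ih =>
    simp only [List.length_append, List.length_singleton] at hl h
    rw [certIndex_append _ _ _ (by omega), certIndex_append _ _ _ (by omega),
      ih (by omega) fun i hi => h i (by omega)]
    simp only
    rw [h ⟨l.length, by omega⟩ (Nat.lt_succ_self _)]

variable [DecidableEq 𝒮] [Fintype 𝒮] (ω : Fin K → Fin H → Transition 𝒮 𝒜 ℬ)

/-- The law of the index draws of a certified policy. -/
noncomputable def jumpMeasure : Measure (Fin H → Fin K → 𝒮 → Fin K) :=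
  Measure.pi fun h => Measure.pi fun k => Measure.pi fun s => (jumpLaw ω h k s).toMeasure

noncomputable instance : IsProbabilityMeasure (jumpMeasure ω) := by
  unfold jumpMeasure
  infer_instance

/-- The law of the index draws of a certified policy, as a `PMF`. -/
noncomputable def jumpPMF : PMF (Fin H → Fin K → 𝒮 → Fin K) := (jumpMeasure ω).toPMF

theorem integral_jumpMeasure (f : (Fin H → Fin K → 𝒮 → Fin K) → ℝ) :
    ∫ ξ, f ξ ∂jumpMeasure ω = ex (jumpPMF ω) f := by
  conv_lhs => rw [← Measure.toPMF_toMeasure (jumpMeasure ω)]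
  rw [PMF.integral_eq_sum]
  rfl

/-- The draw at step `h` is independent of everything that does not involve the draws at step `h`. -/
theorem ex_jumpPMF_resample (h : Fin H) (s : 𝒮) (φ : (Fin H → Fin K → 𝒮 → Fin K) → ℝ)
    (j : (Fin H → Fin K → 𝒮 → Fin K) → Fin K)
    (hφ : ∀ ξ y, φ (Function.update ξ h y) = φ ξ) (hj : ∀ ξ y, j (Function.update ξ h y) = j ξ)
    (f : Fin K → ℝ) :
    ex (jumpPMF ω) (fun ξ => φ ξ * f (ξ h (j ξ) s))
      = ex (jumpPMF ω) fun ξ => φ ξ * ex (jumpLaw ω h (j ξ) s) f := by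
  rw [← integral_jumpMeasure, ← integral_jumpMeasure]
  have h1 : ∀ k, ∫ y : Fin K → 𝒮 → Fin K, f (y k s) ∂(Measure.pi fun k => Measure.pi fun s =>
      (jumpLaw ω h k s).toMeasure) = ex (jumpLaw ω h k s) f := by
    intro k
    have m1 := measurePreserving_eval (fun k => Measure.pi fun s => (jumpLaw ω h k s).toMeasure) k
    have m2 := measurePreserving_eval (fun s => (jumpLaw ω h k s).toMeasure) s
    have m3 := m2.comp m1
    have h2 : ∫ k', f k' ∂(jumpLaw ω h k s).toMeasure = ex (jumpLaw ω h k s) f := by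
      rw [PMF.integral_eq_sum]
      rfl
    rw [← h2, ← m3.map_eq, integral_map Measurable.of_discrete.aemeasurable
      Measurable.of_discrete.aestronglyMeasurable]
    rfl
  conv_lhs => rw [jumpMeasure, ← pi_map_update _ h]
  rw [integral_map (Measurable.of_discrete.aemeasurable)
    (Measurable.of_discrete.aestronglyMeasurable), integral_prod_symm _ (Integrable.of_finite)]
  simp only [hφ, hj, Function.update_self, integral_const_mul, h1]
  rfl

/-- The expected reward-to-go `R` of a certified policy with index draws `ξ` against an opponent `σ`
is at most `g`, if `g` dominates its one-step lookahead. -/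
theorem ex_jumpPMF_mul_le {𝒳 : Type*} {𝒴 : Type*} [Fintype 𝒳] [Fintype 𝒴]
    (π : Fin K → ℕ → 𝒮 → PMF 𝒳) (σ : History 𝒮 𝒜 ℬ → 𝒮 → PMF 𝒴)
    (ρ : ℕ → 𝒮 → 𝒴 → 𝒳 → ℝ) (P : ℕ → 𝒮 → 𝒴 → 𝒳 → PMF 𝒮)
    (e : ℕ → 𝒮 → 𝒴 → 𝒳 → 𝒮 × 𝒜 × ℬ × ℝ) (he : ∀ h s y x, (e h s y x).1 = s) (k : Fin K)
    (R : (Fin H → Fin K → 𝒮 → Fin K) → ℕ → History 𝒮 𝒜 ℬ → 𝒮 → ℝ)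
    (hR0 : ∀ ξ hist s, R ξ 0 hist s = 0)
    (hR : ∀ ξ n hist s, R ξ (n + 1) hist s = ex (σ hist s) fun y =>
      ex (π (certIndex (k, ξ) (hist.map Prod.fst ++ [s])) hist.length s) fun x =>
        ρ hist.length s y x + ex (P hist.length s y x) fun s' =>
          R ξ n (hist ++ [e hist.length s y x]) s')
    (g : ℕ → Fin K → 𝒮 → ℝ) (hg0 : ∀ k s, 0 ≤ g H k s)
    (hg : ∀ (h : Fin H) k s y, ex (jumpLaw ω h k s) (fun j => ex (π j h s) fun x =>
      ρ h s y x + ex (P h s y x) (g (h + 1) j)) ≤ g h k s)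
    (n : ℕ) (hist : History 𝒮 𝒜 ℬ) (s : 𝒮) (hn : hist.length + n = H)
    (φ : (Fin H → Fin K → 𝒮 → Fin K) → ℝ) (hφ0 : ∀ ξ, 0 ≤ φ ξ)
    (hφ : ∀ ξ ξ', (∀ i : Fin H, i < hist.length → ξ i = ξ' i) → φ ξ = φ ξ') :
    ex (jumpPMF ω) (fun ξ => φ ξ * R ξ n hist s)
      ≤ ex (jumpPMF ω) fun ξ => φ ξ * g hist.length (certIndex (k, ξ) (hist.map Prod.fst)) s := by
  induction n generalizing hist s φ with
  | zero =>
    obtain rfl : hist.length = H := by omega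
    refine ex_mono fun ξ => ?_
    rw [hR0, mul_zero]
    exact mul_nonneg (hφ0 ξ) (hg0 _ _)
  | succ n ih =>
    have hlt : hist.length < H := by omega
    set h : Fin H := ⟨hist.length, hlt⟩ with hh
    set idx : (Fin H → Fin K → 𝒮 → Fin K) → Fin K :=
      fun ξ => certIndex (k, ξ) (hist.map Prod.fst) with hidx
    have hnext : ∀ ξ, certIndex (k, ξ) (hist.map Prod.fst ++ [s]) = ξ h (idx ξ) s := fun ξ => by
      rw [certIndex_append _ _ _ (by simpa using hlt)]
      simp [hidx, hh]
    have hupd : ∀ (ξ : Fin H → Fin K → 𝒮 → Fin K) y, ∀ i : Fin H, i < hist.length → Function.update ξ h y i = ξ i := by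
      intro ξ y i hi
      exact Function.update_of_ne (by intro hc; rw [hc] at hi; exact lt_irrefl _ hi) _ _
    have hidx' : ∀ ξ ξ' : Fin H → Fin K → 𝒮 → Fin K,
        (∀ i : Fin H, i < hist.length → ξ i = ξ' i) → idx ξ = idx ξ' := fun ξ ξ' hξ =>
      certIndex_congr _ _ _ _ (by simpa using hlt.le) (by simpa using hξ)
    have key : ∀ y, ex (jumpPMF ω) (fun ξ => φ ξ * ex (π (ξ h (idx ξ) s) hist.length s) fun x =>
          ρ hist.length s y x + ex (P hist.length s y x) fun s' =>
            R ξ n (hist ++ [e hist.length s y x]) s')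
        ≤ ex (jumpPMF ω) fun ξ => φ ξ * g hist.length (idx ξ) s := by
      intro y
      -- The likelihood of the own action `x` is absorbed into the weight. It depends on the draw at
      -- the current step, which belongs to the past once the history is one step longer. This is
      -- what the general weight `φ` is for: the opponent sees the actions, and they carry
      -- information about the seed.
      have hstep : ∀ x s', ex (jumpPMF ω) (fun ξ =>
            (φ ξ * (π (ξ h (idx ξ) s) hist.length s x).toReal)
              * R ξ n (hist ++ [e hist.length s y x]) s')
          ≤ ex (jumpPMF ω) fun ξ => (φ ξ * (π (ξ h (idx ξ) s) hist.length s x).toReal)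
              * g (hist.length + 1) (ξ h (idx ξ) s) s' := by
        intro x s'
        refine (ih (hist ++ [e hist.length s y x]) s' (by simp; omega) _
          (fun ξ => mul_nonneg (hφ0 ξ) ENNReal.toReal_nonneg) fun ξ ξ' hξ => ?_).trans_eq ?_
        · simp only [List.length_append, List.length_singleton] at hξ
          have h1 : ∀ i : Fin H, i < hist.length → ξ i = ξ' i := fun i hi => hξ i (by omega)
          rw [hφ ξ ξ' h1, hidx' ξ ξ' h1, hξ h (Nat.lt_succ_self _)]
        · congr! 2 with ξ
          simp only [List.map_append, List.map_cons, List.map_nil, he, hnext]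
          simp
      calc _ ≤ ex (jumpPMF ω) (fun ξ => φ ξ * ex (π (ξ h (idx ξ) s) hist.length s) fun x =>
              ρ hist.length s y x + ex (P hist.length s y x)
                (g (hist.length + 1) (ξ h (idx ξ) s))) := by
            -- Both sides are linear in the continuation, so the bound can be applied separately for
            -- each own action and next state.
            have expand : ∀ F : (Fin H → Fin K → 𝒮 → Fin K) → 𝒳 → 𝒮 → ℝ,
                ex (jumpPMF ω) (fun ξ => φ ξ * ex (π (ξ h (idx ξ) s) hist.length s) fun x =>
                  ρ hist.length s y x + ex (P hist.length s y x) (F ξ x))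
                = ex (jumpPMF ω) (fun ξ => φ ξ * ex (π (ξ h (idx ξ) s) hist.length s)
                    (ρ hist.length s y))
                  + ∑ x, ∑ s', (P hist.length s y x s').toReal * ex (jumpPMF ω) fun ξ =>
                    (φ ξ * (π (ξ h (idx ξ) s) hist.length s x).toReal) * F ξ x s' := by
              intro F
              have hpt : ∀ ξ, φ ξ * ex (π (ξ h (idx ξ) s) hist.length s) (fun x =>
                    ρ hist.length s y x + ex (P hist.length s y x) (F ξ x))
                  = φ ξ * ex (π (ξ h (idx ξ) s) hist.length s) (ρ hist.length s y)
                    + ∑ x, ∑ s', (P hist.length s y x s').toReal *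
                      ((φ ξ * (π (ξ h (idx ξ) s) hist.length s x).toReal) * F ξ x s') := by
                intro ξ
                rw [ex_add, mul_add]
                simp only [ex, Finset.mul_sum]
                congr 1
                exact Finset.sum_congr rfl fun x _ => Finset.sum_congr rfl fun s' _ => by ring
              simp only [hpt]
              simp only [ex_add, ex_sum, ex_const_mul]
            rw [expand fun ξ x s' => R ξ n (hist ++ [e hist.length s y x]) s',
              expand fun ξ x s' => g (hist.length + 1) (ξ h (idx ξ) s) s']
            gcongr with x _ s' _
            exact hstep x s'
        _ = ex (jumpPMF ω) (fun ξ => φ ξ * ex (jumpLaw ω h (idx ξ) s) fun j =>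
              ex (π j hist.length s) fun x => ρ hist.length s y x +
                ex (P hist.length s y x) (g (hist.length + 1) j)) :=
            -- Neither the weight nor the index before the jump involves the draw at step `h`, so
            -- that draw may be averaged out by `jumpLaw`.
            ex_jumpPMF_resample ω h s φ idx (fun ξ y => hφ _ _ (hupd ξ y))
              (fun ξ y => hidx' _ _ (hupd ξ y)) fun j =>
              ex (π j hist.length s) fun x => ρ hist.length s y x +
                ex (P hist.length s y x) (g (hist.length + 1) j)
        _ ≤ _ := ex_mono fun ξ => mul_le_mul_of_nonneg_left (hg h (idx ξ) s y) (hφ0 ξ)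
    -- The law `σ hist s` of the opponent's action does not depend on the index draws. It can be
    -- moved outside, and each action `y` satisfies the bound.
    simp only [hR, hnext]
    simp only [← ex_const_mul (σ hist s)]
    rw [ex_comm]
    exact ex_le key

/-- The value of a bounded-from-above reward-to-go of a certified policy. -/
theorem integral_certified_le [NeZero K] {𝒳 : Type*} (π : Fin K → ℕ → 𝒮 → PMF 𝒳)
    (f : CertSeed 𝒮 H K → ℝ) (g : Fin K → ℝ)
    (h : ∀ k, ex (jumpPMF ω) (fun ξ => f (k, ξ)) ≤ g k) :
    ∫ z, f z ∂(certified ω π).𝒟 ≤ (K : ℝ)⁻¹ * ∑ k, g k := by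
  change ∫ z, f z ∂((PMF.uniformOfFintype (Fin K)).toMeasure.prod (jumpMeasure ω)) ≤ _
  rw [integral_prod _ Integrable.of_finite, PMF.integral_eq_sum]
  simp only [integral_jumpMeasure, smul_eq_mul]
  change ex (PMF.uniformOfFintype (Fin K)) _ ≤ _
  refine (ex_mono h).trans_eq ?_
  simp [ex_uniform]

end Seed

/-! ### Best-response values of certified policies from one-step inequalities. -/

namespace MarkovGame

variable {𝒮 : Type u} {𝒜 : Type v} {ℬ : Type w} [Fintype 𝒮] [Fintype 𝒜] [Fintype ℬ]
  (G : MarkovGame 𝒮 𝒜 ℬ)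

/-- The seed of the best responder is only averaged over, so a bound uniform over seedless
history-dependent policies is enough. Nonnegative rewards allow the comparison of integrals without
measurability in that seed. -/
theorem maxBestResponseValue_le_of_forall (ν : GeneralPolicy 𝒮 𝒜 ℬ ℬ) (c : ℝ) (hc : 0 ≤ c)
    (h : ∀ μ : History 𝒮 𝒜 ℬ → 𝒮 → PMF 𝒜, ∫ z', G.rew μ (ν.act z') G.H [] G.s₁ ∂ν.𝒟 ≤ c) :
    G.maxBestResponseValue ν ≤ c := by
  refine Real.iSup_le (fun μ => ?_) hc
  rw [value_eq_integral_rew]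
  refine (integral_mono_of_nonneg (g := fun _ => c) (.of_forall fun z => ?_)
    (integrable_const c) (.of_forall fun z => h (μ.act z))).trans_eq (by simp)
  exact integral_nonneg fun z' => (G.rew_mem_Icc _ _ _ _ _ (by simp)).1

variable [DecidableEq 𝒮] {K : ℕ} [NeZero K] (ω : Fin K → Fin G.H → Transition 𝒮 𝒜 ℬ)

theorem maxBestResponseValue_certified_le (π : Fin K → ℕ → 𝒮 → PMF ℬ)
    (g : ℕ → Fin K → 𝒮 → ℝ) (hg0 : ∀ h k s, 0 ≤ g h k s)
    (hg : ∀ (h : Fin G.H) k s a, ex (jumpLaw ω h k s) (fun j => ex (π j h s) fun b =>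
      G.r h s a b + ex (G.P h s a b) (g (h + 1) j)) ≤ g h k s) :
    G.maxBestResponseValue (certified ω π) ≤ (K : ℝ)⁻¹ * ∑ k, g 0 k G.s₁ := by
  refine G.maxBestResponseValue_le_of_forall _ _
    (mul_nonneg (by positivity) (Finset.sum_nonneg fun k _ => hg0 _ _ _)) fun μ => ?_
  refine integral_certified_le ω π _ _ fun k => ?_
  have := ex_jumpPMF_mul_le ω π μ G.r G.P (fun h s a b => (s, a, b, G.r h s a b))
    (fun _ _ _ _ => rfl) k (fun ξ n hist s => G.rew μ ((certified ω π).act (k, ξ)) n hist s)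
    (fun ξ hist s => G.rew_zero _ _ _ _)
    (fun ξ n hist s => G.rew_succ _ _ _ _ _) g (hg0 _) hg G.H [] G.s₁
    (by simp) (fun _ => 1) (fun _ => zero_le_one) (fun _ _ _ => rfl)
  simpa [certIndex_nil, ex_const] using this

theorem le_minBestResponseValue_certified [Nonempty ℬ] (π : Fin K → ℕ → 𝒮 → PMF 𝒜)
    (g : ℕ → Fin K → 𝒮 → ℝ) (hg0 : ∀ k s, g G.H k s ≤ 0)
    (hg : ∀ (h : Fin G.H) k s b, g h k s ≤ ex (jumpLaw ω h k s) (fun j => ex (π j h s) fun a =>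
      G.r h s a b + ex (G.P h s a b) (g (h + 1) j))) :
    (K : ℝ)⁻¹ * ∑ k, g 0 k G.s₁ ≤ G.minBestResponseValue (certified ω π) := by
  -- An infimum over an empty family of reals would be `0`, so an opponent has to be exhibited.
  have : Nonempty (GeneralPolicy 𝒮 𝒜 ℬ ℬ) := ⟨{
    Z := PUnit
    𝒟 := Measure.dirac PUnit.unit
    act := fun _ _ _ => PMF.uniformOfFintype ℬ
    measurable_act := fun _ _ _ => measurable_const }⟩
  refine le_ciInf fun ν => ?_
  rw [value_eq_integral_rew, ← neg_le_neg_iff, ← integral_neg, ← mul_neg,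
    ← Finset.sum_neg_distrib]
  refine integral_certified_le ω π _ _ fun k => ?_
  have hint : ∀ ξ, Integrable (fun z' => -G.rew ((certified ω π).act (k, ξ)) (ν.act z') G.H []
      G.s₁) ν.𝒟 := fun ξ => by
    refine Integrable.of_bound (C := G.H)
      (G.measurable_rew_right _ ν _ _ _).neg.aestronglyMeasurable (.of_forall fun z' => ?_)
    have := G.rew_mem_Icc ((certified ω π).act (k, ξ)) (ν.act z') G.H [] G.s₁ (by simp)
    rw [norm_neg, Real.norm_eq_abs, abs_le]
    constructor <;> linarith [this.1, this.2]
  -- The certified seed is the outer variable of `value` here. Exchanging the integrals fixes the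
  -- opponent's seed first, so that the backward induction applies with negated rewards and the
  -- roles of the two players exchanged.
  have hswap : ex (jumpPMF ω) (fun ξ => -∫ z', G.rew ((certified ω π).act (k, ξ)) (ν.act z')
      G.H [] G.s₁ ∂ν.𝒟) = ∫ z', ex (jumpPMF ω) (fun ξ => -G.rew ((certified ω π).act (k, ξ))
        (ν.act z') G.H [] G.s₁) ∂ν.𝒟 := by
    simp only [ex]
    rw [integral_finsetSum _ fun ξ _ => (hint ξ).const_mul _]
    simp only [integral_const_mul, integral_neg]
  have key : ∀ z', ex (jumpPMF ω) (fun ξ => -G.rew ((certified ω π).act (k, ξ)) (ν.act z') G.H []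
      G.s₁) ≤ -g 0 k G.s₁ := fun z' => by
    have := ex_jumpPMF_mul_le ω π (ν.act z') (fun h s b a => -G.r h s a b)
      (fun h s b a => G.P h s a b) (fun h s b a => (s, a, b, G.r h s a b))
      (fun _ _ _ _ => rfl) k
      (fun ξ n hist s => -G.rew ((certified ω π).act (k, ξ)) (ν.act z') n hist s)
      (fun ξ hist s => by simp [G.rew_zero])
      (fun ξ n hist s => by
        rw [G.rew_succ, ex_comm]
        simp only [neg_ex, neg_add]
        rfl)
      (fun h k s => -g h k s) (fun k s => neg_nonneg.2 (hg0 k s))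
      (fun h k s b => by
        rw [le_neg, neg_ex]
        refine (hg h k s b).trans_eq ?_
        simp only [neg_ex, neg_add, neg_neg])
      G.H [] G.s₁ (by simp) (fun _ => 1) (fun _ => zero_le_one) (fun _ _ _ => rfl)
    simpa [certIndex_nil, ex_const] using this
  rw [hswap]
  refine (integral_mono_ae ?_ (integrable_const (-g 0 k G.s₁)) (.of_forall key)).trans_eq (by simp)
  simp only [ex]
  exact integrable_finsetSum _ fun ξ _ => (hint ξ).const_mul _

end MarkovGame
/-! ### Weighted sums over visits -/

theorem lr_nonneg (H t : ℕ) : 0 ≤ lr H t := by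
  unfold lr
  positivity

theorem lr_succ (H n : ℕ) : lr H (n + 1) = ((H : ℝ) + 1) / (H + n + 1) := by
  simp [lr, add_assoc]

theorem lr_one (H : ℕ) : lr H 1 = 1 := by
  rw [lr, Nat.cast_one, div_self (by positivity)]

theorem one_sub_lr_succ (H n : ℕ) : 1 - lr H (n + 1) = n / (H + n + 1) := by
  have : (H : ℝ) + n + 1 ≠ 0 := by positivity
  rw [lr_succ]
  field_simp
  ring

theorem one_sub_lr_succ_nonneg (H n : ℕ) : 0 ≤ 1 - lr H (n + 1) := by
  rw [one_sub_lr_succ]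
  positivity

section WeightedSums

variable {α : Type*}

/-- The sum of `f` over a list, with weights that depend on the position. -/
noncomputable def indexedSum (l : List α) (w : ℕ → ℝ) (f : α → ℝ) : ℝ :=
  ∑ i ∈ Finset.range l.length, w i * (l[i]?.map f).getD 0

/-- The average of `f` over a list with the weights `α_t^i`. -/
noncomputable def wsum (H : ℕ) (l : List α) (f : α → ℝ) : ℝ :=
  indexedSum l (fun i => lrWeight H l.length (i + 1)) f

theorem indexedSum_eq_sum_fin (l : List α) (w : ℕ → ℝ) (f : α → ℝ) :
    indexedSum l w f = ∑ i : Fin l.length, w i * f (l.get i) := by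
  rw [indexedSum, Finset.sum_range]
  simp

theorem indexedSum_append (l : List α) (x : α) (w : ℕ → ℝ) (f : α → ℝ) :
    indexedSum (l ++ [x]) w f = indexedSum l w f + w l.length * f x := by
  rw [indexedSum, indexedSum, List.length_append, List.length_singleton, Finset.sum_range_succ]
  congr 1
  · refine Finset.sum_congr rfl fun i hi => ?_
    rw [List.getElem?_append_left (Finset.mem_range.1 hi)]
  · simp

theorem wsum_nil (H : ℕ) (f : α → ℝ) : wsum H [] f = 0 := by
  simp [wsum, indexedSum]

theorem wsum_append (H : ℕ) (l : List α) (x : α) (f : α → ℝ) :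
    wsum H (l ++ [x]) f
      = (1 - lr H (l.length + 1)) * wsum H l f + lr H (l.length + 1) * f x := by
  rw [wsum, indexedSum_append, wsum, indexedSum, indexedSum, Finset.mul_sum]
  congr 1
  · refine Finset.sum_congr rfl fun i hi => ?_
    have hi' : i + 1 + 1 ≤ l.length + 1 := by
      have := Finset.mem_range.1 hi
      omega
    rw [List.length_append, List.length_singleton, lrWeight, lrWeight,
      Finset.prod_Icc_succ_top hi']
    ring
  · simp [lrWeight]

theorem wsum_mono (H : ℕ) (l : List α) {f g : α → ℝ} (h : ∀ x ∈ l, f x ≤ g x) :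
    wsum H l f ≤ wsum H l g := by
  rw [wsum, wsum, indexedSum_eq_sum_fin, indexedSum_eq_sum_fin]
  exact Finset.sum_le_sum fun i _ =>
    mul_le_mul_of_nonneg_left (h _ (List.get_mem _ _)) (lrWeight_nonneg _ _ _)

theorem wsum_congr (H : ℕ) (l : List α) {f g : α → ℝ} (h : ∀ x ∈ l, f x = g x) :
    wsum H l f = wsum H l g :=
  le_antisymm (wsum_mono H l fun x hx => (h x hx).le) (wsum_mono H l fun x hx => (h x hx).ge)

theorem wsum_add (H : ℕ) (l : List α) (f g : α → ℝ) :
    wsum H l (fun x => f x + g x) = wsum H l f + wsum H l g := by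
  simp [wsum, indexedSum_eq_sum_fin, mul_add, Finset.sum_add_distrib]

theorem wsum_sub (H : ℕ) (l : List α) (f g : α → ℝ) :
    wsum H l (fun x => f x - g x) = wsum H l f - wsum H l g := by
  simp [wsum, indexedSum_eq_sum_fin, mul_sub, Finset.sum_sub_distrib]

theorem wsum_const_mul (H : ℕ) (l : List α) (c : ℝ) (f : α → ℝ) :
    wsum H l (fun x => c * f x) = c * wsum H l f := by
  simp only [wsum, indexedSum_eq_sum_fin, Finset.mul_sum]
  exact Finset.sum_congr rfl fun _ _ => by ring

theorem wsum_finset_sum {κ : Type*} (H : ℕ) (l : List α) (s : Finset κ) (f : κ → α → ℝ) :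
    wsum H l (fun x => ∑ i ∈ s, f i x) = ∑ i ∈ s, wsum H l (f i) := by
  simp only [wsum, indexedSum_eq_sum_fin, Finset.mul_sum]
  exact Finset.sum_comm

theorem wsum_const (H : ℕ) (l : List α) (hl : l ≠ []) (c : ℝ) : wsum H l (fun _ => c) = c := by
  rw [wsum, indexedSum_eq_sum_fin, ← Finset.sum_mul,
    lrWeight_sum H l.length (List.length_pos_iff.2 hl), one_mul]

theorem wsum_nonneg (H : ℕ) (l : List α) {f : α → ℝ} (h : ∀ x ∈ l, 0 ≤ f x) :
    0 ≤ wsum H l f := by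
  rw [wsum, indexedSum_eq_sum_fin]
  exact Finset.sum_nonneg fun i _ => mul_nonneg (lrWeight_nonneg _ _ _) (h _ (List.get_mem _ _))

theorem le_wsum (H : ℕ) (l : List α) (hl : l ≠ []) {f : α → ℝ} {c : ℝ} (h : ∀ x ∈ l, c ≤ f x) :
    c ≤ wsum H l f :=
  (wsum_const H l hl c).symm.trans_le (wsum_mono H l h)

theorem wsum_le (H : ℕ) (l : List α) (hl : l ≠ []) {f : α → ℝ} {c : ℝ} (h : ∀ x ∈ l, f x ≤ c) :
    wsum H l f ≤ c :=
  (wsum_mono H l h).trans_eq (wsum_const H l hl c)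

/-- Induction from `α_n (1 - α_{n+1}) ≤ α_{n+1}`. The bound keeps the exponents of the
supermartingales in the range that implicit exploration allows. -/
theorem lrWeight_le_lr (H n i : ℕ) (h1 : 1 ≤ i) (hi : i ≤ n) : lrWeight H n i ≤ lr H n := by
  induction n, hi using Nat.le_induction with
  | base => simp [lrWeight]
  | succ n hn ih =>
    have e : lrWeight H (n + 1) i = lrWeight H n i * (1 - lr H (n + 1)) := by
      rw [lrWeight, lrWeight, Finset.prod_Icc_succ_top (by omega), mul_assoc]
    rw [e]
    refine (mul_le_mul_of_nonneg_right ih (one_sub_lr_succ_nonneg H n)).trans ?_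
    have hn' : (0 : ℝ) < n := by exact_mod_cast (by omega : 0 < n)
    have h2 : (0 : ℝ) < (H : ℝ) + n := by positivity
    rw [one_sub_lr_succ, lr_succ, lr, div_mul_div_comm, div_le_div_iff₀ (by positivity)
      (by positivity)]
    have : (n : ℝ) ≤ H + n := by linarith [Nat.cast_nonneg (α := ℝ) H]
    calc ((H : ℝ) + 1) * n * (H + n + 1) = (H + 1) * (H + n + 1) * n := by ring
      _ ≤ (H + 1) * (H + n + 1) * (H + n) := by gcongr
      _ = _ := by ring

end WeightedSums

/-! ### Visits to a state as an increasing list of episodes, and exchange of summation. -/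

section Visits

variable {K : ℕ} (vis : Fin K → Prop) [DecidablePred vis]

/-- The indices below `k` that satisfy `vis`, in increasing order. -/
def visitList (k : ℕ) : List (Fin K) := (List.finRange K).filter fun j => j.val < k ∧ vis j

theorem mem_visitList {k : ℕ} {j : Fin K} : j ∈ visitList vis k ↔ j.val < k ∧ vis j := by
  simp [visitList]

theorem visitList_zero : visitList vis 0 = [] := by
  simp [visitList]

theorem visitList_eq_filter_take (k : ℕ) :
    visitList vis k = ((List.finRange K).take k).filter fun j => vis j := by
  rw [visitList]
  conv_lhs => rw [← List.take_append_drop k (List.finRange K)]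
  rw [List.filter_append]
  have h2 : ((List.finRange K).drop k).filter (fun j => decide (j.val < k ∧ vis j)) = [] := by
    rw [List.filter_eq_nil_iff]
    intro j hj
    obtain ⟨i, hi, rfl⟩ := List.mem_iff_getElem.1 hj
    simp
  rw [h2, List.append_nil]
  refine List.filter_congr fun j hj => ?_
  obtain ⟨i, hi, rfl⟩ := List.mem_iff_getElem.1 hj
  simp only [List.length_take, List.length_finRange] at hi
  simp
  omega

theorem visitList_succ {k : ℕ} (hk : k < K) :
    visitList vis (k + 1)
      = if vis ⟨k, hk⟩ then visitList vis k ++ [⟨k, hk⟩] else visitList vis k := by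
  rw [visitList_eq_filter_take, visitList_eq_filter_take, List.take_add_one, List.filter_append]
  have : (List.finRange K)[k]? = some ⟨k, hk⟩ := by
    rw [List.getElem?_eq_getElem (by simpa using hk)]
    simp
  rw [this]
  split_ifs with h <;> simp [h]

/-- The position of an episode in the list is the number of visits before it, so a weight by
position is a weight by visit count. -/
theorem indexedSum_visitList (w : ℕ → ℝ) (f : Fin K → ℝ) (k : ℕ) (hk : k ≤ K) :
    indexedSum (visitList vis k) w f
      = ∑ j : Fin K, if j.val < k ∧ vis j then w (visitList vis j).length * f j else 0 := by
  induction k with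
  | zero => simp [visitList_zero, indexedSum]
  | succ k ih =>
    have hk' : k < K := hk
    have split : ∀ j : Fin K, (if j.val < k + 1 ∧ vis j then w (visitList vis j).length * f j else 0)
        = (if j.val < k ∧ vis j then w (visitList vis j).length * f j else 0)
          + if j = ⟨k, hk'⟩ then (if vis j then w (visitList vis j).length * f j else 0) else 0 := by
      intro j
      rcases lt_trichotomy j.val k with h | h | h
      · have : j ≠ ⟨k, hk'⟩ := fun e => by simp [e] at h
        simp [h, this, Nat.lt_succ_of_lt h]
      · have : j = ⟨k, hk'⟩ := Fin.ext h
        subst this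
        simp
      · have : j ≠ ⟨k, hk'⟩ := fun e => by simp [e] at h
        have h3 : ¬ j.val < k := by omega
        have h4 : ¬ j.val < k + 1 := by omega
        simp [h3, h4, this]
    simp only [split, Finset.sum_add_distrib, Finset.sum_ite_eq', Finset.mem_univ, if_true]
    rw [← ih hk'.le, visitList_succ vis hk']
    split_ifs with h
    · rw [indexedSum_append]
    · rw [add_zero]

theorem wsum_visitList_length (H : ℕ) (f : ℕ → ℝ) (k : ℕ) (hk : k ≤ K) :
    wsum H (visitList vis k) (fun j => f (visitList vis j).length)
      = wsum H (List.range (visitList vis k).length) f := by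
  induction k with
  | zero => simp [visitList_zero, wsum_nil]
  | succ k ih =>
    have hk' : k < K := hk
    rw [visitList_succ vis hk']
    split_ifs with h
    · rw [wsum_append, ih hk'.le, List.length_append, List.length_singleton, List.range_succ,
        wsum_append]
      simp
    · exact ih hk'.le

/-- The averages over the previous visits sum up to at most `1 + 1 / H` times the sum. -/
theorem sum_wsum_visitList (H : ℕ) (hH : 0 < H) (D : Fin K → ℝ) (k : ℕ) (hk : k ≤ K) :
    (∑ j : Fin K, if j.val < k ∧ vis j then wsum H (visitList vis j) D else 0)
        + (1 + (visitList vis k).length / H) * wsum H (visitList vis k) D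
      = (1 + 1 / H) * ∑ j : Fin K, if j.val < k ∧ vis j then D j else 0 := by
  induction k with
  | zero => simp [visitList_zero, wsum_nil]
  | succ k ih =>
    have hk' : k < K := hk
    have split : ∀ (F : Fin K → ℝ), (∑ j : Fin K, if j.val < k + 1 ∧ vis j then F j else 0)
        = (∑ j : Fin K, if j.val < k ∧ vis j then F j else 0)
          + if vis ⟨k, hk'⟩ then F ⟨k, hk'⟩ else 0 := by
      intro F
      have h1 := indexedSum_visitList vis (fun _ => 1) F (k + 1) hk
      have h2 := indexedSum_visitList vis (fun _ => 1) F k hk'.le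
      simp only [one_mul] at h1 h2
      rw [← h1, ← h2, visitList_succ vis hk']
      split_ifs
      · rw [indexedSum_append, one_mul]
      · rw [add_zero]
    rw [split, split, mul_add, ← ih hk'.le, visitList_succ vis hk']
    split_ifs with h
    · rw [wsum_append, one_sub_lr_succ, lr_succ, List.length_append, List.length_singleton]
      have hH' : (H : ℝ) ≠ 0 := by exact_mod_cast hH.ne'
      have h2 : (H : ℝ) + (visitList vis k).length + 1 ≠ 0 := by positivity
      push_cast
      field_simp
      ring
    · ring

end Visits

/-! ### Averages of `1 / √i` -/

theorem wsum_range_inv_sqrt_le (H n : ℕ) :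
    wsum H (List.range n) (fun i => 1 / √((i : ℝ) + 1)) ≤ 2 / √n := by
  induction n with
  | zero => simp [wsum_nil]
  | succ n ih =>
    rw [List.range_succ, wsum_append, List.length_range]
    rcases n.eq_zero_or_pos with rfl | hn
    · simp [lr_one, wsum_nil]
    · have hn' : (0 : ℝ) < n := by exact_mod_cast hn
      refine (add_le_add_left (mul_le_mul_of_nonneg_left ih (one_sub_lr_succ_nonneg H n)) _).trans ?_
      rw [one_sub_lr_succ, lr_succ]
      have hs := Real.sqrt_pos.2 hn'
      have hs1 : 0 < √((n : ℝ) + 1) := Real.sqrt_pos.2 (by positivity)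
      have e1 := Real.sq_sqrt hn'.le
      have e2 := Real.sq_sqrt (by positivity : (0 : ℝ) ≤ n + 1)
      push_cast
      rw [← sub_nonneg]
      -- The slack of the induction step is computed exactly; it is a sum of nonnegative terms.
      have : 2 / √((n : ℝ) + 1) - ((n : ℝ) / (H + n + 1) * (2 / √n)
          + ((H : ℝ) + 1) / (H + n + 1) * (1 / √((n : ℝ) + 1)))
          = ((H : ℝ) + (√((n : ℝ) + 1) - √n) ^ 2) / ((H + n + 1) * √((n : ℝ) + 1)) := by
        have e3 : (n : ℝ) / √n = √n := Real.div_sqrt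
        have e4 : (n : ℝ) / (H + n + 1) * (2 / √n) = 2 * √n / (H + n + 1) := by
          rw [div_mul_div_comm, mul_comm (n : ℝ) 2, mul_div_mul_comm]
          field_simp
          rw [e1]
        rw [e4]
        field_simp
        nlinarith
      rw [this]
      positivity

theorem inv_sqrt_le_wsum_range (H n : ℕ) (hn : 0 < n) :
    1 / √n ≤ wsum H (List.range n) fun i => 1 / √((i : ℝ) + 1) := by
  refine le_wsum H _ (by simpa using hn.ne') fun i hi => ?_
  have : (i : ℝ) + 1 ≤ n := by exact_mod_cast List.mem_range.1 hi
  gcongr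

theorem sum_range_inv_sqrt_le (n : ℕ) :
    ∑ m ∈ Finset.range n, (if m = 0 then 0 else 1 / √(m : ℝ)) ≤ 2 * √n := by
  have key : ∑ m ∈ Finset.range (n + 1), (if m = 0 then 0 else 1 / √(m : ℝ)) ≤ 2 * √n := by
    induction n with
    | zero => simp
    | succ n ih =>
      rw [Finset.sum_range_succ, if_neg n.succ_ne_zero]
      have hs1 : 0 < √((n : ℝ) + 1) := Real.sqrt_pos.2 (by positivity)
      have e1 := Real.sq_sqrt (Nat.cast_nonneg (α := ℝ) n)
      have e2 := Real.sq_sqrt (by positivity : (0 : ℝ) ≤ n + 1)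
      have : 1 / √((n : ℝ) + 1) ≤ 2 * √((n : ℝ) + 1) - 2 * √n := by
        rw [div_le_iff₀ hs1]
        nlinarith [sq_nonneg (√((n : ℝ) + 1) - √n)]
      push_cast
      linarith
  refine le_trans ?_ key
  rw [Finset.sum_range_succ]
  refine le_add_of_nonneg_right ?_
  split_ifs <;> positivity

/-! ### The exponential weights potential -/

/-- The product `(1 - y + y²/2)(1 + y + y²/2)` equals `1 + y⁴/4`, and the second factor is at most
`exp y`. -/
theorem exp_neg_le_quadratic {y : ℝ} (hy : 0 ≤ y) : Real.exp (-y) ≤ 1 - y + y ^ 2 / 2 := by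
  rw [Real.exp_neg, inv_le_iff_one_le_mul₀ (Real.exp_pos y)]
  have h1 := Real.quadratic_le_exp_of_nonneg hy
  have h2 : 0 ≤ 1 - y + y ^ 2 / 2 := by nlinarith [sq_nonneg (y - 1)]
  calc (1 : ℝ) ≤ (1 - y + y ^ 2 / 2) * (1 + y + y ^ 2 / 2) := by nlinarith [sq_nonneg (y ^ 2)]
    _ ≤ _ := mul_le_mul_of_nonneg_left h1 h2

theorem log_ex_exp_neg_nonpos {α : Type*} [Fintype α] (p : PMF α) {y : α → ℝ} (hy : ∀ a, 0 ≤ y a) :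
    Real.log (ex p fun a => Real.exp (-y a)) ≤ 0 :=
  Real.log_nonpos (le_ex fun a => (Real.exp_pos _).le)
    (ex_le fun a => by simpa using hy a)

theorem log_ex_exp_neg_le {α : Type*} [Fintype α] (p : PMF α) {y : α → ℝ} (hy : ∀ a, 0 ≤ y a) :
    Real.log (ex p fun a => Real.exp (-y a)) ≤ -ex p y + ex p (fun a => y a ^ 2) / 2 := by
  have h1 : ex p (fun a => Real.exp (-y a)) ≤ 1 - ex p y + ex p (fun a => y a ^ 2) / 2 := by
    refine (ex_mono fun a => exp_neg_le_quadratic (hy a)).trans_eq ?_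
    rw [ex_add, ex_sub, ex_const]
    simp only [div_eq_mul_inv, ex_mul_const]
  have h0 : 0 < ex p fun a => Real.exp (-y a) := by
    obtain ⟨a, ha⟩ := p.support_nonempty
    refine Finset.sum_pos' (fun a _ => by positivity) ⟨a, Finset.mem_univ a, ?_⟩
    have := ENNReal.toReal_pos ((p.mem_support_iff a).1 ha) (p.apply_ne_top a)
    positivity
  have := Real.log_le_sub_one_of_pos h0
  linarith

section Potential

variable {𝒳 : Type x} [Fintype 𝒳] [Nonempty 𝒳]

/-- The logarithm of the mean of `exp (-θ u)`, divided by `θ`. -/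
noncomputable def logMeanExp (θ : ℝ) (u : 𝒳 → ℝ) : ℝ :=
  Real.log ((∑ a, Real.exp (-θ * u a)) / Fintype.card 𝒳) / θ

theorem sum_exp_pos (θ : ℝ) (u : 𝒳 → ℝ) : 0 < ∑ a, Real.exp (-θ * u a) :=
  Finset.sum_pos (fun _ _ => Real.exp_pos _) Finset.univ_nonempty

theorem card_pos_real : (0 : ℝ) < Fintype.card 𝒳 := by exact_mod_cast Fintype.card_pos

/-- The power mean inequality with exponent `b / a ≥ 1`. It allows the inverse temperature to vary
with time. -/
theorem logMeanExp_mono {a b : ℝ} (ha : 0 < a) (hab : a ≤ b) (u : 𝒳 → ℝ) :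
    logMeanExp a u ≤ logMeanExp b u := by
  have hb := ha.trans_le hab
  have hc := card_pos_real (𝒳 := 𝒳)
  have h := Real.rpow_arith_mean_le_arith_mean_rpow Finset.univ
    (fun _ : 𝒳 => (Fintype.card 𝒳 : ℝ)⁻¹) (fun x => Real.exp (-a * u x))
    (fun _ _ => by positivity) (by simp) (fun _ _ => (Real.exp_pos _).le)
    ((one_le_div ha).2 hab)
  have e : ∀ x, Real.exp (-a * u x) ^ (b / a) = Real.exp (-b * u x) := fun x => by
    rw [← Real.exp_mul]
    congr 1
    field_simp
  simp only [e, inv_mul_eq_div, ← Finset.sum_div] at h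
  have hp : 0 < (∑ x, Real.exp (-a * u x)) / Fintype.card 𝒳 := div_pos (sum_exp_pos a u) hc
  have h2 := Real.log_le_log (Real.rpow_pos_of_pos hp _) h
  rw [Real.log_rpow hp] at h2
  rw [logMeanExp, logMeanExp, div_le_div_iff₀ ha hb]
  rw [div_mul_eq_mul_div, div_le_iff₀ ha] at h2
  linarith

theorem logMeanExp_nonpos {θ : ℝ} (hθ : 0 < θ) {u : 𝒳 → ℝ} (hu : ∀ a, 0 ≤ u a) :
    logMeanExp θ u ≤ 0 := by
  refine div_nonpos_of_nonpos_of_nonneg (Real.log_nonpos (div_nonneg (sum_exp_pos θ u).le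
    card_pos_real.le) ?_) hθ.le
  rw [div_le_one card_pos_real]
  refine (Finset.sum_le_card_nsmul Finset.univ _ 1 fun a _ => ?_).trans (by simp)
  rw [Real.exp_le_one_iff, neg_mul, neg_nonpos]
  exact mul_nonneg hθ.le (hu a)

theorem neg_sub_le_logMeanExp {θ : ℝ} (hθ : 0 < θ) (u : 𝒳 → ℝ) (a : 𝒳) :
    -u a - Real.log (Fintype.card 𝒳) / θ ≤ logMeanExp θ u := by
  have h1 : Real.exp (-θ * u a) ≤ ∑ a, Real.exp (-θ * u a) :=
    Finset.single_le_sum (f := fun a => Real.exp (-θ * u a)) (fun _ _ => (Real.exp_pos _).le)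
      (Finset.mem_univ a)
  have h2 := Real.log_le_log (Real.exp_pos _) h1
  rw [Real.log_exp] at h2
  rw [logMeanExp, Real.log_div (sum_exp_pos θ u).ne' card_pos_real.ne', le_div_iff₀ hθ, sub_mul,
    div_mul_cancel₀ _ hθ.ne']
  linarith

theorem expWeights_toReal (θ : ℝ) (u : 𝒳 → ℝ) (a : 𝒳) :
    (expWeights θ u a).toReal = Real.exp (-θ * u a) / ∑ a', Real.exp (-θ * u a') := by
  rw [expWeights, PMF.ofFintype_apply, ENNReal.toReal_ofReal]
  have := sum_exp_pos θ u
  positivity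

/-- Since `q (1 - α) = θ`, the old part of the new exponent is exactly `-θ L`. The ratio of the two
normalizing sums is then a mean under the current policy. -/
theorem logMeanExp_step {θ q α : ℝ} (hα : α < 1) (hθ : 0 < θ) (hq : q * (1 - α) = θ)
    (L l : 𝒳 → ℝ) :
    logMeanExp q (fun a => (1 - α) * L a + α * l a)
      = (1 - α) * logMeanExp θ L
        + Real.log (ex (expWeights θ L) fun a => Real.exp (-(q * α * l a))) / q := by
  have h1 : 0 < 1 - α := by linarith
  have hq0 : 0 < q := by
    by_contra! hcon
    nlinarith
  have hp := sum_exp_pos θ L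
  have hc := card_pos_real (𝒳 := 𝒳)
  have e1 : ex (expWeights θ L) (fun a => Real.exp (-(q * α * l a)))
      = (∑ a, Real.exp (-q * ((1 - α) * L a + α * l a))) / ∑ a, Real.exp (-θ * L a) := by
    rw [ex, Finset.sum_div]
    refine Finset.sum_congr rfl fun a _ => ?_
    rw [expWeights_toReal, div_mul_eq_mul_div, ← Real.exp_add]
    congr 2
    rw [← hq]
    ring
  have hp2 := sum_exp_pos q fun a => (1 - α) * L a + α * l a
  rw [e1, logMeanExp, logMeanExp, Real.log_div hp2.ne' hp.ne', Real.log_div hp2.ne' hc.ne',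
    Real.log_div hp.ne' hc.ne', ← hq]
  field_simp
  ring

end Potential

/-! ### The learning dynamics at a fixed state and step -/

theorem stepSize_pos {m : ℕ} {ι : ℝ} {t : ℕ} (hm : 0 < m) (hι : 0 < ι) (ht : 0 < t) :
    0 < stepSize m ι t := by
  have hm' : (0 : ℝ) < m := by exact_mod_cast hm
  have ht' : (0 : ℝ) < t := by exact_mod_cast ht
  exact Real.sqrt_pos.2 (by positivity)

section Learner

variable {𝒳 : Type x} [Fintype 𝒳] [Nonempty 𝒳] [DecidableEq 𝒳]

/-- The estimates and policies of a learner at a fixed state and step: `vis j` says that episode `j`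
visits the state, with action `act j`, value target `y j` and loss `ℓ j`. -/
structure LocalRun (H : ℕ) (ι : ℝ) {K : ℕ} (vis : Fin K → Prop) [DecidablePred vis]
    (act : Fin K → 𝒳) (y ℓ : Fin K → ℝ) (V₀ : ℝ) (N : ℕ → ℕ) (V : ℕ → ℝ) (L : ℕ → 𝒳 → ℝ)
    (π : ℕ → PMF 𝒳) : Prop where
  N_zero : N 0 = 0
  V_zero : V 0 = V₀
  L_zero : ∀ a, L 0 a = 0
  π_zero : π 0 = PMF.uniformOfFintype 𝒳
  N_succ : ∀ j : Fin K, N (j + 1) = if vis j then N j + 1 else N j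
  V_succ : ∀ j : Fin K, V (j + 1)
    = if vis j then (1 - lr H (N j + 1)) * V j + lr H (N j + 1) * y j else V j
  L_succ : ∀ j : Fin K, ∀ a, L (j + 1) a = if vis j then (1 - lr H (N j + 1)) * L j a
    + lr H (N j + 1) * (if act j = a then
      ℓ j / ((π j (act j)).toReal + stepSize (Fintype.card 𝒳) ι (N j + 1)) else 0) else L j a
  π_succ : ∀ j : Fin K, π (j + 1) = if vis j then
    expWeights (stepSize (Fintype.card 𝒳) ι (N j + 1) / lr H (N j + 1)) (L (j + 1)) else π j

namespace LocalRun

variable {H : ℕ} {ι : ℝ} {K : ℕ} {vis : Fin K → Prop} [DecidablePred vis]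
  {act : Fin K → 𝒳} {y ℓ : Fin K → ℝ} {V₀ : ℝ} {N : ℕ → ℕ} {V : ℕ → ℝ} {L : ℕ → 𝒳 → ℝ}
  {π : ℕ → PMF 𝒳}

theorem ofTables {𝒮 : Type u} (T : ℕ → Tables 𝒮 𝒳) (fb : Fin K → ℕ → 𝒮 → Option (𝒳 × ℝ × ℝ))
    (hT : ∀ j : Fin K, T (j + 1) = (T j).update H ι (fb j)) (h : ℕ) (s : 𝒮)
    (hfb : ∀ j, fb j h s = if vis j then some (act j, y j, ℓ j) else none)
    (hN : (T 0).N h s = 0) (hV : (T 0).V h s = V₀) (hL : ∀ a, (T 0).L h s a = 0)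
    (hπ : (T 0).π h s = PMF.uniformOfFintype 𝒳) :
    LocalRun H ι vis act y ℓ V₀ (fun k => (T k).N h s) (fun k => (T k).V h s)
      (fun k => (T k).L h s) (fun k => (T k).π h s) where
  N_zero := hN
  V_zero := hV
  L_zero := hL
  π_zero := hπ
  N_succ j := by
    rw [hT]
    by_cases hv : vis j <;> simp [Tables.update, hfb, hv]
  V_succ j := by
    rw [hT]
    by_cases hv : vis j <;> simp [Tables.update, hfb, hv]
  L_succ j a := by
    rw [hT]
    by_cases hv : vis j <;> simp [Tables.update, hfb, hv]
  π_succ j := by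
    rw [hT]
    by_cases hv : vis j <;> simp [Tables.update, hfb, hv]

variable (R : LocalRun H ι vis act y ℓ V₀ N V L π)

/-- The loss estimate with implicit exploration. -/
noncomputable def lossEst (ι : ℝ) (act : Fin K → 𝒳) (ℓ : Fin K → ℝ) (N : ℕ → ℕ)
    (π : ℕ → PMF 𝒳) (j : Fin K) (a : 𝒳) : ℝ :=
  if act j = a then ℓ j / ((π j (act j)).toReal + stepSize (Fintype.card 𝒳) ι (N j + 1)) else 0

include R

theorem N_eq (k : ℕ) (hk : k ≤ K) : N k = (visitList vis k).length := by
  induction k with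
  | zero => simp [visitList_zero, R.N_zero]
  | succ k ih =>
    rw [R.N_succ ⟨k, hk⟩, visitList_succ vis hk]
    split_ifs <;> simp [ih (Nat.le_of_succ_le hk)]

/-- The initial value leaves no trace after the first visit, because `α_1 = 1`. -/
theorem V_eq (k : ℕ) (hk : k ≤ K) :
    V k = if visitList vis k = [] then V₀ else wsum H (visitList vis k) y := by
  induction k with
  | zero => simp [visitList_zero, R.V_zero]
  | succ k ih =>
    have hk' := Nat.le_of_succ_le hk
    rw [R.V_succ ⟨k, hk⟩, visitList_succ vis hk]
    split_ifs with hv hnil h1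
    · simp at hnil
    · rw [wsum_append, R.N_eq k hk', ih hk']
      split_ifs with h2
      · simp [h2, lr_one]
      · rfl
    · rw [ih hk', if_pos h1]
    · rw [ih hk', if_neg h1]

theorem L_eq (k : ℕ) (hk : k ≤ K) (a : 𝒳) :
    L k a = wsum H (visitList vis k) fun j => lossEst ι act ℓ N π j a := by
  induction k with
  | zero => simp [visitList_zero, R.L_zero, wsum_nil]
  | succ k ih =>
    have hk' := Nat.le_of_succ_le hk
    rw [R.L_succ ⟨k, hk⟩, visitList_succ vis hk]
    by_cases hv : vis ⟨k, hk⟩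
    · rw [if_pos hv, if_pos hv, wsum_append, ← ih hk', ← R.N_eq k hk']
      rfl
    · rw [if_neg hv, if_neg hv]
      exact ih hk'

theorem π_eq (k : ℕ) (hk : k ≤ K) :
    π k = if visitList vis k = [] then PMF.uniformOfFintype 𝒳
      else expWeights (stepSize (Fintype.card 𝒳) ι (N k) / lr H (N k)) (L k) := by
  induction k with
  | zero => simp [visitList_zero, R.π_zero]
  | succ k ih =>
    have hk' := Nat.le_of_succ_le hk
    by_cases hv : vis ⟨k, hk⟩
    · have hN := R.N_succ ⟨k, hk⟩
      have hπ := R.π_succ ⟨k, hk⟩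
      rw [if_pos hv] at hN hπ
      simp only at hN hπ
      rw [hπ, visitList_succ vis hk, if_pos hv, if_neg (by simp), hN]
    · have hN := R.N_succ ⟨k, hk⟩
      have hπ := R.π_succ ⟨k, hk⟩
      rw [if_neg hv] at hN hπ
      have hL : L (k + 1) = L k := funext fun a => by
        have := R.L_succ ⟨k, hk⟩ a
        rwa [if_neg hv] at this
      simp only at hN hπ
      rw [hπ, visitList_succ vis hk, if_neg hv, ih hk', hN, hL]

theorem π_pos (k : ℕ) (hk : k ≤ K) (a : 𝒳) : 0 < (π k a).toReal := by
  rw [R.π_eq k hk]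
  split_ifs
  · have := Fintype.card_pos (α := 𝒳)
    simp [PMF.uniformOfFintype_apply]
    exact this
  · rw [expWeights_toReal]
    exact div_pos (Real.exp_pos _) (sum_exp_pos _ _)

end LocalRun

end Learner

theorem stepSize_le_two_mul_succ (m : ℕ) {ι : ℝ} (hι : 0 ≤ ι) {n : ℕ} (hn : 0 < n) :
    stepSize m ι n ≤ 2 * stepSize m ι (n + 1) := by
  rw [stepSize, stepSize]
  have h2 : (2 : ℝ) = √4 := by
    rw [show (4 : ℝ) = 2 ^ 2 by norm_num, Real.sqrt_sq (by norm_num)]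
  rw [h2, ← Real.sqrt_mul (by norm_num)]
  refine Real.sqrt_le_sqrt ?_
  rcases m.eq_zero_or_pos with rfl | hm
  · simp
  have hm' : (0 : ℝ) < m := by exact_mod_cast hm
  have hn' : (1 : ℝ) ≤ n := by exact_mod_cast hn
  rw [mul_div_assoc', div_le_div_iff₀ (by positivity) (by positivity)]
  push_cast
  nlinarith [mul_nonneg hι hm'.le]

theorem sqrt_natCast_succ_le {H n : ℕ} (hn : n < H) : √((n : ℝ) + 1) ≤ H := by
  rw [Real.sqrt_le_left (by positivity)]
  have : (n : ℝ) + 1 ≤ H := by exact_mod_cast hn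
  nlinarith

/-! ### The regret for the estimated losses. -/

section Learner

variable {𝒳 : Type x} [Fintype 𝒳] [DecidableEq 𝒳]

namespace LocalRun

variable {H : ℕ} {ι : ℝ} {K : ℕ} {vis : Fin K → Prop} [DecidablePred vis]
  {act : Fin K → 𝒳} {y ℓ : Fin K → ℝ} {V₀ : ℝ} {N : ℕ → ℕ} {V : ℕ → ℝ} {L : ℕ → 𝒳 → ℝ}
  {π : ℕ → PMF 𝒳}

theorem lossEst_nonneg {j : Fin K} (h : 0 ≤ ℓ j) (a : 𝒳) : 0 ≤ lossEst ι act ℓ N π j a := by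
  unfold lossEst stepSize
  split_ifs <;> positivity

/-- The bias that implicit exploration causes in a round. -/
noncomputable def explorationBias (ι : ℝ) (act : Fin K → 𝒳) (ℓ : Fin K → ℝ) (N : ℕ → ℕ)
    (π : ℕ → PMF 𝒳) (j : Fin K) : ℝ :=
  stepSize (Fintype.card 𝒳) ι (N j + 1) * ∑ a, lossEst ι act ℓ N π j a

theorem explorationBias_nonneg {j : Fin K} (h : 0 ≤ ℓ j) :
    0 ≤ explorationBias ι act ℓ N π j :=
  mul_nonneg (Real.sqrt_nonneg _) (Finset.sum_nonneg fun _ _ => lossEst_nonneg h _)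

variable [Nonempty 𝒳] (R : LocalRun H ι vis act y ℓ V₀ N V L π)

include R

theorem den_pos (j : Fin K) (a : 𝒳) :
    0 < (π j a).toReal + stepSize (Fintype.card 𝒳) ι (N j + 1) :=
  add_pos_of_pos_of_nonneg (R.π_pos j j.2.le a) (Real.sqrt_nonneg _)

/-- Pathwise, `π ℓ / (π + η) = ℓ - η ℓ / (π + η)`. The realized loss appears with no martingale
argument. -/
theorem ex_lossEst (j : Fin K) :
    ex (π j) (lossEst ι act ℓ N π j) = ℓ j - explorationBias ι act ℓ N π j := by
  have h := (R.den_pos j (act j)).ne'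
  simp only [ex, explorationBias, lossEst, mul_ite, mul_zero, Finset.sum_ite_eq, Finset.mem_univ,
    if_true]
  field_simp
  ring

/-- One of the two factors cancels against the policy: `π ℓ / (π + η) ≤ ℓ ≤ H`. The variance term is
thereby of the same kind as the exploration bias. -/
theorem ex_lossEst_sq_le {j : Fin K} (h0 : 0 ≤ ℓ j) (h1 : ℓ j ≤ H) :
    ex (π j) (fun a => lossEst ι act ℓ N π j a ^ 2) ≤ H * ∑ a, lossEst ι act ℓ N π j a := by
  rw [ex, Finset.mul_sum]
  refine Finset.sum_le_sum fun a _ => ?_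
  rw [sq, ← mul_assoc]
  refine mul_le_mul_of_nonneg_right ?_ (lossEst_nonneg h0 a)
  unfold lossEst
  split_ifs with ha
  · subst ha
    rw [mul_div_assoc', div_le_iff₀ (R.den_pos j _)]
    have h2 := Real.sqrt_nonneg (ι / (Fintype.card 𝒳 * (N j + 1 : ℕ)))
    rw [stepSize]
    have h3 := (R.π_pos j j.2.le (act j)).le
    nlinarith [mul_le_mul_of_nonneg_left h1 h3, mul_nonneg (Nat.cast_nonneg (α := ℝ) H) h2]
  · simp

/-- Each visit contracts the potential by `1 - α` and adds a log-moment term, as in the recursion of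
`wsum`. The term `H² / √i` pays for the first `H` visits, where the second-order expansion is too
weak. -/
theorem logMeanExp_le (hH : 0 < H) (hι : 0 < ι) (hℓ : ∀ j, vis j → 0 ≤ ℓ j ∧ ℓ j ≤ H)
    (k : ℕ) (hk : k ≤ K) (hne : visitList vis k ≠ []) :
    logMeanExp (stepSize (Fintype.card 𝒳) ι (N k) / lr H (N k)) (L k)
      ≤ wsum H (visitList vis k) fun j => -(ℓ j - explorationBias ι act ℓ N π j)
        + (2 * H * explorationBias ι act ℓ N π j + (H : ℝ) ^ 2 * (1 / √((N j : ℝ) + 1))) := by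
  induction k with
  | zero => simp [visitList_zero] at hne
  | succ k ih =>
    have hk' := Nat.le_of_succ_le hk
    set j : Fin K := ⟨k, hk⟩ with hj
    by_cases hv : vis j
    swap
    · have hN := R.N_succ j
      have hL : L (k + 1) = L k := funext fun a => by
        have := R.L_succ j a
        rwa [if_neg hv] at this
      rw [if_neg hv] at hN
      simp only [hj] at hN
      rw [visitList_succ vis hk, if_neg hv] at hne ⊢
      rw [hN, hL]
      exact ih hk' hne
    · obtain ⟨h0, h1⟩ := hℓ j hv
      have hN : N (k + 1) = N k + 1 := by
        have := R.N_succ j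
        rwa [if_pos hv] at this
      set n := N k with hn
      have hlen : (visitList vis k).length = n := (R.N_eq k hk').symm
      have hL : L (k + 1) = fun a => (1 - lr H (n + 1)) * L k a
          + lr H (n + 1) * lossEst ι act ℓ N π j a := funext fun a => by
        have := R.L_succ j a
        rwa [if_pos hv] at this
      have hX := explorationBias_nonneg (ι := ι) (act := act) (N := N) (π := π) h0
      have hlh := fun a => lossEst_nonneg (ι := ι) (act := act) (N := N) (π := π) h0 a
      have hm := Fintype.card_pos (α := 𝒳)
      have hη' := stepSize_pos (m := Fintype.card 𝒳) hm hι n.succ_pos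
      have hHr : (0 : ℝ) < H := by exact_mod_cast hH
      have hlr' : 0 < lr H (n + 1) := by
        rw [lr_succ]
        positivity
      have hθ' := div_pos hη' hlr'
      -- For at most `H` visits `√(n + 1) ≤ H`, so `H² / √(n + 1) ≥ H` outweighs the loss.
      have hearly : n < H → 0 ≤ -(ℓ j - explorationBias ι act ℓ N π j)
          + (2 * H * explorationBias ι act ℓ N π j + (H : ℝ) ^ 2 * (1 / √((n : ℝ) + 1))) := by
        intro hnH
        have h2 := sqrt_natCast_succ_le hnH
        have h3 : 0 < √((n : ℝ) + 1) := Real.sqrt_pos.2 (by positivity)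
        have h4 : (H : ℝ) ≤ (H : ℝ) ^ 2 * (1 / √((n : ℝ) + 1)) := by
          rw [mul_one_div, le_div_iff₀ h3, sq]
          gcongr
        have h5 : 0 ≤ 2 * H * explorationBias ι act ℓ N π j := by positivity
        linarith
      rw [visitList_succ vis hk, if_pos hv, wsum_append, hlen, hN, hL]
      rcases n.eq_zero_or_pos with h00 | hnpos
      · rw [h00, zero_add, lr_one, sub_self, zero_mul, zero_add, one_mul]
        refine (logMeanExp_nonpos ?_ fun a => ?_).trans ?_
        · have := hθ'
          rwa [h00, zero_add, lr_one] at this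
        · simpa using hlh a
        · exact hearly (h00 ▸ hH)
      · have hnr : (0 : ℝ) < n := by exact_mod_cast hnpos
        have hne' : visitList vis k ≠ [] := by
          intro hc
          rw [hc] at hlen
          simp at hlen
          omega
        have hη := stepSize_pos (m := Fintype.card 𝒳) hm hι hnpos
        have hlr : 0 < lr H n := by
          unfold lr
          positivity
        set η := stepSize (Fintype.card 𝒳) ι n with hηdef
        set α := lr H (n + 1) with hα
        have h1α : 1 - α = n / (H + n + 1) := one_sub_lr_succ H n
        have h1α' : 0 < 1 - α := by
          rw [h1α]
          positivity
        set θ := η / lr H n with hθ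
        have hθpos : 0 < θ := div_pos hη hlr
        -- This is the inverse temperature required by `logMeanExp_step`. The temperature prescribed
        -- by the algorithm after the update is at most `q`, so monotonicity applies.
        set q := θ / (1 - α) with hq
        have hqpos : 0 < q := div_pos hθpos h1α'
        have hqα : q * α = η * ((H + n) / n) := by
          rw [hq, hθ, h1α, hα, lr_succ, lr]
          field_simp
        have hηle : stepSize (Fintype.card 𝒳) ι (n + 1) ≤ η := by
          rw [hηdef, stepSize, stepSize]
          have : (0 : ℝ) < Fintype.card 𝒳 := card_pos_real
          gcongr
          simp
        have hmono : stepSize (Fintype.card 𝒳) ι (n + 1) / α ≤ q := by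
          rw [div_le_iff₀ hlr', hqα]
          refine hηle.trans (le_mul_of_one_le_right hη.le ?_)
          rw [one_le_div hnr]
          linarith
        refine (logMeanExp_mono hθ' hmono _).trans ?_
        rw [logMeanExp_step (θ := θ) (by linarith) hθpos (div_mul_cancel₀ _ h1α'.ne')]
        refine add_le_add (mul_le_mul_of_nonneg_left (ih hk' hne') h1α'.le) ?_
        have hπ : expWeights θ (L k) = π j := by
          have := R.π_eq k hk'
          rw [if_neg hne'] at this
          exact this.symm
        rw [hπ]
        have hy : ∀ a, 0 ≤ q * α * lossEst ι act ℓ N π j a := fun a =>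
          mul_nonneg (mul_nonneg hqpos.le hlr'.le) (hlh a)
        rcases lt_or_ge n H with hnH | hnH
        -- Here `q α = η (H + n) / n` may be far larger than `η`; the log-moment is simply dropped
        -- as nonpositive. Once `n ≥ H` the factor is at most `2`, and the quadratic bound takes
        -- over.
        · exact (div_nonpos_of_nonpos_of_nonneg (log_ex_exp_neg_nonpos _ hy) hqpos.le).trans
            (mul_nonneg hlr'.le (hearly hnH))
        · rw [div_le_iff₀ hqpos]
          refine (log_ex_exp_neg_le _ hy).trans ?_
          have e1 : ex (π j) (fun a => (q * α * lossEst ι act ℓ N π j a) ^ 2)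
              = (q * α) ^ 2 * ex (π j) fun a => lossEst ι act ℓ N π j a ^ 2 := by
            rw [← ex_const_mul]
            simp only [mul_pow]
          rw [e1, ex_const_mul, R.ex_lossEst]
          have hsq := R.ex_lossEst_sq_le h0 h1
          have hsum : 0 ≤ ∑ a, lossEst ι act ℓ N π j a := Finset.sum_nonneg fun a _ => hlh a
          have h2 : q * α ≤ 2 * η := by
            rw [hqα, mul_comm]
            refine mul_le_mul_of_nonneg_right ?_ hη.le
            rw [div_le_iff₀ hnr]
            have : (H : ℝ) ≤ n := by exact_mod_cast hnH
            linarith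
          have h3 : η ≤ 2 * stepSize (Fintype.card 𝒳) ι (n + 1) :=
            stepSize_le_two_mul_succ _ hι.le hnpos
          have h4 : q * α * (H * ∑ a, lossEst ι act ℓ N π j a)
              ≤ 4 * H * explorationBias ι act ℓ N π j := by
            have h5 : 0 ≤ H * ∑ a, lossEst ι act ℓ N π j a := mul_nonneg hHr.le hsum
            refine (mul_le_mul_of_nonneg_right (h2.trans (mul_le_mul_of_nonneg_left h3
              zero_le_two)) h5).trans_eq ?_
            rw [explorationBias]
            change _ = 4 * (H : ℝ) * (stepSize (Fintype.card 𝒳) ι (n + 1) * _)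
            ring
          have hqα0 : 0 ≤ q * α := mul_nonneg hqpos.le hlr'.le
          have h6 : (q * α) ^ 2 * ex (π j) (fun a => lossEst ι act ℓ N π j a ^ 2)
              ≤ (q * α) * (4 * H * explorationBias ι act ℓ N π j) := by
            rw [sq, mul_assoc]
            exact mul_le_mul_of_nonneg_left ((mul_le_mul_of_nonneg_left hsq hqα0).trans h4) hqα0
          have h7 : 0 ≤ (H : ℝ) ^ 2 * (1 / √((n : ℝ) + 1)) := by positivity
          have h8 := mul_nonneg hqα0 h7
          change _ ≤ α * (_ + (_ + (H : ℝ) ^ 2 * (1 / √((n : ℝ) + 1)))) * q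
          nlinarith

/-- The regret of exponential weights with respect to the estimated losses. -/
theorem wsum_sub_le (hH : 0 < H) (hι : 0 < ι) (hℓ : ∀ j, vis j → 0 ≤ ℓ j ∧ ℓ j ≤ H)
    (k : ℕ) (hk : k ≤ K) (hne : visitList vis k ≠ []) (a : 𝒳) :
    wsum H (visitList vis k) ℓ - L k a
      ≤ (1 + 2 * H) * wsum H (visitList vis k) (explorationBias ι act ℓ N π)
        + (H : ℝ) ^ 2 * wsum H (visitList vis k) (fun j => 1 / √((N j : ℝ) + 1))
        + lr H (N k) * Real.log (Fintype.card 𝒳) / stepSize (Fintype.card 𝒳) ι (N k) := by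
  have hNpos : 0 < N k := by
    rw [R.N_eq k hk]
    exact List.length_pos_iff.2 hne
  have hη := stepSize_pos (m := Fintype.card 𝒳) Fintype.card_pos hι hNpos
  have hlr : 0 < lr H (N k) := by
    unfold lr
    positivity
  have h1 := neg_sub_le_logMeanExp (div_pos hη hlr) (L k) a
  have h2 := R.logMeanExp_le hH hι hℓ k hk hne
  have e : ∀ j, -(ℓ j - explorationBias ι act ℓ N π j)
        + (2 * H * explorationBias ι act ℓ N π j + (H : ℝ) ^ 2 * (1 / √((N j : ℝ) + 1)))
      = ((1 + 2 * H) * explorationBias ι act ℓ N π j + (H : ℝ) ^ 2 * (1 / √((N j : ℝ) + 1)))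
        - ℓ j := fun j => by ring
  simp only [e] at h2
  rw [wsum_sub, wsum_add, wsum_const_mul, wsum_const_mul] at h2
  rw [div_div_eq_mul_div, mul_comm (Real.log _)] at h1
  linarith

end LocalRun

end Learner

/-! ### The regret for the mean losses. -/

section Learner

variable {𝒳 : Type x} [Fintype 𝒳] [Nonempty 𝒳] [DecidableEq 𝒳]

namespace LocalRun

variable {H : ℕ} {ι : ℝ} {K : ℕ} {vis : Fin K → Prop} [DecidablePred vis]
  {act : Fin K → 𝒳} {y ℓ : Fin K → ℝ} {V₀ : ℝ} {N : ℕ → ℕ} {V : ℕ → ℝ} {L : ℕ → 𝒳 → ℝ}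
  {π : ℕ → PMF 𝒳}
  (R : LocalRun H ι vis act y ℓ V₀ N V L π)

include R

theorem wsum_inv_sqrt_le (k : ℕ) (hk : k ≤ K) :
    wsum H (visitList vis k) (fun j => 1 / √((N j : ℝ) + 1)) ≤ 2 / √(N k) := by
  have h := wsum_visitList_length vis H (fun i => 1 / √((i : ℝ) + 1)) k hk
  simp only [← R.N_eq _ (Fin.is_le' (a := _)), ← R.N_eq k hk] at h
  rw [h]
  exact wsum_range_inv_sqrt_le H _

theorem inv_sqrt_le_wsum (k : ℕ) (hk : k ≤ K) (hne : visitList vis k ≠ []) :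
    1 / √(N k) ≤ wsum H (visitList vis k) (fun j => 1 / √((N j : ℝ) + 1)) := by
  have h := wsum_visitList_length vis H (fun i => 1 / √((i : ℝ) + 1)) k hk
  simp only [← R.N_eq _ (Fin.is_le' (a := _)), ← R.N_eq k hk] at h
  rw [h]
  refine inv_sqrt_le_wsum_range H _ ?_
  rw [R.N_eq k hk]
  exact List.length_pos_iff.2 hne

/-- The regret of the learner, when the loss estimates do not exceed the mean losses too much. -/
theorem regret_le (hH : 0 < H) (hι : Real.log 2 ≤ ι) (hA : Real.log (Fintype.card 𝒳) ≤ ι)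
    (hℓ : ∀ j, vis j → 0 ≤ ℓ j ∧ ℓ j ≤ H) (lm : Fin K → 𝒳 → ℝ)
    (hlm : ∀ j, vis j → ∀ a, 0 ≤ lm j a ∧ lm j a ≤ H)
    (k : ℕ) (hk : k ≤ K) (hne : visitList vis k ≠ [])
    (h1 : ∀ a, wsum H (visitList vis k) (fun j => lossEst ι act ℓ N π j a - lm j a)
      ≤ 3 * H * ι * lr H (N k) / (2 * stepSize (Fintype.card 𝒳) ι (N k)))
    (h2 : ∀ a, wsum H (visitList vis k) (fun j => stepSize (Fintype.card 𝒳) ι (N j + 1)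
      * (lossEst ι act ℓ N π j a - lm j a)) ≤ 3 * H * ι * lr H (N k) / 2) (a : 𝒳) :
    wsum H (visitList vis k) (fun j => ℓ j - lm j a)
      ≤ 25 * √((H : ℝ) ^ 4 * Fintype.card 𝒳 * ι / N k) := by
  have hι2 : 0.69 ≤ ι := by linarith [Real.log_two_gt_d9]
  have hι0 : 0 < ι := by linarith
  have hNpos : 0 < N k := by
    rw [R.N_eq k hk]
    exact List.length_pos_iff.2 hne
  set n := N k with hn
  have hnr : (0 : ℝ) < n := by exact_mod_cast hNpos
  have hm := Fintype.card_pos (α := 𝒳)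
  have hH1 : (1 : ℝ) ≤ H := by exact_mod_cast hH
  set A : ℝ := (Fintype.card 𝒳 : ℝ) with hAdef
  have hA1 : 1 ≤ A := by
    rw [hAdef]
    exact_mod_cast hm
  have hA0 : 0 < A := by linarith
  set s := √(A * ι / n) with hs
  have hs0 : 0 < s := Real.sqrt_pos.2 (by positivity)
  have hs2 : s ^ 2 = A * ι / n := Real.sq_sqrt (by positivity)
  have hgoal : √((H : ℝ) ^ 4 * A * ι / n) = (H : ℝ) ^ 2 * s := by
    rw [hs, show (H : ℝ) ^ 4 * A * ι / n = ((H : ℝ) ^ 2) ^ 2 * (A * ι / n) by ring,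
      Real.sqrt_mul (by positivity), Real.sqrt_sq (by positivity)]
  rw [hgoal]
  -- If `H s > 1` the claim exceeds the trivial regret bound `H`. Otherwise `(H s)² ≤ H s`, which
  -- makes the deviation part of the bias first order.
  by_cases hcase : 1 < H * s
  · have : wsum H (visitList vis k) (fun j => ℓ j - lm j a) ≤ H := by
      refine wsum_le H _ hne fun j hj => ?_
      have hv := ((mem_visitList vis).1 hj).2
      linarith [(hℓ j hv).2, (hlm j hv a).1]
    have h3 : (H : ℝ) ≤ H * (H * s) := le_mul_of_one_le_right (by positivity) hcase.le
    have h4 : 0 ≤ H * (H * s) := by positivity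
    linarith
  rw [not_lt] at hcase
  have hη := stepSize_pos hm hι0 hNpos
  have hηs : stepSize (Fintype.card 𝒳) ι n * s = ι / n := by
    rw [stepSize, hs, ← hAdef, ← Real.sqrt_mul (by positivity)]
    rw [show ι / (A * n) * (A * ι / n) = (ι / n) ^ 2 by field_simp]
    exact Real.sqrt_sq (by positivity)
  have hlr : lr H n ≤ 2 * H / n := by
    rw [lr]
    gcongr
    · linarith
    · linarith
  have hlr0 : 0 ≤ lr H n := lr_nonneg H n
  -- This uses `A ι ≥ 0.69` and `1.25² · 0.69 > 1`.
  have hinv : 1 / √(n : ℝ) ≤ 1.25 * s := by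
    refine (sq_le_sq₀ (by positivity) (by positivity)).1 ?_
    rw [div_pow, mul_pow, hs2, Real.sq_sqrt hnr.le, one_pow, mul_div_assoc']
    gcongr
    have : ι ≤ A * ι := le_mul_of_one_le_left hι0.le hA1
    linarith
  have hbias : wsum H (visitList vis k) (explorationBias ι act ℓ N π) ≤ 5 * (H * s) := by
    have e1 : wsum H (visitList vis k) (explorationBias ι act ℓ N π)
        = ∑ a, (wsum H (visitList vis k) (fun j => stepSize (Fintype.card 𝒳) ι (N j + 1)
            * (lossEst ι act ℓ N π j a - lm j a))
          + wsum H (visitList vis k) fun j => stepSize (Fintype.card 𝒳) ι (N j + 1) * lm j a) := by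
      simp only [← wsum_add, ← wsum_finset_sum]
      refine wsum_congr _ _ fun j _ => ?_
      rw [explorationBias, Finset.mul_sum]
      exact Finset.sum_congr rfl fun _ _ => by ring
    have e2 : ∀ j, stepSize (Fintype.card 𝒳) ι (N j + 1) = √(ι / A) * (1 / √((N j : ℝ) + 1)) := by
      intro j
      rw [stepSize, mul_one_div, ← Real.sqrt_div (by positivity), div_div]
      push_cast
      rfl
    have e3 : ∀ a, wsum H (visitList vis k) (fun j => stepSize (Fintype.card 𝒳) ι (N j + 1) * lm j a)
        ≤ H * (√(ι / A) * (2 / √n)) := by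
      intro a
      calc _ ≤ wsum H (visitList vis k) (fun j => H * (√(ι / A) * (1 / √((N j : ℝ) + 1)))) := by
            refine wsum_mono _ _ fun j hj => ?_
            rw [e2, mul_comm]
            exact mul_le_mul_of_nonneg_right (hlm j ((mem_visitList vis).1 hj).2 a).2
              (by positivity)
        _ ≤ _ := by
            rw [wsum_const_mul, wsum_const_mul]
            gcongr
            exact R.wsum_inv_sqrt_le k hk
    have e4 : A * (√(ι / A) * (2 / √n)) = 2 * s := by
      have e40 : A * √(ι / A) = √(A * ι) := by
        rw [show A * ι = A ^ 2 * (ι / A) by field_simp, Real.sqrt_mul (by positivity),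
          Real.sqrt_sq hA0.le]
      rw [hs, Real.sqrt_div (by positivity : (0 : ℝ) ≤ A * ι), ← e40]
      ring
    rw [e1]
    refine (Finset.sum_le_sum fun a _ => add_le_add (h2 a) (e3 a)).trans ?_
    rw [Finset.sum_const, Finset.card_univ, nsmul_eq_mul, ← hAdef]
    -- Each of the `A` actions contributes one deviation; with `α_n ≤ 2H / n` their sum is at most
    -- `3 H² A ι / n = 3 (H s)²`.
    have e5 : A * (3 * H * ι * lr H n / 2) ≤ 3 * (H * s) ^ 2 := by
      rw [mul_pow, hs2]
      calc A * (3 * H * ι * lr H n / 2) ≤ A * (3 * H * ι * (2 * H / n) / 2) := by gcongr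
        _ = _ := by
          field_simp
    have e6 : (H * s) ^ 2 ≤ H * s := by
      have : 0 ≤ H * s := by positivity
      rw [sq]
      exact mul_le_of_le_one_left this hcase
    have e7 : A * (3 * H * ι * lr H n / 2 + H * (√(ι / A) * (2 / √n)))
        = A * (3 * H * ι * lr H n / 2) + H * (A * (√(ι / A) * (2 / √n))) := by ring
    rw [e7, e4]
    linarith
  have hreg := R.wsum_sub_le hH hι0 hℓ k hk hne a
  have hinvsum := R.wsum_inv_sqrt_le k hk
  have h1a := h1 a
  rw [wsum_sub, ← R.L_eq k hk a] at h1a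
  rw [wsum_sub]
  have t1 : (1 + 2 * H) * wsum H (visitList vis k) (explorationBias ι act ℓ N π)
      ≤ (3 * H) * (5 * (H * s)) := by
    refine (mul_le_mul_of_nonneg_left hbias (by positivity)).trans ?_
    gcongr
    linarith
  have t2 : (H : ℝ) ^ 2 * wsum H (visitList vis k) (fun j => 1 / √((N j : ℝ) + 1))
      ≤ (H : ℝ) ^ 2 * (2.5 * s) := by
    gcongr
    refine hinvsum.trans ?_
    have : 2 / √(n : ℝ) = 2 * (1 / √(n : ℝ)) := by ring
    rw [this]
    linarith
  have t0 : lr H n * ι / stepSize (Fintype.card 𝒳) ι n ≤ 2 * H * s := by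
    rw [div_le_iff₀ hη, mul_assoc, mul_comm s, hηs]
    calc lr H n * ι ≤ 2 * H / n * ι := by gcongr
      _ = _ := by ring
  have t3 : lr H n * Real.log (Fintype.card 𝒳) / stepSize (Fintype.card 𝒳) ι n ≤ 2 * H * s := by
    refine le_trans ?_ t0
    gcongr
  have t4 : 3 * H * ι * lr H n / (2 * stepSize (Fintype.card 𝒳) ι n) ≤ 3 * H * (H * s) := by
    calc _ = 3 * H / 2 * (lr H n * ι / stepSize (Fintype.card 𝒳) ι n) := by
          field_simp
      _ ≤ 3 * H / 2 * (2 * H * s) := by gcongr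
      _ = _ := by ring
  have t5 : H * s ≤ (H : ℝ) ^ 2 * s := by
    gcongr
    exact le_self_pow₀ hH1 two_ne_zero
  have t6 : 0 ≤ (H : ℝ) ^ 2 * s := by positivity
  -- The contributions, in units of `H² s`, are `15` (bias), `2.5` (early visits), `2` (entropy) and
  -- `3` (comparator), within the allowed `25`.
  rw [← hn] at hreg
  linarith

end LocalRun

end Learner

/-! ### Concentration of the loss estimates -/

/-- It rests on `log (1 + w) ≥ 2w / (2 + w)` at `w = u z / p`: as `u z ≤ 2η`, the denominator `p +
η` is large enough. -/
theorem exp_implicit_exploration_le {p z η u : ℝ} (hp : 0 < p) (hz0 : 0 ≤ z) (hz1 : z ≤ 1)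
    (hu0 : 0 ≤ u) (hu : u ≤ 2 * η) : Real.exp (u * (z / (p + η))) ≤ 1 + u * z / p := by
  have hw : 0 ≤ u * z / p := by positivity
  rw [← Real.le_log_iff_exp_le (by positivity)]
  refine le_trans ?_ (Real.le_log_one_add_of_nonneg hw)
  have hη : 0 ≤ η := by linarith
  have h1 : 2 * (u * z / p) / (u * z / p + 2) = 2 * (u * z) / (u * z + 2 * p) := by
    field_simp
  have h2 : 0 ≤ u * z := mul_nonneg hu0 hz0
  rw [h1, mul_div_assoc', div_le_div_iff₀ (by positivity) (by positivity)]
  have h3 : u * z ≤ 2 * η := (mul_le_of_le_one_right hu0 hz1).trans hu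
  nlinarith

/-- The implicit exploration estimate of a loss has a sub-unit exponential moment around the mean
loss. -/
theorem ex_exp_lossEst_le {𝒳 β : Type*} [Fintype 𝒳] [DecidableEq 𝒳] [Fintype β]
    (θ : PMF 𝒳) (x : 𝒳) (hθ : 0 < (θ x).toReal) (q : 𝒳 → PMF β) (ℓ : 𝒳 → β → ℝ) {B : ℝ}
    (hB : 0 < B) (hℓ : ∀ y, 0 ≤ ℓ x y ∧ ℓ x y ≤ B) {η u : ℝ} (hu0 : 0 ≤ u) (hu : u ≤ 2 * η) :
    ex θ (fun x' => ex (q x') fun y => Real.exp (u * ((if x' = x then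
      ℓ x' y / ((θ x').toReal + η) else 0) - ex (q x) (ℓ x)) / B)) ≤ 1 := by
  set m := ex (q x) (ℓ x) with hm
  have key : ∀ x', ex (q x') (fun y => Real.exp (u * ((if x' = x then
      ℓ x' y / ((θ x').toReal + η) else 0) - m) / B))
      ≤ Real.exp (-(u * m / B)) * (1 + if x' = x then u * m / B / (θ x).toReal else 0) := by
    intro x'
    split_ifs with hx
    · subst hx
      have : ∀ y, Real.exp (u * (ℓ x' y / ((θ x').toReal + η) - m) / B)
          ≤ Real.exp (-(u * m / B)) * (1 + u / B / (θ x').toReal * ℓ x' y) := by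
        intro y
        have e : u * (ℓ x' y / ((θ x').toReal + η) - m) / B
            = -(u * m / B) + u * (ℓ x' y / B / ((θ x').toReal + η)) := by
          ring
        rw [e, Real.exp_add]
        refine mul_le_mul_of_nonneg_left ?_ (Real.exp_nonneg _)
        refine (exp_implicit_exploration_le hθ (div_nonneg (hℓ y).1 hB.le)
          ((div_le_one hB).2 (hℓ y).2) hu0 hu).trans_eq ?_
        ring
      refine (ex_mono this).trans_eq ?_
      rw [ex_const_mul, ex_add, ex_const, ex_const_mul, ← hm]
      ring
    · refine (ex_const _ _).trans_le (le_of_eq ?_)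
      rw [add_zero, mul_one]
      congr 1
      ring
  refine (ex_mono key).trans ?_
  rw [ex_const_mul, ex_add, ex_const]
  have e : ex θ (fun x' => if x' = x then u * m / B / (θ x).toReal else 0) = u * m / B := by
    simp only [ex, mul_ite, mul_zero, Finset.sum_ite_eq', Finset.mem_univ, if_true]
    field_simp
  -- The action is drawn with probability `θ x`, which cancels the `1 / p`; what remains is `1 + v ≤
  -- exp v` with `v = u m / B`.
  rw [e, Real.exp_neg, inv_mul_le_iff₀ (Real.exp_pos _), mul_one, add_comm]
  exact Real.add_one_le_exp _

/-- The coefficients of the exponential supermartingales. -/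
noncomputable def ixCoeff (H m : ℕ) (ι : ℝ) (late : Bool) (t n : ℕ) : ℝ :=
  if n < t then
    lrWeight H t (n + 1) * (2 * (if late then stepSize m ι t else stepSize m ι (n + 1)) / lr H t)
  else 0

theorem stepSize_anti (m : ℕ) {ι : ℝ} (hι : 0 ≤ ι) {n t : ℕ} (hn : 0 < n) (h : n ≤ t) :
    stepSize m ι t ≤ stepSize m ι n := by
  rw [stepSize, stepSize]
  refine Real.sqrt_le_sqrt ?_
  rcases m.eq_zero_or_pos with rfl | hm
  · simp
  have hm' : (0 : ℝ) < m := by exact_mod_cast hm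
  have hn' : (0 : ℝ) < n := by exact_mod_cast hn
  gcongr

theorem ixCoeff_nonneg (H m : ℕ) (ι : ℝ) (late : Bool) (t n : ℕ) :
    0 ≤ ixCoeff H m ι late t n := by
  have h1 := lrWeight_nonneg H t (n + 1)
  have h2 := lr_nonneg H t
  unfold ixCoeff stepSize
  split_ifs <;> positivity

theorem ixCoeff_le (H m : ℕ) {ι : ℝ} (hι : 0 ≤ ι) (late : Bool) (t n : ℕ) :
    ixCoeff H m ι late t n ≤ 2 * stepSize m ι (n + 1) := by
  have hs : 0 ≤ stepSize m ι (n + 1) := Real.sqrt_nonneg _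
  unfold ixCoeff
  split_ifs with hn hl
  · have hlr : 0 < lr H t := by
      unfold lr
      have : (0 : ℝ) < t := by exact_mod_cast (by omega : 0 < t)
      positivity
    have hw := lrWeight_le_lr H t (n + 1) (by omega) hn
    have h2 := stepSize_anti m hι n.succ_pos (Nat.succ_le_of_lt hn)
    rw [mul_div_assoc', div_le_iff₀ hlr, mul_comm _ (lr H t)]
    have : 0 ≤ stepSize m ι t := Real.sqrt_nonneg _
    gcongr
  · have hlr : 0 < lr H t := by
      unfold lr
      have : (0 : ℝ) < t := by exact_mod_cast (by omega : 0 < t)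
      positivity
    have hw := lrWeight_le_lr H t (n + 1) (by omega) hn
    rw [mul_div_assoc', div_le_iff₀ hlr, mul_comm _ (lr H t)]
    gcongr
  · positivity

namespace LocalRun

variable {𝒳 : Type x} [Fintype 𝒳] [Nonempty 𝒳] [DecidableEq 𝒳]
  {H : ℕ} {ι : ℝ} {K : ℕ} {vis : Fin K → Prop} [DecidablePred vis]
  {act : Fin K → 𝒳} {y ℓ : Fin K → ℝ} {V₀ : ℝ} {N : ℕ → ℕ} {V : ℕ → ℝ} {L : ℕ → 𝒳 → ℝ}
  {π : ℕ → PMF 𝒳}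
  (R : LocalRun H ι vis act y ℓ V₀ N V L π)

include R

theorem N_mono {j k : ℕ} (hjk : j ≤ k) (hk : k ≤ K) : N j ≤ N k := by
  induction k, hjk using Nat.le_induction with
  | base => exact le_rfl
  | succ k _ ih =>
    refine (ih (Nat.le_of_succ_le hk)).trans ?_
    have := R.N_succ ⟨k, hk⟩
    simp only at this
    rw [this]
    split_ifs <;> omega

/-- The cutoff on the visit count selects exactly the visits before episode `k`. The left side has
coefficients determined by a count fixed in advance, as the supermartingales need, although `N k`
itself is random. -/
theorem sum_eq_wsum (k : ℕ) (hk : k ≤ K) (f : Fin K → ℝ) :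
    (∑ j, if vis j then (if N j < N k then lrWeight H (N k) (N j + 1) else 0) * f j else 0)
      = wsum H (visitList vis k) f := by
  rw [wsum, indexedSum_visitList vis _ _ k hk, ← R.N_eq k hk]
  refine Finset.sum_congr rfl fun j _ => ?_
  rw [← R.N_eq j j.2.le]
  by_cases hv : vis j
  · have hN : N (j + 1) = N j + 1 := by rw [R.N_succ, if_pos hv]
    by_cases hj : j.val < k
    · have : N j < N k := by
        have := R.N_mono (Nat.succ_le_of_lt hj) hk
        rw [Nat.succ_eq_add_one] at this
        omega
      simp [hv, hj, this]
    · have : ¬ N j < N k := by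
        have := R.N_mono (not_lt.1 hj) j.2.le
        omega
      simp [hv, hj, this]
  · simp [hv]

/-- The regret of the learner, when the exponents of the supermartingales are small. -/
theorem regret_le_of_ixCoeff (hH : 0 < H) (hι : Real.log 2 ≤ ι)
    (hA : Real.log (Fintype.card 𝒳) ≤ ι)
    (hℓ : ∀ j, vis j → 0 ≤ ℓ j ∧ ℓ j ≤ H) (lm : Fin K → 𝒳 → ℝ)
    (hlm : ∀ j, vis j → ∀ a, 0 ≤ lm j a ∧ lm j a ≤ H)
    (hgood : ∀ (late : Bool) (t : Fin K) (a : 𝒳), (∑ j, if vis j then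
      ixCoeff H (Fintype.card 𝒳) ι late (t + 1) (N j) * (lossEst ι act ℓ N π j a - lm j a) / H
        else 0) ≤ 3 * ι)
    (k : ℕ) (hk : k ≤ K) (hne : visitList vis k ≠ []) (a : 𝒳) :
    wsum H (visitList vis k) (fun j => ℓ j - lm j a)
      ≤ 25 * √((H : ℝ) ^ 4 * Fintype.card 𝒳 * ι / N k) := by
  have hι0 : 0 < ι := (Real.log_pos one_lt_two).trans_le hι
  have hNpos : 0 < N k := by
    rw [R.N_eq k hk]
    exact List.length_pos_iff.2 hne
  have hNle : N k ≤ K := by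
    rw [R.N_eq k hk, visitList]
    exact (List.length_filter_le _ _).trans (by simp)
  have hη := stepSize_pos (m := Fintype.card 𝒳) Fintype.card_pos hι0 hNpos
  have hlr : 0 < lr H (N k) := by
    unfold lr
    positivity
  have hHr : (0 : ℝ) < H := by exact_mod_cast hH
  have key : ∀ late a, (2 / (lr H (N k) * H)) * wsum H (visitList vis k) (fun j =>
      (if late = true then stepSize (Fintype.card 𝒳) ι (N k)
        else stepSize (Fintype.card 𝒳) ι (N j + 1)) * (lossEst ι act ℓ N π j a - lm j a))
      ≤ 3 * ι := by
    intro late a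
    -- The index `t : Fin K` stands for the visit count `t + 1`, hence the shift by one.
    have h := hgood late ⟨N k - 1, by omega⟩ a
    simp only [Nat.sub_add_cancel hNpos] at h
    rw [← wsum_const_mul, ← R.sum_eq_wsum k hk]
    refine le_trans (le_of_eq (Finset.sum_congr rfl fun j _ => ?_)) h
    unfold ixCoeff
    by_cases hv : vis j
    · by_cases hlt : N j < N k
      · simp only [hv, hlt, if_true]
        cases late <;> simp <;> ring
      · simp [hv, hlt]
    · simp [hv]
  refine R.regret_le hH hι hA hℓ lm hlm k hk hne (fun a => ?_) (fun a => ?_) a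
  · have h := key true a
    simp only [if_true] at h
    rw [wsum_const_mul] at h
    rw [le_div_iff₀ (by positivity)]
    rw [div_mul_eq_mul_div, div_le_iff₀ (by positivity)] at h
    linarith
  · have h := key false a
    simp only [Bool.false_eq_true, if_false] at h
    rw [div_mul_eq_mul_div, div_le_iff₀ (by positivity)] at h
    linarith

end LocalRun

/-! ### The learning dynamics in a game -/

theorem bonus_nonneg (H m : ℕ) {c : ℝ} (hc : 0 ≤ c) (ι : ℝ) (t : ℕ) : 0 ≤ bonus H m c ι t :=
  mul_nonneg hc (Real.sqrt_nonneg _)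

/-! ### Ranges of the truncated estimates and of the targets. -/

section Truncation

variable {𝒮 : Type u} {𝒜 : Type v} {ℬ : Type w}

theorem upperV_le (H : ℕ) (T : Tables 𝒮 𝒜) {h : ℕ} (hh : h ≤ H) (s : 𝒮) :
    upperV H T h s ≤ (H : ℝ) - h := by
  unfold upperV
  split_ifs
  · exact min_le_left _ _
  · rw [sub_nonneg]
    exact_mod_cast hh

theorem upperV_nonneg {H : ℕ} {T : Tables 𝒮 𝒜} (hT : ∀ h < H, ∀ s, 0 ≤ T.V h s) (h : ℕ) (s : 𝒮) :
    0 ≤ upperV H T h s := by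
  unfold upperV
  split_ifs with hh
  · refine le_min ?_ (hT h hh s)
    rw [sub_nonneg]
    exact_mod_cast hh.le
  · exact le_rfl

theorem lowerV_nonneg (H : ℕ) (T : Tables 𝒮 ℬ) (h : ℕ) (s : 𝒮) : 0 ≤ lowerV H T h s := by
  unfold lowerV
  split_ifs
  · exact le_max_left _ _
  · exact le_rfl

theorem lowerV_le {H : ℕ} {T : Tables 𝒮 ℬ} (hT : ∀ h < H, ∀ s, T.V h s ≤ (H : ℝ) - h) {h : ℕ}
    (hh : h ≤ H) (s : 𝒮) : lowerV H T h s ≤ (H : ℝ) - h := by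
  have h0 : (0 : ℝ) ≤ (H : ℝ) - h := by
    rw [sub_nonneg]
    exact_mod_cast hh
  unfold lowerV
  split_ifs with hlt
  · exact max_le h0 (hT h hlt s)
  · exact h0

end Truncation

namespace MarkovGame

variable {𝒮 : Type u} {𝒜 : Type v} {ℬ : Type w} (G : MarkovGame 𝒮 𝒜 ℬ)

/-- The value target of the max-player, without the bonus. -/
noncomputable def maxTarget (T : Tables 𝒮 𝒜) (h : ℕ) (x : Transition 𝒮 𝒜 ℬ) : ℝ :=
  G.r h x.1 x.2.1 x.2.2.1 + upperV G.H T (h + 1) x.2.2.2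

/-- The value target of the min-player, without the bonus. -/
noncomputable def minTarget (T : Tables 𝒮 ℬ) (h : ℕ) (x : Transition 𝒮 𝒜 ℬ) : ℝ :=
  G.r h x.1 x.2.1 x.2.2.1 + lowerV G.H T (h + 1) x.2.2.2

theorem maxTarget_mem {T : Tables 𝒮 𝒜} (hT : ∀ h < G.H, ∀ s, 0 ≤ T.V h s) {h : ℕ} (hh : h < G.H)
    (x : Transition 𝒮 𝒜 ℬ) : 0 ≤ G.maxTarget T h x ∧ G.maxTarget T h x ≤ (G.H : ℝ) - h := by
  have h1 := G.r_nonneg h hh x.1 x.2.1 x.2.2.1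
  have h2 := G.r_le_one h hh x.1 x.2.1 x.2.2.1
  have h3 := upperV_nonneg hT (h + 1) x.2.2.2
  have h4 := upperV_le G.H T (Nat.succ_le_of_lt hh) x.2.2.2
  push_cast at h4
  unfold maxTarget
  constructor <;> linarith

theorem minTarget_mem {T : Tables 𝒮 ℬ} (hT : ∀ h < G.H, ∀ s, T.V h s ≤ (G.H : ℝ) - h) {h : ℕ}
    (hh : h < G.H) (x : Transition 𝒮 𝒜 ℬ) :
    0 ≤ G.minTarget T h x ∧ G.minTarget T h x ≤ (G.H : ℝ) - h := by
  have h1 := G.r_nonneg h hh x.1 x.2.1 x.2.2.1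
  have h2 := G.r_le_one h hh x.1 x.2.1 x.2.2.1
  have h3 := lowerV_nonneg G.H T (h + 1) x.2.2.2
  have h4 := lowerV_le hT (Nat.succ_le_of_lt hh) x.2.2.2
  push_cast at h4
  unfold minTarget
  constructor <;> linarith

variable [DecidableEq 𝒮] (c ι : ℝ) {K : ℕ} (ω : Fin K → Fin G.H → Transition 𝒮 𝒜 ℬ)

section MaxPlayer

variable [Fintype 𝒜] [Nonempty 𝒜] [DecidableEq 𝒜]

theorem maxTables_succ (j : Fin K) :
    G.maxTables c ι ω (j + 1) = G.maxUpdate c ι (G.maxTables c ι ω j) (ω j) := by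
  rw [maxTables, dif_pos j.2]

/-- Tables are functions of the past, so conditioning on the first `K` episodes freezes every
earlier exponent. -/
theorem maxTables_snoc (τ : Fin G.H → Transition 𝒮 𝒜 ℬ) (k : ℕ) (hk : k ≤ K) :
    G.maxTables c ι (Fin.snoc (α := fun _ => Fin G.H → Transition 𝒮 𝒜 ℬ) ω τ) k
      = G.maxTables c ι ω k := by
  induction k with
  | zero => rfl
  | succ k ih =>
    have hk' : k < K := hk
    rw [maxTables, maxTables, dif_pos hk', dif_pos (Nat.lt_succ_of_lt hk'), ih hk'.le]
    congr 1
    exact Fin.snoc_castSucc (α := fun _ => Fin G.H → Transition 𝒮 𝒜 ℬ) τ ω ⟨k, hk'⟩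

theorem maxTables_localRun (h : Fin G.H) (s : 𝒮) :
    LocalRun G.H ι (fun j => (ω j h).1 = s) (fun j => (ω j h).2.1)
      (fun j => G.maxTarget (G.maxTables c ι ω j) h (ω j h)
        + bonus G.H (Fintype.card 𝒜) c ι ((G.maxTables c ι ω j).N h s + 1))
      (fun j => (G.H : ℝ) - h - G.maxTarget (G.maxTables c ι ω j) h (ω j h))
      ((G.H : ℝ) - h) (fun k => (G.maxTables c ι ω k).N h s) (fun k => (G.maxTables c ι ω k).V h s)
      (fun k => (G.maxTables c ι ω k).L h s) (fun k => (G.maxTables c ι ω k).π h s) := by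
  refine LocalRun.ofTables _ _ (fun j => G.maxTables_succ c ι ω j) h s (fun j => ?_) rfl rfl
    (fun _ => rfl) rfl
  simp only [h.2, dif_pos, Fin.eta, maxTarget]
  by_cases hs : (ω j h).1 = s
  · subst hs
    simp
  · simp [hs]

theorem maxTables_V_nonneg (hc : 0 ≤ c) (k : ℕ) (hk : k ≤ K) (h : ℕ) (hh : h < G.H) (s : 𝒮) :
    0 ≤ (G.maxTables c ι ω k).V h s := by
  induction k generalizing h s with
  | zero =>
    change (0 : ℝ) ≤ (G.H : ℝ) - h
    rw [sub_nonneg]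
    exact_mod_cast hh.le
  | succ k ih =>
    have hk' := Nat.le_of_succ_le hk
    have := (G.maxTables_localRun c ι ω ⟨h, hh⟩ s).V_succ ⟨k, hk⟩
    simp only at this
    rw [this]
    split_ifs
    · refine add_nonneg (mul_nonneg (one_sub_lr_succ_nonneg _ _) (ih hk' h hh s))
        (mul_nonneg (lr_nonneg _ _) (add_nonneg ?_ (bonus_nonneg _ _ hc _ _)))
      exact (G.maxTarget_mem (ih hk') hh _).1
    · exact ih hk' h hh s

end MaxPlayer

section MinPlayer

variable [Fintype ℬ] [Nonempty ℬ] [DecidableEq ℬ]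

theorem minTables_succ (j : Fin K) :
    G.minTables c ι ω (j + 1) = G.minUpdate c ι (G.minTables c ι ω j) (ω j) := by
  rw [minTables, dif_pos j.2]

theorem minTables_snoc (τ : Fin G.H → Transition 𝒮 𝒜 ℬ) (k : ℕ) (hk : k ≤ K) :
    G.minTables c ι (Fin.snoc (α := fun _ => Fin G.H → Transition 𝒮 𝒜 ℬ) ω τ) k
      = G.minTables c ι ω k := by
  induction k with
  | zero => rfl
  | succ k ih =>
    have hk' : k < K := hk
    rw [minTables, minTables, dif_pos hk', dif_pos (Nat.lt_succ_of_lt hk'), ih hk'.le]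
    congr 1
    exact Fin.snoc_castSucc (α := fun _ => Fin G.H → Transition 𝒮 𝒜 ℬ) τ ω ⟨k, hk'⟩

theorem minTables_localRun (h : Fin G.H) (s : 𝒮) :
    LocalRun G.H ι (fun j => (ω j h).1 = s) (fun j => (ω j h).2.2.1)
      (fun j => G.minTarget (G.minTables c ι ω j) h (ω j h)
        - bonus G.H (Fintype.card ℬ) c ι ((G.minTables c ι ω j).N h s + 1))
      (fun j => G.minTarget (G.minTables c ι ω j) h (ω j h))
      0 (fun k => (G.minTables c ι ω k).N h s) (fun k => (G.minTables c ι ω k).V h s)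
      (fun k => (G.minTables c ι ω k).L h s) (fun k => (G.minTables c ι ω k).π h s) := by
  refine LocalRun.ofTables _ _ (fun j => G.minTables_succ c ι ω j) h s (fun j => ?_) rfl rfl
    (fun _ => rfl) rfl
  simp only [h.2, dif_pos, Fin.eta, minTarget]
  by_cases hs : (ω j h).1 = s
  · subst hs
    simp
  · simp [hs]

theorem minTables_V_le (hc : 0 ≤ c) (k : ℕ) (hk : k ≤ K) (h : ℕ) (hh : h < G.H) (s : 𝒮) :
    (G.minTables c ι ω k).V h s ≤ (G.H : ℝ) - h := by
  induction k generalizing h s with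
  | zero =>
    change (0 : ℝ) ≤ (G.H : ℝ) - h
    rw [sub_nonneg]
    exact_mod_cast hh.le
  | succ k ih =>
    have hk' := Nat.le_of_succ_le hk
    have := (G.minTables_localRun c ι ω ⟨h, hh⟩ s).V_succ ⟨k, hk⟩
    simp only at this
    rw [this]
    split_ifs
    · have h1 := mul_le_mul_of_nonneg_left (ih hk' h hh s)
        (one_sub_lr_succ_nonneg G.H ((G.minTables c ι ω k).N h s))
      have h2 := (G.minTarget_mem (ih hk') hh (ω ⟨k, hk⟩ ⟨h, hh⟩)).2
      have h3 := bonus_nonneg G.H (Fintype.card ℬ) hc ι ((G.minTables c ι ω k).N h s + 1)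
      have h4 := mul_le_mul_of_nonneg_left (sub_le_self _ h3 |>.trans h2)
        (lr_nonneg G.H ((G.minTables c ι ω k).N h s + 1))
      linarith
    · exact ih hk' h hh s

end MinPlayer

variable [Fintype 𝒜] [Nonempty 𝒜] [DecidableEq 𝒜] [Fintype ℬ] [Nonempty ℬ] [DecidableEq ℬ]

/-! ### Supermartingales along the run -/

theorem run_support (hω : ω ∈ (G.run c ι K).support) (k : Fin K) :
    (∀ h0 : 0 < G.H, (ω k ⟨0, h0⟩).1 = G.s₁) ∧
      ∀ i (hi : i + 1 < G.H), (ω k ⟨i + 1, hi⟩).1 = (ω k ⟨i, by omega⟩).2.2.2 := by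
  induction K with
  | zero => exact k.elim0
  | succ K ih =>
    simp only [run, PMF.mem_support_bind_iff, PMF.mem_support_map_iff] at hω
    obtain ⟨ω', hω', τ, hτ, rfl⟩ := hω
    induction k using Fin.lastCases with
    | last =>
      simp only [Fin.snoc_last]
      exact G.rollout_support _ _ _ _ _ _ hτ
    | cast k =>
      simp only [Fin.snoc_castSucc]
      exact ih ω' hω' k

variable [Fintype 𝒮]

/-- The exponential is a supermartingale over episodes: given the past, the last factor has mean at
most `1`. Within an episode only the transition at step `h` counts, and the state reached there is
arbitrary. -/
theorem ex_run_exp_le (h : Fin G.H) (f : Tables 𝒮 𝒜 → Tables 𝒮 ℬ → Transition 𝒮 𝒜 ℬ → ℝ)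
    (hf : ∀ (k : ℕ) (ω : Fin k → Fin G.H → Transition 𝒮 𝒜 ℬ) (s : 𝒮),
      ex ((G.maxTables c ι ω k).π h s) (fun a => ex ((G.minTables c ι ω k).π h s) fun b =>
        ex (G.P h s a b) fun s' =>
          Real.exp (f (G.maxTables c ι ω k) (G.minTables c ι ω k) (s, a, b, s'))) ≤ 1) (K : ℕ) :
    ex (G.run c ι K) (fun ω => Real.exp (∑ j : Fin K,
      f (G.maxTables c ι ω j) (G.minTables c ι ω j) (ω j h))) ≤ 1 := by
  induction K with
  | zero => simp [run, ex_pure]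
  | succ K ih =>
    rw [run, ex_bind]
    refine le_trans (ex_mono fun ω => ?_) ih
    rw [ex_map]
    simp only [Fin.sum_univ_castSucc, Fin.snoc_castSucc, Fin.snoc_last, Fin.val_castSucc,
      Fin.val_last]
    have e1 : ∀ (τ : Fin G.H → Transition 𝒮 𝒜 ℬ) (j : Fin K),
        G.maxTables c ι (Fin.snoc (α := fun _ => Fin G.H → Transition 𝒮 𝒜 ℬ) ω τ) j
          = G.maxTables c ι ω j := fun τ j => G.maxTables_snoc c ι ω τ j j.2.le
    have e2 : ∀ (τ : Fin G.H → Transition 𝒮 𝒜 ℬ) (j : Fin K),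
        G.minTables c ι (Fin.snoc (α := fun _ => Fin G.H → Transition 𝒮 𝒜 ℬ) ω τ) j
          = G.minTables c ι ω j := fun τ j => G.minTables_snoc c ι ω τ j j.2.le
    simp only [e1, e2, G.maxTables_snoc c ι ω _ K le_rfl, G.minTables_snoc c ι ω _ K le_rfl,
      Real.exp_add, ex_const_mul]
    refine mul_le_of_le_one_right (Real.exp_nonneg _) ?_
    exact G.ex_rollout_apply_le G.H [] G.s₁ h
      (fun h => (G.maxTables c ι ω K).π h) (fun h => (G.minTables c ι ω K).π h)
      (fun x => Real.exp (f (G.maxTables c ι ω K) (G.minTables c ι ω K) x)) 1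
      (by simpa using hf K ω)

end MarkovGame

theorem bonus_eq (H m : ℕ) (c : ℝ) {ι : ℝ} (hι : 0 ≤ ι) (t : ℕ) :
    bonus H m c ι t = c * √((H : ℝ) ^ 4 * m * ι) * (1 / √(t : ℝ)) := by
  rw [bonus, Real.sqrt_div (by positivity)]
  ring

/-- The weights sum to one and each bonus of an earlier visit is at least the one at the current
count. Thus `c ≥ 25` lets the averaged bonus cover the regret. -/
theorem LocalRun.le_wsum_bonus {𝒳 : Type x} [Fintype 𝒳] [Nonempty 𝒳] [DecidableEq 𝒳]
    {H : ℕ} {ι : ℝ} {K : ℕ} {vis : Fin K → Prop} [DecidablePred vis]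
    {act : Fin K → 𝒳} {y ℓ : Fin K → ℝ} {V₀ : ℝ} {N : ℕ → ℕ} {V : ℕ → ℝ} {L : ℕ → 𝒳 → ℝ}
    {π : ℕ → PMF 𝒳} (R : LocalRun H ι vis act y ℓ V₀ N V L π) {c : ℝ} (hc : 25 ≤ c) (hι : 0 ≤ ι)
    (k : ℕ) (hk : k ≤ K) (hne : visitList vis k ≠ []) (m : ℕ) :
    25 * √((H : ℝ) ^ 4 * m * ι / N k) ≤ wsum H (visitList vis k) fun j =>
      bonus H m c ι (N j + 1) := by
  simp only [bonus_eq H m c hι, wsum_const_mul]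
  rw [Real.sqrt_div (by positivity), ← mul_one_div, ← mul_assoc]
  have := R.inv_sqrt_le_wsum k hk hne
  push_cast
  gcongr

theorem LocalRun.wsum_bonus_le {𝒳 : Type x} [Fintype 𝒳] [Nonempty 𝒳] [DecidableEq 𝒳]
    {H : ℕ} {ι : ℝ} {K : ℕ} {vis : Fin K → Prop} [DecidablePred vis]
    {act : Fin K → 𝒳} {y ℓ : Fin K → ℝ} {V₀ : ℝ} {N : ℕ → ℕ} {V : ℕ → ℝ} {L : ℕ → 𝒳 → ℝ}
    {π : ℕ → PMF 𝒳} (R : LocalRun H ι vis act y ℓ V₀ N V L π) {c : ℝ} (hc : 0 ≤ c) (hι : 0 ≤ ι)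
    (k : ℕ) (hk : k ≤ K) (m : ℕ) :
    wsum H (visitList vis k) (fun j => bonus H m c ι (N j + 1))
      ≤ c * √((H : ℝ) ^ 4 * m * ι) * (2 / √(N k)) := by
  simp only [bonus_eq H m c hι, wsum_const_mul]
  have := R.wsum_inv_sqrt_le k hk
  push_cast
  gcongr

section JumpLaw

variable {𝒮 : Type u} {𝒜 : Type v} {ℬ : Type w} [DecidableEq 𝒮] {H K : ℕ}

theorem ex_jumpLaw (ω : Fin K → Fin H → Transition 𝒮 𝒜 ℬ) (h : Fin H) (k : Fin K) (s : 𝒮)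
    (f : Fin K → ℝ) :
    ex (jumpLaw ω h k s) f = if visitList (fun j => (ω j h).1 = s) k = [] then f k
      else wsum H (visitList (fun j => (ω j h).1 = s) k) f := by
  have hv : visits ω h k s = visitList (fun j => (ω j h).1 = s) k := rfl
  rw [← hv, jumpLaw]
  by_cases hnil : visits ω h k s = []
  · rw [dif_neg (by simp [hnil]), if_pos hnil, ex_pure]
  · rw [dif_pos (List.length_pos_iff.2 hnil), if_neg hnil, ex_map, wsum, indexedSum_eq_sum_fin, ex]
    refine Finset.sum_congr rfl fun i _ => ?_
    rw [visitWeights, PMF.ofFintype_apply, ENNReal.toReal_ofReal (lrWeight_nonneg _ _ _)]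

end JumpLaw

/-! ### Optimism and pessimism on the good event. -/

namespace MarkovGame

section Means

variable {𝒮 : Type u} {𝒜 : Type v} {ℬ : Type w} (G : MarkovGame 𝒮 𝒜 ℬ) [Fintype 𝒮]

/-- The mean value target of the max-player when it plays `a`. -/
noncomputable def maxMean [Fintype ℬ] (T : Tables 𝒮 𝒜) (ν : PMF ℬ) (h : ℕ) (s : 𝒮) (a : 𝒜) : ℝ :=
  ex ν fun b => ex (G.P h s a b) fun s' => G.maxTarget T h (s, a, b, s')

theorem maxMean_mem [Fintype ℬ] {T : Tables 𝒮 𝒜} (hT : ∀ h < G.H, ∀ s, 0 ≤ T.V h s) (ν : PMF ℬ) {h : ℕ}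
    (hh : h < G.H) (s : 𝒮) (a : 𝒜) :
    0 ≤ G.maxMean T ν h s a ∧ G.maxMean T ν h s a ≤ (G.H : ℝ) - h :=
  ⟨le_ex fun _ => le_ex fun _ => (G.maxTarget_mem hT hh _).1,
    ex_le fun _ => ex_le fun _ => (G.maxTarget_mem hT hh _).2⟩

/-- The mean value target of the min-player when it plays `b`. -/
noncomputable def minMean [Fintype 𝒜] (T : Tables 𝒮 ℬ) (μ : PMF 𝒜) (h : ℕ) (s : 𝒮) (b : ℬ) : ℝ :=
  ex μ fun a => ex (G.P h s a b) fun s' => G.minTarget T h (s, a, b, s')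

theorem minMean_mem [Fintype 𝒜] {T : Tables 𝒮 ℬ} (hT : ∀ h < G.H, ∀ s, T.V h s ≤ (G.H : ℝ) - h) (μ : PMF 𝒜)
    {h : ℕ} (hh : h < G.H) (s : 𝒮) (b : ℬ) :
    0 ≤ G.minMean T μ h s b ∧ G.minMean T μ h s b ≤ (G.H : ℝ) - h :=
  ⟨le_ex fun _ => le_ex fun _ => (G.minTarget_mem hT hh _).1,
    ex_le fun _ => ex_le fun _ => (G.minTarget_mem hT hh _).2⟩

end Means

variable {𝒮 : Type u} {𝒜 : Type v} {ℬ : Type w} (G : MarkovGame 𝒮 𝒜 ℬ)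
  [Fintype 𝒮] [DecidableEq 𝒮] [Fintype 𝒜] [Nonempty 𝒜] [DecidableEq 𝒜] [Fintype ℬ] [Nonempty ℬ]
  [DecidableEq ℬ] (c ι : ℝ) {K : ℕ} (ω : Fin K → Fin G.H → Transition 𝒮 𝒜 ℬ)

section MaxPlayer

/-- The exponent of a supermartingale of the max-player. -/
noncomputable def maxDeviation (h : ℕ) (s : 𝒮) (late : Bool) (t : ℕ) (a : 𝒜)
    (T : Tables 𝒮 𝒜) (T' : Tables 𝒮 ℬ) (x : Transition 𝒮 𝒜 ℬ) : ℝ :=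
  if x.1 = s then
    ixCoeff G.H (Fintype.card 𝒜) ι late t (T.N h s) * ((if x.2.1 = a then
      ((G.H : ℝ) - h - G.maxTarget T h x)
        / ((T.π h s x.2.1).toReal + stepSize (Fintype.card 𝒜) ι (T.N h s + 1)) else 0)
      - ((G.H : ℝ) - h - G.maxMean T (T'.π h s) h s a)) / G.H
  else 0

variable {c ι}

theorem ex_run_exp_maxDeviation_le (hc : 0 ≤ c) (hι : 0 ≤ ι) (h : Fin G.H) (s : 𝒮) (late : Bool)
    (t : ℕ) (a : 𝒜) (K : ℕ) :
    ex (G.run c ι K) (fun ω => Real.exp (∑ j : Fin K, G.maxDeviation ι h s late t a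
      (G.maxTables c ι ω j) (G.minTables c ι ω j) (ω j h))) ≤ 1 := by
  refine G.ex_run_exp_le c ι h (G.maxDeviation ι h s late t a) (fun k ω s₀ => ?_) K
  unfold maxDeviation
  by_cases hs : s₀ = s
  · subst hs
    simp only [if_true]
    have hH : (0 : ℝ) < G.H := by exact_mod_cast h.pos
    set T := G.maxTables c ι ω k
    set T' := G.minTables c ι ω k
    have h1 := ex_exp_lossEst_le (T.π h s₀) a ((G.maxTables_localRun c ι ω h s₀).π_pos k le_rfl a)
      (fun a => (T'.π h s₀).bind fun b => (G.P h s₀ a b).map fun s' => (b, s'))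
      (fun a y => (G.H : ℝ) - h - G.maxTarget T h (s₀, a, y.1, y.2)) hH (fun y => by
        obtain ⟨h1, h2⟩ := G.maxTarget_mem (G.maxTables_V_nonneg c ι ω hc k le_rfl) h.2
          (s₀, a, y.1, y.2)
        have : (0 : ℝ) ≤ (h : ℕ) := Nat.cast_nonneg _
        constructor <;> linarith)
      (ixCoeff_nonneg G.H (Fintype.card 𝒜) ι late t (T.N h s₀))
      (ixCoeff_le G.H (Fintype.card 𝒜) hι late t (T.N h s₀))
    simp only [ex_bind, ex_map, ex_sub, ex_const] at h1
    exact h1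
  · simp [hs, ex_const]

/-- Optimism: the estimate of the max-player dominates its one-step lookahead against the certified
policy of the min-player. -/
theorem ex_jumpLaw_le_upperV (hc : 25 ≤ c) (hι : Real.log 2 ≤ ι)
    (hA : Real.log (Fintype.card 𝒜) ≤ ι) (h : Fin G.H) (s : 𝒮)
    (hgood : ∀ (late : Bool) (t : Fin K) (a : 𝒜), (∑ j : Fin K, G.maxDeviation ι h s late (t + 1) a
      (G.maxTables c ι ω j) (G.minTables c ι ω j) (ω j h)) ≤ 3 * ι) (k : Fin K) (a : 𝒜) :
    ex (jumpLaw ω h k s) (fun j => ex ((G.minTables c ι ω j).π h s) fun b =>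
      G.r h s a b + ex (G.P h s a b) (upperV G.H (G.maxTables c ι ω j) (h + 1)))
      ≤ upperV G.H (G.maxTables c ι ω k) h s := by
  have hc0 : 0 ≤ c := by linarith
  have hι0 : 0 ≤ ι := (Real.log_nonneg one_le_two).trans hι
  have hT := fun (j : Fin K) => G.maxTables_V_nonneg c ι ω hc0 j j.2.le
  have R := G.maxTables_localRun c ι ω h s
  have e : ∀ j : Fin K, ex ((G.minTables c ι ω j).π h s) (fun b =>
      G.r h s a b + ex (G.P h s a b) (upperV G.H (G.maxTables c ι ω j) (h + 1)))
      = G.maxMean (G.maxTables c ι ω j) ((G.minTables c ι ω j).π h s) h s a := fun j => by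
    simp only [maxMean, maxTarget, ex_add, ex_const]
  have hmean := fun j : Fin K => G.maxMean_mem (hT j) ((G.minTables c ι ω j).π h s) h.2 s
  have hVk := R.V_eq k k.2.le
  simp only [e]
  rw [ex_jumpLaw, upperV, if_pos h.2, hVk]
  split_ifs with hnil
  -- At an unvisited state the index is kept and the table still holds its initial value `H - h`,
  -- which exceeds any target.
  · rw [min_self]
    exact (hmean k a).2
  · refine le_min (wsum_le _ _ hnil fun j _ => (hmean j a).2) ?_
    have hh0 : (0 : ℝ) ≤ (h : ℕ) := Nat.cast_nonneg _
    have hreg := R.regret_le_of_ixCoeff h.pos hι hA (fun j _ => by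
        obtain ⟨h1, h2⟩ := G.maxTarget_mem (hT j) h.2 (ω j h)
        constructor <;> linarith)
      (fun j a => (G.H : ℝ) - h - G.maxMean (G.maxTables c ι ω j) ((G.minTables c ι ω j).π h s) h s a)
      (fun j _ a => by
        obtain ⟨h1, h2⟩ := hmean j a
        constructor <;> linarith) hgood k k.2.le hnil a
    have hbonus := R.le_wsum_bonus hc hι0 k k.2.le hnil (Fintype.card 𝒜)
    rw [wsum_add]
    -- The losses are `H - h` minus targets, so the regret becomes mean target of `a` minus realized
    -- target.
    simp only [sub_sub_sub_cancel_left] at hreg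
    rw [wsum_sub] at hreg
    linarith

end MaxPlayer

section MinPlayer

/-- The exponent of a supermartingale of the min-player. -/
noncomputable def minDeviation (h : ℕ) (s : 𝒮) (late : Bool) (t : ℕ) (b : ℬ)
    (T : Tables 𝒮 𝒜) (T' : Tables 𝒮 ℬ) (x : Transition 𝒮 𝒜 ℬ) : ℝ :=
  if x.1 = s then
    ixCoeff G.H (Fintype.card ℬ) ι late t (T'.N h s) * ((if x.2.2.1 = b then
      G.minTarget T' h x
        / ((T'.π h s x.2.2.1).toReal + stepSize (Fintype.card ℬ) ι (T'.N h s + 1)) else 0)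
      - G.minMean T' (T.π h s) h s b) / G.H
  else 0

variable {c ι}

theorem ex_run_exp_minDeviation_le (hc : 0 ≤ c) (hι : 0 ≤ ι) (h : Fin G.H) (s : 𝒮) (late : Bool)
    (t : ℕ) (b : ℬ) (K : ℕ) :
    ex (G.run c ι K) (fun ω => Real.exp (∑ j : Fin K, G.minDeviation ι h s late t b
      (G.maxTables c ι ω j) (G.minTables c ι ω j) (ω j h))) ≤ 1 := by
  refine G.ex_run_exp_le c ι h (G.minDeviation ι h s late t b) (fun k ω s₀ => ?_) K
  unfold minDeviation
  by_cases hs : s₀ = s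
  · subst hs
    simp only [if_true]
    have hH : (0 : ℝ) < G.H := by exact_mod_cast h.pos
    set T := G.maxTables c ι ω k
    set T' := G.minTables c ι ω k
    have h1 := ex_exp_lossEst_le (T'.π h s₀) b ((G.minTables_localRun c ι ω h s₀).π_pos k le_rfl b)
      (fun b => (T.π h s₀).bind fun a => (G.P h s₀ a b).map fun s' => (a, s'))
      (fun b y => G.minTarget T' h (s₀, y.1, b, y.2)) hH (fun y => by
        obtain ⟨h1, h2⟩ := G.minTarget_mem (G.minTables_V_le c ι ω hc k le_rfl) h.2
          (s₀, y.1, b, y.2)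
        have : (0 : ℝ) ≤ (h : ℕ) := Nat.cast_nonneg _
        constructor <;> linarith)
      (ixCoeff_nonneg G.H (Fintype.card ℬ) ι late t (T'.N h s₀))
      (ixCoeff_le G.H (Fintype.card ℬ) hι late t (T'.N h s₀))
    simp only [ex_bind, ex_map] at h1
    rw [ex_comm]
    exact h1
  · simp [hs, ex_const]

/-- Pessimism: the estimate of the min-player is dominated by its one-step lookahead against the
certified policy of the max-player. -/
theorem lowerV_le_ex_jumpLaw (hc : 25 ≤ c) (hι : Real.log 2 ≤ ι)
    (hB : Real.log (Fintype.card ℬ) ≤ ι) (h : Fin G.H) (s : 𝒮)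
    (hgood : ∀ (late : Bool) (t : Fin K) (b : ℬ), (∑ j : Fin K, G.minDeviation ι h s late (t + 1) b
      (G.maxTables c ι ω j) (G.minTables c ι ω j) (ω j h)) ≤ 3 * ι) (k : Fin K) (b : ℬ) :
    lowerV G.H (G.minTables c ι ω k) h s
      ≤ ex (jumpLaw ω h k s) (fun j => ex ((G.maxTables c ι ω j).π h s) fun a =>
        G.r h s a b + ex (G.P h s a b) (lowerV G.H (G.minTables c ι ω j) (h + 1))) := by
  have hc0 : 0 ≤ c := by linarith
  have hι0 : 0 ≤ ι := (Real.log_nonneg one_le_two).trans hι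
  have hT := fun (j : Fin K) => G.minTables_V_le c ι ω hc0 j j.2.le
  have R := G.minTables_localRun c ι ω h s
  have e : ∀ j : Fin K, ex ((G.maxTables c ι ω j).π h s) (fun a =>
      G.r h s a b + ex (G.P h s a b) (lowerV G.H (G.minTables c ι ω j) (h + 1)))
      = G.minMean (G.minTables c ι ω j) ((G.maxTables c ι ω j).π h s) h s b := fun j => by
    simp only [minMean, minTarget, ex_add, ex_const]
  have hmean := fun j : Fin K => G.minMean_mem (hT j) ((G.maxTables c ι ω j).π h s) h.2 s
  have hVk := R.V_eq k k.2.le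
  simp only [e]
  rw [ex_jumpLaw, lowerV, if_pos h.2, hVk]
  split_ifs with hnil
  · rw [max_self]
    exact (hmean k b).1
  · refine max_le (wsum_nonneg _ _ fun j _ => (hmean j b).1) ?_
    have hh0 : (0 : ℝ) ≤ (h : ℕ) := Nat.cast_nonneg _
    have hreg := R.regret_le_of_ixCoeff h.pos hι hB (fun j _ => by
        obtain ⟨h1, h2⟩ := G.minTarget_mem (hT j) h.2 (ω j h)
        constructor <;> linarith)
      (fun j b => G.minMean (G.minTables c ι ω j) ((G.maxTables c ι ω j).π h s) h s b)
      (fun j _ b => by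
        obtain ⟨h1, h2⟩ := hmean j b
        constructor <;> linarith) hgood k k.2.le hnil b
    have hbonus := R.le_wsum_bonus hc hι0 k k.2.le hnil (Fintype.card ℬ)
    rw [wsum_sub]
    rw [wsum_sub] at hreg
    linarith

end MinPlayer

end MarkovGame

/-! ### Sums over all episodes -/

section StateSums

variable {𝒮 : Type u} [Fintype 𝒮] [DecidableEq 𝒮] {K : ℕ} (st : Fin K → 𝒮)

theorem sum_eq_sum_state (F : 𝒮 → Fin K → ℝ) :
    ∑ j, F (st j) j = ∑ s, ∑ j : Fin K, if j.val < K ∧ st j = s then F s j else 0 := by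
  rw [Finset.sum_comm]
  refine Finset.sum_congr rfl fun j _ => ?_
  simp

/-- Successive visits to a state see the counts `0, 1, …` in turn. -/
theorem sum_visitList_length (f : ℕ → ℝ) :
    ∑ j : Fin K, f (visitList (fun i => st i = st j) j).length
      = ∑ s, ∑ m ∈ Finset.range (visitList (fun i => st i = s) K).length, f m := by
  rw [sum_eq_sum_state st fun s j => f (visitList (fun i => st i = s) j).length]
  refine Finset.sum_congr rfl fun s _ => ?_
  have h := indexedSum_visitList (fun i => st i = s) f (fun _ => 1) K le_rfl
  simp only [mul_one] at h
  rw [← h, indexedSum_eq_sum_fin, Finset.sum_range]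
  simp

theorem sum_sqrt_visitList_length_le :
    ∑ s, √((visitList (fun i => st i = s) K).length : ℝ) ≤ √(Fintype.card 𝒮 * K) := by
  refine Real.le_sqrt_of_sq_le ?_
  refine (sq_sum_le_card_mul_sum_sq).trans_eq ?_
  simp only [Real.sq_sqrt (Nat.cast_nonneg (α := ℝ) _)]
  have := sum_visitList_length st fun _ => 1
  simp only [Finset.sum_const, Finset.card_univ, Fintype.card_fin, Finset.card_range,
    nsmul_eq_mul, mul_one] at this
  rw [← this, Finset.card_univ]

theorem sum_bonus_le {a b : ℝ} (ha : 0 ≤ a) (hb : 0 ≤ b) :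
    ∑ j : Fin K, (if (visitList (fun i => st i = st j) j).length = 0 then a
      else b * (1 / √((visitList (fun i => st i = st j) j).length : ℝ)))
      ≤ Fintype.card 𝒮 * a + 2 * b * √(Fintype.card 𝒮 * K) := by
  rw [sum_visitList_length st fun m => if m = 0 then a else b * (1 / √(m : ℝ))]
  have h1 : ∀ n : ℕ, ∑ m ∈ Finset.range n, (if m = 0 then a else b * (1 / √(m : ℝ)))
      ≤ a + 2 * b * √(n : ℝ) := by
    intro n
    have e : ∀ m : ℕ, (if m = 0 then a else b * (1 / √(m : ℝ)))
        = (if m = 0 then a else 0) + b * (if m = 0 then 0 else 1 / √(m : ℝ)) := by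
      intro m
      split_ifs <;> simp
    simp only [e, Finset.sum_add_distrib, ← Finset.mul_sum]
    have h2 := mul_le_mul_of_nonneg_left (sum_range_inv_sqrt_le n) hb
    have h3 : ∑ m ∈ Finset.range n, (if m = 0 then a else 0) ≤ a := by
      rw [Finset.sum_ite_eq']
      split_ifs <;> linarith
    linarith
  refine (Finset.sum_le_sum fun s _ => h1 _).trans ?_
  rw [Finset.sum_add_distrib, ← Finset.mul_sum, Finset.sum_const, Finset.card_univ, nsmul_eq_mul]
  gcongr
  exact sum_sqrt_visitList_length_le st

/-- The identity `sum_wsum_visitList` holds with a remainder; it is nonnegative because `D` is, and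
is dropped. -/
theorem sum_wsum_le {H : ℕ} (hH : 0 < H) {D : Fin K → ℝ} (hD : ∀ j, 0 ≤ D j) :
    ∑ j : Fin K, wsum H (visitList (fun i => st i = st j) j) D ≤ (1 + 1 / H) * ∑ j, D j := by
  rw [sum_eq_sum_state st fun s j => wsum H (visitList (fun i => st i = s) j) D,
    sum_eq_sum_state st fun _ j => D j, Finset.mul_sum]
  refine Finset.sum_le_sum fun s _ => ?_
  rw [← sum_wsum_visitList (fun i => st i = s) H hH D K le_rfl]
  refine le_add_of_nonneg_right (mul_nonneg (by positivity) ?_)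
  exact wsum_nonneg _ _ fun j _ => hD j

end StateSums

/-- Each step back adds `B` and a factor `1 + 1/H`. The constant is `(1 + 1/H)^H ≤ e ≤ 3`. -/
theorem le_of_backward_recursion {H : ℕ} (hH : 0 < H) {B : ℝ} (hB : 0 ≤ B) (e : ℕ → ℝ)
    (hlast : e H = 0) (hstep : ∀ h < H, e h ≤ B + (1 + 1 / H) * e (h + 1)) :
    e 0 ≤ 3 * H * B := by
  have hHr : (0 : ℝ) < H := by exact_mod_cast hH
  set q : ℝ := 1 + 1 / H with hq
  have hq1 : 1 ≤ q := by
    rw [hq]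
    have : (0 : ℝ) ≤ 1 / H := by positivity
    linarith
  have key : ∀ i ≤ H, e (H - i) ≤ i * q ^ i * B := by
    intro i hi
    induction i with
    | zero => simp [hlast]
    | succ i ih =>
      have h1 := hstep (H - (i + 1)) (by omega)
      rw [show H - (i + 1) + 1 = H - i by omega] at h1
      have h2 := mul_le_mul_of_nonneg_left (ih (by omega)) (by linarith : 0 ≤ q)
      have h3 : B ≤ q ^ (i + 1) * B := le_mul_of_one_le_left hB (one_le_pow₀ hq1)
      push_cast
      calc e (H - (i + 1)) ≤ q ^ (i + 1) * B + q * (i * q ^ i * B) := by linarith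
        _ = _ := by ring
  have h := key H le_rfl
  rw [Nat.sub_self] at h
  have hpow : q ^ H ≤ 3 := by
    calc q ^ H ≤ Real.exp (1 / H) ^ H := by
          refine pow_le_pow_left₀ (by linarith) ?_ H
          rw [hq, add_comm]
          exact Real.add_one_le_exp _
      _ = Real.exp 1 := by
          rw [← Real.exp_nat_mul, mul_one_div_cancel hHr.ne']
      _ ≤ 3 := by linarith [Real.exp_one_lt_d9]
  calc e 0 ≤ H * q ^ H * B := h
    _ ≤ H * 3 * B := by gcongr
    _ = _ := by ring

theorem lowerV_le_upperV_of_le {𝒮 : Type u} {𝒜 : Type v} {ℬ : Type w} {H : ℕ} {T : Tables 𝒮 𝒜} {T' : Tables 𝒮 ℬ}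
    (hT : ∀ h < H, ∀ s, 0 ≤ T.V h s) (hT' : ∀ h < H, ∀ s, T'.V h s ≤ (H : ℝ) - h)
    (hle : ∀ h < H, ∀ s, T'.V h s ≤ T.V h s) (h : ℕ) (s : 𝒮) :
    lowerV H T' h s ≤ upperV H T h s := by
  unfold lowerV upperV
  split_ifs with hh
  · have : (h : ℝ) ≤ H := by exact_mod_cast hh.le
    exact max_le (le_min (by linarith) (hT h hh s)) (le_min (hT' h hh s) (hle h hh s))
  · exact le_rfl

/-! ### The gap between the two estimates. -/

namespace MarkovGame

variable {𝒮 : Type u} {𝒜 : Type v} {ℬ : Type w} (G : MarkovGame 𝒮 𝒜 ℬ)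
  [DecidableEq 𝒮] [Fintype 𝒜] [Nonempty 𝒜] [DecidableEq 𝒜] [Fintype ℬ] [Nonempty ℬ]
  [DecidableEq ℬ] {c ι : ℝ} {K : ℕ} (ω : Fin K → Fin G.H → Transition 𝒮 𝒜 ℬ)

/-- This holds on every run, with no good event: both tables use the same rewards, next states and
rates, and the bonuses push them apart. It makes the gap nonnegative, as `sum_wsum_le` requires. -/
theorem minTables_V_le_maxTables_V (hc : 0 ≤ c) (k : ℕ) (hk : k ≤ K) (h : ℕ) (hh : h < G.H)
    (s : 𝒮) : (G.minTables c ι ω k).V h s ≤ (G.maxTables c ι ω k).V h s := by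
  induction k generalizing h s with
  | zero =>
    change (0 : ℝ) ≤ (G.H : ℝ) - h
    rw [sub_nonneg]
    exact_mod_cast hh.le
  | succ k ih =>
    have hk' := Nat.le_of_succ_le hk
    have R := G.maxTables_localRun c ι ω ⟨h, hh⟩ s
    have R' := G.minTables_localRun c ι ω ⟨h, hh⟩ s
    have h1 := R.V_succ ⟨k, hk⟩
    have h2 := R'.V_succ ⟨k, hk⟩
    have hN : (G.maxTables c ι ω k).N h s = (G.minTables c ι ω k).N h s :=
      (R.N_eq k hk').trans (R'.N_eq k hk').symm
    simp only [hN] at h1 h2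
    rw [h1, h2]
    split_ifs
    · have h3 := mul_le_mul_of_nonneg_left (ih hk' h hh s)
        (one_sub_lr_succ_nonneg G.H ((G.minTables c ι ω k).N h s))
      refine add_le_add h3 (mul_le_mul_of_nonneg_left ?_ (lr_nonneg _ _))
      have h4 := bonus_nonneg G.H (Fintype.card 𝒜) hc ι ((G.minTables c ι ω k).N h s + 1)
      have h5 := bonus_nonneg G.H (Fintype.card ℬ) hc ι ((G.minTables c ι ω k).N h s + 1)
      have h6 := lowerV_le_upperV_of_le (G.maxTables_V_nonneg c ι ω hc k hk')
        (G.minTables_V_le c ι ω hc k hk') (ih hk') (h + 1) (ω ⟨k, hk⟩ ⟨h, hh⟩).2.2.2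
      unfold maxTarget minTarget
      linarith
    · exact ih hk' h hh s

/-- The difference of the estimates of the two players. -/
noncomputable def estimateGap (c ι : ℝ) (j : Fin K) (h : ℕ) (s : 𝒮) : ℝ :=
  upperV G.H (G.maxTables c ι ω j) h s - lowerV G.H (G.minTables c ι ω j) h s

theorem estimateGap_nonneg (hc : 0 ≤ c) (j : Fin K) (h : ℕ) (s : 𝒮) :
    0 ≤ G.estimateGap ω c ι j h s :=
  sub_nonneg.2 (lowerV_le_upperV_of_le (G.maxTables_V_nonneg c ι ω hc j j.2.le)
    (G.minTables_V_le c ι ω hc j j.2.le) (G.minTables_V_le_maxTables_V ω hc j j.2.le) h s)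

theorem estimateGap_le (hc : 0 ≤ c) (hι : 0 ≤ ι) (k : Fin K) (h : Fin G.H) (s : 𝒮) :
    G.estimateGap ω c ι k h s
      ≤ (if (visitList (fun j => (ω j h).1 = s) k).length = 0 then (G.H : ℝ)
        else 2 * c * (√((G.H : ℝ) ^ 4 * Fintype.card 𝒜 * ι) + √((G.H : ℝ) ^ 4 * Fintype.card ℬ * ι))
          * (1 / √((visitList (fun j => (ω j h).1 = s) k).length : ℝ)))
        + wsum G.H (visitList (fun j => (ω j h).1 = s) k)
          fun j => G.estimateGap ω c ι j (h + 1) (ω j h).2.2.2 := by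
  have R := G.maxTables_localRun c ι ω h s
  have R' := G.minTables_localRun c ι ω h s
  unfold estimateGap
  by_cases hnil : visitList (fun j => (ω j h).1 = s) k = []
  · simp only [hnil, List.length_nil, if_true, wsum_nil, add_zero]
    have h1 := upperV_le G.H (G.maxTables c ι ω k) h.2.le s
    have h2 := lowerV_nonneg G.H (G.minTables c ι ω k) h s
    have h3 : (0 : ℝ) ≤ (h : ℕ) := Nat.cast_nonneg _
    linarith
  · have hlen : (visitList (fun j => (ω j h).1 = s) k).length ≠ 0 := fun hc =>
      hnil (List.length_eq_zero_iff.1 hc)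
    rw [if_neg hlen]
    have h1 : upperV G.H (G.maxTables c ι ω k) h s ≤ (G.maxTables c ι ω k).V h s := by
      rw [upperV, if_pos h.2]
      exact min_le_right _ _
    have h2 : (G.minTables c ι ω k).V h s ≤ lowerV G.H (G.minTables c ι ω k) h s := by
      rw [lowerV, if_pos h.2]
      exact le_max_right _ _
    have hV := R.V_eq k k.2.le
    have hV' := R'.V_eq k k.2.le
    rw [if_neg hnil, wsum_add] at hV
    rw [if_neg hnil, wsum_sub] at hV'
    have hb := R.wsum_bonus_le hc hι k k.2.le (Fintype.card 𝒜)
    have hb' := R'.wsum_bonus_le hc hι k k.2.le (Fintype.card ℬ)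
    rw [R.N_eq k k.2.le] at hb
    rw [R'.N_eq k k.2.le] at hb'
    have hgap : wsum G.H (visitList (fun j => (ω j h).1 = s) k) (fun j =>
          upperV G.H (G.maxTables c ι ω j) (h + 1) (ω j h).2.2.2
            - lowerV G.H (G.minTables c ι ω j) (h + 1) (ω j h).2.2.2)
        = wsum G.H (visitList (fun j => (ω j h).1 = s) k)
            (fun j => G.maxTarget (G.maxTables c ι ω j) h (ω j h))
          - wsum G.H (visitList (fun j => (ω j h).1 = s) k)
            fun j => G.minTarget (G.minTables c ι ω j) h (ω j h) := by
      rw [← wsum_sub]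
      refine wsum_congr _ _ fun j _ => ?_
      unfold maxTarget minTarget
      ring
    rw [hgap]
    have e : 2 * c * (√((G.H : ℝ) ^ 4 * Fintype.card 𝒜 * ι)
          + √((G.H : ℝ) ^ 4 * Fintype.card ℬ * ι))
          * (1 / √((visitList (fun j => (ω j h).1 = s) k).length : ℝ))
        = c * √((G.H : ℝ) ^ 4 * Fintype.card 𝒜 * ι)
            * (2 / √((visitList (fun j => (ω j h).1 = s) k).length : ℝ))
          + c * √((G.H : ℝ) ^ 4 * Fintype.card ℬ * ι)
            * (2 / √((visitList (fun j => (ω j h).1 = s) k).length : ℝ)) := by ring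
    rw [e]
    linarith

variable [Fintype 𝒮]

/-- The sum of the gaps at the initial state. -/
theorem sum_estimateGap_le (hc : 0 ≤ c) (hι : 0 ≤ ι) (hH : 0 < G.H)
    (hω : ω ∈ (G.run c ι K).support) :
    ∑ k, G.estimateGap ω c ι k 0 G.s₁ ≤ 3 * G.H * (Fintype.card 𝒮 * G.H
      + 2 * (2 * c * (√((G.H : ℝ) ^ 4 * Fintype.card 𝒜 * ι)
        + √((G.H : ℝ) ^ 4 * Fintype.card ℬ * ι))) * √(Fintype.card 𝒮 * K)) := by
  have hsup := G.run_support c ι ω hω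
  set b := 2 * c * (√((G.H : ℝ) ^ 4 * Fintype.card 𝒜 * ι)
    + √((G.H : ℝ) ^ 4 * Fintype.card ℬ * ι)) with hb
  have hb0 : 0 ≤ b := by positivity
  set e : ℕ → ℝ := fun h => if hh : h < G.H then
    ∑ k, G.estimateGap ω c ι k h (ω k ⟨h, hh⟩).1 else 0 with he
  have e0 : ∑ k, G.estimateGap ω c ι k 0 G.s₁ = e 0 := by
    rw [he]
    simp only [dif_pos hH]
    exact Finset.sum_congr rfl fun k _ => by rw [(hsup k).1 hH]
  rw [e0]
  refine le_of_backward_recursion hH (by positivity) e (by simp [he]) fun h hh => ?_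
  -- On the support the next state at step `h` is the state at step `h + 1`. After the last step
  -- both estimates vanish.
  have enext : e (h + 1) = ∑ k, G.estimateGap ω c ι k (h + 1) (ω k ⟨h, hh⟩).2.2.2 := by
    rw [he]
    simp only
    split_ifs with hh'
    · exact Finset.sum_congr rfl fun k _ => by rw [(hsup k).2 h hh']
    · refine (Finset.sum_eq_zero fun k _ => ?_).symm
      simp [estimateGap, upperV, lowerV, hh']
  rw [enext, he]
  simp only [dif_pos hh]
  refine (Finset.sum_le_sum fun k _ =>
    G.estimateGap_le ω hc hι k ⟨h, hh⟩ (ω k ⟨h, hh⟩).1).trans ?_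
  rw [Finset.sum_add_distrib]
  exact add_le_add (sum_bonus_le (fun j => (ω j ⟨h, hh⟩).1) (Nat.cast_nonneg _) hb0)
    (sum_wsum_le (fun j => (ω j ⟨h, hh⟩).1) hH fun j => G.estimateGap_nonneg ω hc j _ _)

end MarkovGame

/-! ### Degenerate cases: a large `ε`, or one action per player. -/

theorem PMF_eq_of_subsingleton {α : Type*} [Subsingleton α] (p q : PMF α) : p = q := by
  refine PMF.ext fun a => ?_
  have h : ∀ p : PMF α, p a = 1 := fun p => by
    rw [← p.tsum_coe, tsum_eq_single a fun b hb => absurd (Subsingleton.elim b a) hb]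
  rw [h, h]

namespace MarkovGame

section Trivial

variable {𝒮 : Type u} {𝒜 : Type v} {ℬ : Type w} [Fintype 𝒮] [Fintype 𝒜] [Fintype ℬ]
  (G : MarkovGame 𝒮 𝒜 ℬ)

theorem isApproxNash_of_horizon_le {ε : ℝ} (hε : (G.H : ℝ) ≤ ε) (μ : GeneralPolicy 𝒮 𝒜 ℬ 𝒜)
    (ν : GeneralPolicy 𝒮 𝒜 ℬ ℬ) : G.IsApproxNash ε μ ν := by
  have h1 : G.maxBestResponseValue ν ≤ G.H := by
    refine G.maxBestResponseValue_le_of_forall ν _ (Nat.cast_nonneg _) fun μ => ?_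
    refine (integral_mono_of_nonneg (.of_forall fun z' => ?_) (integrable_const (G.H : ℝ))
      (.of_forall fun z' => ?_)).trans_eq (by simp)
    · exact (G.rew_mem_Icc _ _ _ _ _ (by simp)).1
    · exact (G.rew_mem_Icc _ _ _ _ _ (by simp)).2
  have h2 : 0 ≤ G.minBestResponseValue μ := by
    refine Real.iInf_nonneg fun ν => ?_
    rw [value_eq_integral_rew]
    exact integral_nonneg fun z => integral_nonneg fun z' =>
      (G.rew_mem_Icc _ _ _ _ _ (by simp)).1
  unfold IsApproxNash
  linarith

theorem isApproxNash_of_subsingleton [Subsingleton 𝒜] [Subsingleton ℬ] {ε : ℝ} (hε : 0 ≤ ε)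
    (μ : GeneralPolicy 𝒮 𝒜 ℬ 𝒜) (ν : GeneralPolicy 𝒮 𝒜 ℬ ℬ) : G.IsApproxNash ε μ ν := by
  have hv : ∀ (μ' : GeneralPolicy 𝒮 𝒜 ℬ 𝒜) (ν' : GeneralPolicy 𝒮 𝒜 ℬ ℬ),
      G.value μ' ν' = G.value μ ν := by
    intro μ' ν'
    obtain ⟨z₀⟩ : Nonempty μ.Z := μ.𝒟.nonempty_of_neZero
    obtain ⟨z₁⟩ : Nonempty ν.Z := ν.𝒟.nonempty_of_neZero
    have h : ∀ (μ' : GeneralPolicy 𝒮 𝒜 ℬ 𝒜) (ν' : GeneralPolicy 𝒮 𝒜 ℬ ℬ),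
        G.value μ' ν' = G.rew (μ.act z₀) (ν.act z₁) G.H [] G.s₁ := by
      intro μ' ν'
      rw [value_eq_integral_rew]
      have e1 : ∀ z, μ'.act z = μ.act z₀ := fun z => by
        ext1 hist
        ext1 s
        exact PMF_eq_of_subsingleton _ _
      have e2 : ∀ z, ν'.act z = ν.act z₁ := fun z => by
        ext1 hist
        ext1 s
        exact PMF_eq_of_subsingleton _ _
      simp [e1, e2]
    rw [h, h]
  have : Nonempty (GeneralPolicy 𝒮 𝒜 ℬ 𝒜) := ⟨μ⟩
  have : Nonempty (GeneralPolicy 𝒮 𝒜 ℬ ℬ) := ⟨ν⟩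
  simp only [IsApproxNash, maxBestResponseValue, minBestResponseValue, hv, ciSup_const, ciInf_const,
    sub_self]
  exact hε

end Trivial

variable {𝒮 : Type u} {𝒜 : Type v} {ℬ : Type w} (G : MarkovGame 𝒮 𝒜 ℬ)
  [Fintype 𝒮] [DecidableEq 𝒮] [Fintype 𝒜] [Nonempty 𝒜] [DecidableEq 𝒜] [Fintype ℬ] [Nonempty ℬ]
  [DecidableEq ℬ] {c ι : ℝ} {K : ℕ}

/-- The exponent of a supermartingale of one of the two players. -/
noncomputable def deviation (ι : ℝ) (i : (Fin G.H × 𝒮 × Bool × Fin K) × (𝒜 ⊕ ℬ))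
    (T : Tables 𝒮 𝒜) (T' : Tables 𝒮 ℬ) (x : Fin G.H → Transition 𝒮 𝒜 ℬ) : ℝ :=
  match i with
  | ((h, s, late, t), .inl a) => G.maxDeviation ι h s late (t + 1) a T T' (x h)
  | ((h, s, late, t), .inr b) => G.minDeviation ι h s late (t + 1) b T T' (x h)

theorem ex_run_exp_deviation_le (hc : 0 ≤ c) (hι : 0 ≤ ι)
    (i : (Fin G.H × 𝒮 × Bool × Fin K) × (𝒜 ⊕ ℬ)) :
    ex (G.run c ι K) (fun ω => Real.exp (∑ j : Fin K, G.deviation ι i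
      (G.maxTables c ι ω j) (G.minTables c ι ω j) (ω j))) ≤ 1 := by
  obtain ⟨⟨h, s, late, t⟩, a | b⟩ := i
  · exact G.ex_run_exp_maxDeviation_le hc hι h s late (t + 1) a K
  · exact G.ex_run_exp_minDeviation_le hc hι h s late (t + 1) b K

/-- On the good event, the gap of the certified policies is at most the mean gap of the estimates. -/
theorem bestResponseGap_le [NeZero K] (ω : Fin K → Fin G.H → Transition 𝒮 𝒜 ℬ) (hc : 25 ≤ c)
    (hι : Real.log 2 ≤ ι) (hA : Real.log (Fintype.card 𝒜) ≤ ι) (hB : Real.log (Fintype.card ℬ) ≤ ι)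
    (hgood : ∀ i : (Fin G.H × 𝒮 × Bool × Fin K) × (𝒜 ⊕ ℬ), (∑ j : Fin K, G.deviation ι i
      (G.maxTables c ι ω j) (G.minTables c ι ω j) (ω j)) ≤ 3 * ι) :
    G.maxBestResponseValue (G.certifiedMin c ι ω) - G.minBestResponseValue (G.certifiedMax c ι ω)
      ≤ (K : ℝ)⁻¹ * ∑ k, G.estimateGap ω c ι k 0 G.s₁ := by
  have hc0 : 0 ≤ c := by linarith
  have h1 := G.maxBestResponseValue_certified_le ω (fun k => (G.minTables c ι ω k).π)
    (fun h k s => upperV G.H (G.maxTables c ι ω k) h s)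
    (fun h k s => upperV_nonneg (G.maxTables_V_nonneg c ι ω hc0 k k.2.le) h s)
    (fun h k s a => G.ex_jumpLaw_le_upperV ω hc hι hA h s
      (fun late t a => hgood ((h, s, late, t), .inl a)) k a)
  have h2 := G.le_minBestResponseValue_certified ω (fun k => (G.maxTables c ι ω k).π)
    (fun h k s => lowerV G.H (G.minTables c ι ω k) h s)
    (fun k s => by simp [lowerV])
    (fun h k s b => G.lowerV_le_ex_jumpLaw ω hc hι hB h s
      (fun late t b => hgood ((h, s, late, t), .inr b)) k b)
  simp only [estimateGap, Finset.sum_sub_distrib, mul_sub]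
  exact sub_le_sub h1 h2

end MarkovGame

/-- The arithmetic of the sample size. -/
theorem gap_bound_le {c : ℝ} (hc : 0 < c) {H K S A B ι ε s : ℝ} (hH : 1 ≤ H) (hK : 1 ≤ K)
    (hA : 1 ≤ A) (hB : 1 ≤ B) (hι : Real.log 2 ≤ ι) (hε : 0 < ε) (hεH : ε ≤ H) (hs0 : 0 ≤ s)
    (hs : s ≤ S) (h : (2304 * c ^ 2 + 6) * (H ^ 6 * S * (A + B) * ι / ε ^ 2) ≤ K) :
    K⁻¹ * (3 * H * (s * H + 2 * (2 * c * (√(H ^ 4 * A * ι) + √(H ^ 4 * B * ι))) * √(s * K)))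
      ≤ ε := by
  have hι2 : 0.5 ≤ ι := by linarith [Real.log_two_gt_d9]
  have hι0 : 0 < ι := by linarith
  have hS0 : 0 ≤ S := hs0.trans hs
  have hK0 : 0 < K := by linarith
  have hH0 : 0 < H := by linarith
  set C : ℝ := 2304 * c ^ 2 + 6 with hC
  have hX : C * (H ^ 6 * S * (A + B) * ι) ≤ K * ε ^ 2 := by
    rwa [mul_div_assoc', div_le_iff₀ (by positivity)] at h
  have hX0 : 0 ≤ H ^ 6 * S * (A + B) * ι := by positivity
  have t1 : 3 * H * (s * H) ≤ K * ε / 2 := by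
    have h1 : H ^ 6 * S ≤ H ^ 6 * S * (A + B) * ι := by
      rw [mul_assoc (H ^ 6 * S)]
      refine le_mul_of_one_le_right (by positivity) ?_
      nlinarith
    have h2 : 6 * (H ^ 6 * S * (A + B) * ι) ≤ K * ε ^ 2 := by
      refine (mul_le_mul_of_nonneg_right ?_ hX0).trans hX
      rw [hC]
      -- The summand `6` of `C` serves the cost `S H` of first visits; the summand `2304 c² = (48
      -- c)²` serves the bonuses.
      linarith [mul_nonneg (by norm_num : (0 : ℝ) ≤ 2304) (sq_nonneg c)]
    have h3 : H * (H ^ 2 * S) ≤ H ^ 6 * S := by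
      have : H ^ 3 ≤ H ^ 6 := pow_le_pow_right₀ hH (by norm_num)
      calc H * (H ^ 2 * S) = H ^ 3 * S := by ring
        _ ≤ _ := by gcongr
    have h4 : H * (6 * (H ^ 2 * S)) ≤ H * (K * ε) := by
      calc H * (6 * (H ^ 2 * S)) ≤ K * ε ^ 2 := by linarith
        _ = ε * (K * ε) := by ring
        _ ≤ H * (K * ε) := by gcongr
    have h5 := le_of_mul_le_mul_left h4 hH0
    have h6 : H ^ 2 * s ≤ H ^ 2 * S := by gcongr
    nlinarith
  have t2 : 3 * H * (2 * (2 * c * (√(H ^ 4 * A * ι) + √(H ^ 4 * B * ι))) * √(s * K))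
      ≤ K * ε / 2 := by
    have hA' : √(H ^ 4 * A * ι) ≤ √(H ^ 4 * (A + B) * ι) := by
      gcongr
      linarith
    have hB' : √(H ^ 4 * B * ι) ≤ √(H ^ 4 * (A + B) * ι) := by
      gcongr
      linarith
    have hs' : √(s * K) ≤ √(S * K) := by gcongr
    calc _ ≤ 3 * H * (2 * (2 * c * (√(H ^ 4 * (A + B) * ι) + √(H ^ 4 * (A + B) * ι))) * √(S * K)) := by
          gcongr
      _ = 24 * c * (H * (√(H ^ 4 * (A + B) * ι) * √(S * K))) := by ring
      _ = 24 * c * √(H ^ 6 * S * (A + B) * ι * K) := by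
          rw [← Real.sqrt_mul (by positivity)]
          nth_rw 1 [← Real.sqrt_sq hH0.le]
          rw [← Real.sqrt_mul (by positivity)]
          congr 2
          ring
      _ ≤ K * ε / 2 := by
          have h1 : 2304 * c ^ 2 * (H ^ 6 * S * (A + B) * ι) ≤ K * ε ^ 2 := by
            refine (mul_le_mul_of_nonneg_right ?_ hX0).trans hX
            linarith
          have h2 : √(H ^ 6 * S * (A + B) * ι * K) ≤ K * ε / (48 * c) := by
            refine Real.sqrt_le_iff.2 ⟨by positivity, ?_⟩
            rw [div_pow, le_div_iff₀ (by positivity)]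
            nlinarith
          calc _ ≤ 24 * c * (K * ε / (48 * c)) := by gcongr
            _ = _ := by
              field_simp
              norm_num
  rw [inv_mul_le_iff₀ hK0, mul_add]
  linarith

end NashV

open NashV in
theorem mainTheorem2 :
    ∃ c₀ : ℝ, 0 < c₀ ∧ ∀ c : ℝ, c₀ ≤ c → ∃ C : ℝ, 0 < C ∧
      ∀ (𝒮 : Type u) (𝒜 : Type v) (ℬ : Type w)
        [Fintype 𝒮] [DecidableEq 𝒮]
        [Fintype 𝒜] [Nonempty 𝒜] [DecidableEq 𝒜]
        [Fintype ℬ] [Nonempty ℬ] [DecidableEq ℬ]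
        (G : NashV.MarkovGame 𝒮 𝒜 ℬ) (S : ℕ), Fintype.card 𝒮 ≤ S →
      ∀ (K : ℕ) [NeZero K] (p ε ι : ℝ), 0 < p → p ≤ 1 → 0 < ε →
        ι = Real.log ((S : ℝ) * Fintype.card 𝒜 * Fintype.card ℬ * (G.H * K) / p) →
        C * ((G.H : ℝ) ^ 6 * S * (Fintype.card 𝒜 + Fintype.card ℬ) * ι / ε ^ 2) ≤ K →
        ENNReal.ofReal (1 - p) ≤ (G.run c ι K).toOuterMeasure
          {ω | G.IsApproxNash ε (G.certifiedMax c ι ω) (G.certifiedMin c ι ω)} := by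
  refine ⟨25, by norm_num, fun c hc => ⟨2304 * c ^ 2 + 6, by positivity, ?_⟩⟩
  intro 𝒮 𝒜 ℬ _ _ _ _ _ _ _ _ G S hS K _ p ε ι hp hp1 hε hιdef hK
  have htriv : (∀ ω : Fin K → Fin G.H → Transition 𝒮 𝒜 ℬ,
      G.IsApproxNash ε (G.certifiedMax c ι ω) (G.certifiedMin c ι ω)) →
      ENNReal.ofReal (1 - p) ≤ (G.run c ι K).toOuterMeasure
          {ω | G.IsApproxNash ε (G.certifiedMax c ι ω) (G.certifiedMin c ι ω)} := fun h =>
    ofReal_one_sub_le_toOuterMeasure (κ := Empty) _ _ (fun _ _ => False) p 0 (fun i => i.elim)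
      (by simpa using hp.le) fun ω _ _ => h ω
  rcases le_or_gt (G.H : ℝ) ε with hεH | hεH
  · exact htriv fun ω => G.isApproxNash_of_horizon_le hεH _ _
  have hHpos : 0 < G.H := by
    have : (0 : ℝ) < G.H := hε.trans hεH
    exact_mod_cast this
  have hApos := Fintype.card_pos (α := 𝒜)
  have hBpos := Fintype.card_pos (α := ℬ)
  have hKpos : 0 < K := Nat.pos_of_ne_zero (NeZero.ne K)
  have hSpos : 0 < S := by
    have : Nonempty 𝒮 := ⟨G.s₁⟩
    exact (Fintype.card_pos (α := 𝒮)).trans_le hS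
  -- With a single action on each side `ι` may be as small as `0`. In all other cases `A B ≥ 2`,
  -- which gives `log 2 ≤ ι`.
  by_cases hAB : Fintype.card 𝒜 * Fintype.card ℬ ≤ 1
  · have hA1 : Fintype.card 𝒜 ≤ 1 := by nlinarith
    have hB1 : Fintype.card ℬ ≤ 1 := by nlinarith
    have : Subsingleton 𝒜 := Fintype.card_le_one_iff_subsingleton.1 hA1
    have : Subsingleton ℬ := Fintype.card_le_one_iff_subsingleton.1 hB1
    exact htriv fun ω => G.isApproxNash_of_subsingleton hε.le _ _
  rw [not_le] at hAB
  have hHr : (1 : ℝ) ≤ G.H := by exact_mod_cast hHpos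
  have hAr : (1 : ℝ) ≤ Fintype.card 𝒜 := by exact_mod_cast hApos
  have hBr : (1 : ℝ) ≤ Fintype.card ℬ := by exact_mod_cast hBpos
  have hKr : (1 : ℝ) ≤ K := by exact_mod_cast hKpos
  have hSr : (1 : ℝ) ≤ S := by exact_mod_cast hSpos
  set A : ℝ := (Fintype.card 𝒜 : ℝ) with hAdef
  set B : ℝ := (Fintype.card ℬ : ℝ) with hBdef
  have hAB2 : 2 ≤ A * B := by
    rw [hAdef, hBdef]
    exact_mod_cast hAB
  set M : ℝ := (S : ℝ) * A * B * (G.H * K) with hM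
  have hMAB : A * B ≤ M := by
    have h1 : (1 : ℝ) ≤ S * (G.H * K) := one_le_mul_of_one_le_of_one_le hSr
      (one_le_mul_of_one_le_of_one_le hHr hKr)
    calc A * B ≤ A * B * (S * (G.H * K)) := le_mul_of_one_le_right (by positivity) h1
      _ = M := by rw [hM]; ring
  have hM2 : 2 ≤ M := hAB2.trans hMAB
  have hMp : M ≤ M / p := by
    rw [le_div_iff₀ hp]
    exact mul_le_of_le_one_right (by linarith) hp1
  have hι : Real.log 2 ≤ ι := by
    rw [hιdef]
    exact Real.log_le_log two_pos (hM2.trans hMp)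
  have hA : Real.log A ≤ ι := by
    rw [hιdef]
    refine Real.log_le_log (by linarith) (le_trans ?_ (hMAB.trans hMp))
    exact le_mul_of_one_le_right (by linarith) hBr
  have hB : Real.log B ≤ ι := by
    rw [hιdef]
    refine Real.log_le_log (by linarith) (le_trans ?_ (hMAB.trans hMp))
    exact le_mul_of_one_le_left (by linarith) hAr
  have hι0 : 0 ≤ ι := (Real.log_nonneg one_le_two).trans hι
  have hc0 : 0 < c := by linarith
  -- With `M = S A B H K` there are at most `4 M` events, each of probability at most `exp (-3ι) =
  -- (p / M)³`. The total is at most `p` because `M ≥ 2`; level `ι` would not absorb the factor `4`.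
  refine ofReal_one_sub_le_toOuterMeasure (κ := (Fin G.H × 𝒮 × Bool × Fin K) × (𝒜 ⊕ ℬ)) _ _
    (fun i ω => 3 * ι < ∑ j : Fin K, G.deviation ι i
      (G.maxTables c ι ω j) (G.minTables c ι ω j) (ω j)) p (Real.exp (-(3 * ι)))
    (fun i => ex_indicator_le_exp _ _ _ (G.ex_run_exp_deviation_le hc0.le hι0 i)) ?_
    fun ω hω hgood => ?_
  · have hexp : Real.exp (-(3 * ι)) = (p / M) ^ 3 := by
      have : Real.exp ι = M / p := by
        rw [hιdef, Real.exp_log (by positivity)]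
      rw [Real.exp_neg, show (3 : ℝ) * ι = (3 : ℕ) * ι by norm_num, Real.exp_nat_mul, this,
        ← inv_pow, inv_div]
    have hcard : (Fintype.card ((Fin G.H × 𝒮 × Bool × Fin K) × (𝒜 ⊕ ℬ)) : ℝ) ≤ 4 * M := by
      simp only [Fintype.card_prod, Fintype.card_sum, Fintype.card_fin, Fintype.card_bool,
        Nat.cast_mul, Nat.cast_add, Nat.cast_ofNat]
      rw [← hAdef, ← hBdef]
      have hS' : (Fintype.card 𝒮 : ℝ) ≤ S := by exact_mod_cast hS
      have hsum : A + B ≤ 2 * (A * B) := by nlinarith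
      calc (G.H : ℝ) * (Fintype.card 𝒮 * (2 * K)) * (A + B)
          ≤ G.H * (S * (2 * K)) * (2 * (A * B)) := by gcongr
        _ = 4 * M := by rw [hM]; ring
    rw [hexp]
    have hM0 : 0 < M := by linarith
    calc _ ≤ 4 * M * (p / M) ^ 3 := by gcongr
      _ = p * (p ^ 2 * (4 / M ^ 2)) := by
        field_simp
      _ ≤ p := by
        refine mul_le_of_le_one_right hp.le (mul_le_one₀ (pow_le_one₀ hp.le hp1) (by positivity) ?_)
        rw [div_le_one (by positivity)]
        nlinarith
  · have hgap := G.bestResponseGap_le ω hc hι hA hB fun i => not_lt.1 (hgood i)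
    refine hgap.trans ((mul_le_mul_of_nonneg_left
      (G.sum_estimateGap_le ω hc0.le hι0 hHpos hω) (by positivity)).trans ?_)
    exact gap_bound_le hc0 hHr hKr hAr hBr hι hε hεH.le (Nat.cast_nonneg _)
      (by exact_mod_cast hS) hK
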